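/- **Lemma (boundary gradient estimate).** Let $n\ge 3$, let $\Omega\subset\mathbb R^n$ be a smooth bounded domain, and let $f:\mathbb R^k\to[0,\infty)$ be smooth, such that $\mathcal N=\{f=0\}$ is a smooth compact submanifold of $\mathbb R^k$ and $f$ vanishes non-degenerately on $\mathcal N$, i.e. $\nabla^2f(z)v\cdot v>0$ for all $z\in\mathcal N$ and $v\in(T_z\mathcal N)^\perp\setminus\{0\}$. For $\varepsilon>0$ write $e_\varepsilon(u)=\frac12|\nabla u|^2+\frac1{\varepsilon^2}f(u)$. Let $n<p<\infty$. There exist $\delta>0$ and $C>0$, depending only on $p$, $f$ and $\Omega$, such that the following holds for all $x_0\in\overline\Omega$, all $r,\varepsilon\in(0,1]$, all boundary data $u_b\in C^2(\partial\Omega;\mathcal N)$ and every smooth solution $u$ (that is, $u\in C^\infty(\Omega;\mathbb R^k)\cap C^1(\overline\Omega;\mathbb R^k)$) of $$\Delta u=\frac1{\varepsilon^2}\nabla f(u)\ \text{ in }\Omega,\qquad u=u_b\ \text{ on }\partial\Omega .$$ If $\operatorname{dist}(u,\mathcal N)\le\delta$ in $B_r(x_0)\cap\Omega$, then $$\sup_{B_{r/2}(x_0)\cap\partial\Omega}|\nabla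 u|\le C\Big(r^{1-\frac np}\|e_{\varepsilon/r}(u)\|_{L^p(B_r(x_0)\cap\Omega)}+r^{-\frac n2}\|\nabla u\|_{L^2(B_r(x_0)\cap\Omega)}+\sup_{\partial\Omega}|\nabla_{\partial\Omega}u_b|+r\sup_{\partial\Omega}|\nabla^2_{\partial\Omega}u_b|+\frac\delta r\Big),$$ where $\nabla_{\partial\Omega}u_b$ and $\nabla^2_{\partial\Omega}u_b$ denote the tangential gradient and the (covariant) Hessian of $u_b$ on the hypersurface $\partial\Omega$ (the supremum on the left is over a possibly empty set, in which case nothing is claimed). -/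

import Mathlib

open Set Filter Topology MeasureTheory Metric
open scoped ContDiff

noncomputable section

namespace GinzburgLandau

/-- `Ω ⊆ ℝⁿ` is a smooth bounded domain: open, connected (in particular non-empty), bounded, and
near each boundary point it is the sublevel set `{φ < 0}` of a smooth function `φ` with
`dφ ≠ 0` at that point. -/
structure IsSmoothBoundedDomain {n : ℕ} (Ω : Set (EuclideanSpace ℝ (Fin n))) : Prop where
  isOpen : IsOpen Ω
  isConnected : IsConnected Ω
  isBounded : Bornology.IsBounded Ω
  smooth_frontier : ∀ x ∈ frontier Ω, ∃ U ∈ 𝓝 x, ∃ φ : EuclideanSpace ℝ (Fin n) → ℝ,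
    ContDiff ℝ ∞ φ ∧ fderiv ℝ φ x ≠ 0 ∧ ∀ y ∈ U, (y ∈ Ω ↔ φ y < 0)

/-- `N ⊆ ℝᵏ` is a smooth (embedded, boundaryless) submanifold: for a fixed codimension `c` it is,
near each of its points, the zero set of a smooth `ℝᶜ`-valued map with surjective differential at
that point. -/
def IsSmoothSubmanifold {k : ℕ} (N : Set (EuclideanSpace ℝ (Fin k))) : Prop :=
  ∃ c : ℕ, ∀ x ∈ N, ∃ U ∈ 𝓝 x, ∃ Φ : EuclideanSpace ℝ (Fin k) → EuclideanSpace ℝ (Fin c),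
    ContDiff ℝ ∞ Φ ∧ Function.Surjective (fderiv ℝ Φ x) ∧ ∀ y ∈ U, (y ∈ N ↔ Φ y = 0)

/-- The vacuum `{f = 0}` of a potential. -/
def vacuum {k : ℕ} (f : EuclideanSpace ℝ (Fin k) → ℝ) : Set (EuclideanSpace ℝ (Fin k)) :=
  {z | f z = 0}

/-- The normal space `(T_z N)^⊥`; for a submanifold `N` the tangent cone at `z ∈ N` is the tangent
space `T_z N`. -/
def normalSpace {k : ℕ} (N : Set (EuclideanSpace ℝ (Fin k))) (z : EuclideanSpace ℝ (Fin k)) :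
    Set (EuclideanSpace ℝ (Fin k)) :=
  {v | ∀ w ∈ tangentConeAt ℝ N z, inner ℝ v w = 0}

/-- A smooth potential `f : ℝᵏ → [0,∞)` whose vacuum is a smooth compact submanifold on which `f`
vanishes non-degenerately: `∇²f(z) v · v > 0` for `z` in the vacuum and normal `v ≠ 0`. -/
structure IsNondegeneratePotential {k : ℕ} (f : EuclideanSpace ℝ (Fin k) → ℝ) : Prop where
  smooth : ContDiff ℝ ∞ f
  nonneg : ∀ z, 0 ≤ f z
  isCompact_vacuum : IsCompact (vacuum f)
  submanifold_vacuum : IsSmoothSubmanifold (vacuum f)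
  nondegenerate : ∀ z ∈ vacuum f, ∀ v ∈ normalSpace (vacuum f) z, v ≠ 0 →
    0 < fderiv ℝ (fderiv ℝ f) z v v

/-- The Euclidean (Frobenius) norm of a linear map: `(∑ᵢ |A eᵢ|²)^{1/2}`. -/
def frobNorm {n k : ℕ} (A : EuclideanSpace ℝ (Fin n) →L[ℝ] EuclideanSpace ℝ (Fin k)) : ℝ :=
  Real.sqrt (∑ i : Fin n, ‖A (EuclideanSpace.single i 1)‖ ^ 2)

/-- The energy density `e_ε(u) = ½ |∇u|² + ε⁻² f(u)`, at interior points. -/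
def energyDensity {n k : ℕ} (f : EuclideanSpace ℝ (Fin k) → ℝ) (ε : ℝ)
    (u : EuclideanSpace ℝ (Fin n) → EuclideanSpace ℝ (Fin k)) (x : EuclideanSpace ℝ (Fin n)) : ℝ :=
  1 / 2 * frobNorm (fderiv ℝ u x) ^ 2 + 1 / ε ^ 2 * f (u x)

/-- A point of `S` nearest to `y`. If `S` is a compact smooth hypersurface, it exists, and it is
unique and depends smoothly on `y` when `y` is close to `S`. -/
def nearestPoint {n : ℕ} (S : Set (EuclideanSpace ℝ (Fin n))) (y : EuclideanSpace ℝ (Fin n)) :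
    EuclideanSpace ℝ (Fin n) :=
  Classical.epsilon fun z => z ∈ S ∧ dist y z = infDist y S

/-- The extension of `g : S → ℝᵏ` that is constant along the normals of `S`. -/
def normalExtension {n k : ℕ} (S : Set (EuclideanSpace ℝ (Fin n)))
    (g : EuclideanSpace ℝ (Fin n) → EuclideanSpace ℝ (Fin k)) :
    EuclideanSpace ℝ (Fin n) → EuclideanSpace ℝ (Fin k) :=
  fun y => g (nearestPoint S y)

/-- `|∇_S g|(x)` for a function `g` on a compact smooth hypersurface `S` and `x ∈ S`: the
derivative at `x` of the normally constant extension is the tangential derivative composed with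
the orthogonal projection on `T_x S`. -/
def tangentialGradNorm {n k : ℕ} (S : Set (EuclideanSpace ℝ (Fin n)))
    (g : EuclideanSpace ℝ (Fin n) → EuclideanSpace ℝ (Fin k))
    (x : EuclideanSpace ℝ (Fin n)) : ℝ :=
  frobNorm (fderiv ℝ (normalExtension S g) x)

/-- `|∇²_S g|(x)` for a function `g` on a compact smooth hypersurface `S` and `x ∈ S`: the
second derivative at `x` of the normally constant extension, restricted to `T_x S`, is the
(covariant) Hessian of `g` on `S`; the derivative at `x` of the nearest point map is the
orthogonal projection on `T_x S`. -/
def tangentialHessNorm {n k : ℕ} (S : Set (EuclideanSpace ℝ (Fin n)))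
    (g : EuclideanSpace ℝ (Fin n) → EuclideanSpace ℝ (Fin k))
    (x : EuclideanSpace ℝ (Fin n)) : ℝ :=
  Real.sqrt (∑ i : Fin n, ∑ j : Fin n,
    ‖fderiv ℝ (fderiv ℝ (normalExtension S g)) x
      (fderiv ℝ (nearestPoint S) x (EuclideanSpace.single i 1))
      (fderiv ℝ (nearestPoint S) x (EuclideanSpace.single j 1))‖ ^ 2)

/-- `g` is a function of class `C²` on `S`: near each point of `S` it is the restriction of a `C²`
function on an open set. -/
def IsC2On {n k : ℕ} (S : Set (EuclideanSpace ℝ (Fin n)))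
    (g : EuclideanSpace ℝ (Fin n) → EuclideanSpace ℝ (Fin k)) : Prop :=
  ∀ x ∈ S, ∃ G : EuclideanSpace ℝ (Fin n) → EuclideanSpace ℝ (Fin k),
    ContDiffAt ℝ 2 G x ∧ G =ᶠ[𝓝[S] x] g

/-- `u` is a smooth solution of `Δu = ε⁻² ∇f(u)` in `Ω` with `u = u_b` on `∂Ω`: smooth in `Ω` and
of class `C¹` up to the boundary. -/
structure IsSmoothSolution {n k : ℕ} (Ω : Set (EuclideanSpace ℝ (Fin n)))
    (f : EuclideanSpace ℝ (Fin k) → ℝ) (ε : ℝ)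
    (ub u : EuclideanSpace ℝ (Fin n) → EuclideanSpace ℝ (Fin k)) : Prop where
  smooth : ContDiffOn ℝ ∞ u Ω
  contDiffOn_closure : ContDiffOn ℝ 1 u (closure Ω)
  eqn : ∀ x ∈ Ω, Laplacian.laplacian u x = (1 / ε ^ 2) • gradient f (u x)
  boundary : ∀ x ∈ frontier Ω, u x = ub x

end GinzburgLandau

end

/-! Fix y on the boundary with inner unit normal ν. The tangential part of ∇u at y is that of the
boundary data, so only the normal derivative has to be estimated. It comes from a comparison
argument for one scalar function from which ε disappears.

Near its vacuum, √f behaves like a distance function. `exists_sqrt_semiconvex` makes this precise: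
2√f ≤ K|∇f|, and D²√f is bounded below where f > 0. For |e| ≤ 1 let h = ⟨u − u(y) − L(x − y), e⟩ +
K√f(u) − A₀|x − y|². The equation gives Δ⟨u, e⟩ ≥ −ε⁻²|∇f(u)|, and the chain rule gives Δ√f(u) ≥
−C|∇u|² + ε⁻²|∇f(u)|²/(2√f(u)). By the first inequality, K times the last term absorbs the bad one,
so Δh ≥ −(KC|∇u|² + 2nA₀) whatever ε is (`not_isLocalMax_testFunction`).

On ∂Ω the term √f(u) vanishes. With L the tangential derivative of the data, the remaining bracket
is at most τ|x − y|² (`norm_boundary_taylor_le`). On |x − y| = s the function u is bounded, since it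
stays near a compact vacuum. Taking A₀ = τ + b/s² + ℓ/s makes h ≤ 0 on the boundary of Ω ∩ B_s(y).

So h lies below any non-negative w with −Δw > KC|∇u|² + 2nA₀. `exists_barrier` builds w as a Green
potential of the exterior of a ball touching Ω at y from outside (`exists_uniform_geometry`). The
Green kernel at y + tν is at most Ct|y + tν − z|^(1−n), and Hölder's inequality with p > n gives w(y
+ tν) ≤ Ct(s^(1−n/p)‖F‖_p + As), where F = KC|∇u|² and A = 2nA₀. Dividing by t and letting t → 0
bounds the normal derivative. The energy density enters through |∇u|² ≤ 2e, true for every ε. With s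
comparable to r, the term δ/r comes from b/s. The L² term of the statement is not needed.

The kernel is regularised at a scale η, so that w can be differentiated under the integral sign. The
price is that the strict inequality for Δw holds only on a prescribed compact subset. That suffices,
because {h ≥ τ'} is compact inside the open region for each level τ' > 0. -/

noncomputable section

namespace GinzburgLandau

/-! ### Local-to-uniform principles and the second derivative test -/

section

/-- A property that gets weaker as its constant grows, and that holds near every point of a compact
set with some constant, holds on the whole set with a common constant. -/
theorem exists_uniform_of_locally {X : Type*} [TopologicalSpace X] {S : Set X} (hS : IsCompact S)
    (P : ℝ → X → Prop) (mono : ∀ x c c', c ≤ c' → P c x → P c' x)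
    (loc : ∀ x ∈ S, ∃ c, ∀ᶠ y in 𝓝[S] x, P c y) : ∃ c, ∀ x ∈ S, P c x := by
  have := hS.induction_on (p := fun T => ∃ c, ∀ x ∈ T, P c x) ⟨1, by simp⟩
    (fun s t hst ⟨c, h⟩ => ⟨c, fun x hx => h x (hst hx)⟩)
    (fun s t ⟨c, h⟩ ⟨d, h'⟩ => ⟨max c d, fun x hx => hx.elim
      (fun hx => mono x c _ (le_max_left _ _) (h x hx))
      (fun hx => mono x d _ (le_max_right _ _) (h' x hx))⟩)
    (fun x hx => by
      obtain ⟨c, h⟩ := loc x hx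
      exact ⟨_, h, c, fun y hy => hy⟩)
  exact this

/-- The version for constants that improve as they shrink: finitely many local constants have a
positive minimum. -/
theorem exists_uniform_pos_of_locally {X : Type*} [TopologicalSpace X] {S : Set X}
    (hS : IsCompact S) (P : ℝ → X → Prop) (mono : ∀ x c c', 0 < c' → c' ≤ c → P c x → P c' x)
    (loc : ∀ x ∈ S, ∃ c, 0 < c ∧ ∀ᶠ y in 𝓝[S] x, P c y) : ∃ c, 0 < c ∧ ∀ x ∈ S, P c x := by
  have := hS.induction_on (p := fun T => ∃ c, 0 < c ∧ ∀ x ∈ T, P c x) ⟨1, one_pos, by simp⟩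
    (fun s t hst ⟨c, hc, h⟩ => ⟨c, hc, fun x hx => h x (hst hx)⟩)
    (fun s t ⟨c, hc, h⟩ ⟨d, hd, h'⟩ => ⟨min c d, lt_min hc hd, fun x hx => hx.elim
      (fun hx => mono x c _ (lt_min hc hd) (min_le_left _ _) (h x hx))
      (fun hx => mono x d _ (lt_min hc hd) (min_le_right _ _) (h' x hx))⟩)
    (fun x hx => by
      obtain ⟨c, hc, h⟩ := loc x hx
      exact ⟨_, h, c, hc, fun y hy => hy⟩)
  exact this

/-- The necessary second-order condition at a local maximum. -/
theorem second_deriv_nonpos_of_isLocalMax {φ φ₁ : ℝ → ℝ} {c : ℝ}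
    (h₁ : ∀ᶠ τ in 𝓝 (0 : ℝ), HasDerivAt φ (φ₁ τ) τ) (h₂ : HasDerivAt φ₁ c 0)
    (hmax : IsLocalMax φ 0) : c ≤ 0 := by
  by_contra! hc
  have hd : deriv φ =ᶠ[𝓝 0] φ₁ := h₁.mono fun τ h => h.deriv
  have hdd : deriv (deriv φ) 0 = c := by rw [hd.deriv_eq, h₂.deriv]
  -- If c > 0, the maximum is also a local minimum, so φ is constant near 0 and c = 0.
  have hmin := isLocalMin_of_deriv_deriv_pos (hdd ▸ hc) hmax.deriv_eq_zero
    h₁.self_of_nhds.continuousAt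
  have hconst : φ =ᶠ[𝓝 0] fun _ => φ 0 := by
    filter_upwards [hmin, hmax] with τ h h' using le_antisymm h' h
  have : deriv (deriv φ) 0 = 0 := by
    rw [hconst.deriv.deriv_eq]; simp
  linarith

/-! ### The regularised Newtonian kernel -/

section Kernel

set_option linter.unusedSectionVars false

variable {E : Type*} [NormedAddCommGroup E] [InnerProductSpace ℝ E]

/-- The regularised Newtonian kernel `(|x|² + η²)^{-a}`. -/
def regKernel (a η : ℝ) (x : E) : ℝ := (‖x‖ ^ 2 + η ^ 2) ^ (-a)

/-- The derivative of the regularised kernel in direction `e`. -/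
def regKernelDeriv (a η : ℝ) (e x : E) : ℝ :=
  -(2 * a) * inner ℝ x e * (‖x‖ ^ 2 + η ^ 2) ^ (-a - 1)

/-- The second derivative of the regularised kernel in direction `e`. -/
def regKernelDeriv₂ (a η : ℝ) (e x : E) : ℝ :=
  -(2 * a) * ‖e‖ ^ 2 * (‖x‖ ^ 2 + η ^ 2) ^ (-a - 1) +
    4 * a * (a + 1) * inner ℝ x e ^ 2 * (‖x‖ ^ 2 + η ^ 2) ^ (-a - 2)

variable {a η : ℝ}

theorem hasDerivAt_sq_norm_line (x e : E) (τ : ℝ) :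
    HasDerivAt (fun τ : ℝ => ‖x + τ • e‖ ^ 2 + η ^ 2) (2 * inner ℝ (x + τ • e) e) τ := by
  have h : HasDerivAt (fun τ : ℝ => x + τ • e) e τ := by
    simpa using ((hasDerivAt_id τ).smul_const e).const_add x
  simpa using h.norm_sq.add_const (η ^ 2)

theorem sq_norm_add_sq_pos (hη : 0 < η) (x : E) : 0 < ‖x‖ ^ 2 + η ^ 2 := by positivity

theorem hasDerivAt_regKernel (hη : 0 < η) (x e : E) (τ : ℝ) :
    HasDerivAt (fun τ : ℝ => regKernel a η (x + τ • e)) (regKernelDeriv a η e (x + τ • e)) τ := by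
  have := (hasDerivAt_sq_norm_line (η := η) x e τ).rpow_const (p := -a)
    (Or.inl (sq_norm_add_sq_pos hη _).ne')
  unfold regKernel regKernelDeriv
  convert this using 1
  ring

theorem hasDerivAt_regKernelDeriv (hη : 0 < η) (x e : E) (τ : ℝ) :
    HasDerivAt (fun τ : ℝ => regKernelDeriv a η e (x + τ • e))
      (regKernelDeriv₂ a η e (x + τ • e)) τ := by
  have h1 := (hasDerivAt_sq_norm_line (η := η) x e τ).rpow_const (p := -a - 1)
    (Or.inl (sq_norm_add_sq_pos hη _).ne')
  have h : HasDerivAt (fun τ : ℝ => x + τ • e) e τ := by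
    simpa using ((hasDerivAt_id τ).smul_const e).const_add x
  have h2 : HasDerivAt (fun τ : ℝ => inner ℝ (x + τ • e) e) (‖e‖ ^ 2) τ := by
    simpa using h.inner ℝ (hasDerivAt_const τ e)
  have := (h2.const_mul (-(2 * a))).mul h1
  unfold regKernelDeriv regKernelDeriv₂
  refine this.congr_deriv ?_
  rw [show -a - 1 - 1 = -a - 2 by ring]
  ring

theorem regKernel_pos (hη : 0 < η) (x : E) : 0 < regKernel a η x :=
  Real.rpow_pos_of_pos (sq_norm_add_sq_pos hη x) _

theorem rpow_neg_sq_norm_le (hη : 0 < η) {b : ℝ} (hb : 0 ≤ b) (x : E) :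
    (‖x‖ ^ 2 + η ^ 2) ^ (-b) ≤ (η ^ 2) ^ (-b) :=
  Real.rpow_le_rpow_of_nonpos (by positivity) (by nlinarith [sq_nonneg ‖x‖]) (by linarith)

theorem regKernel_le (ha : 0 ≤ a) (hη : 0 < η) (x : E) : regKernel a η x ≤ (η ^ 2) ^ (-a) :=
  rpow_neg_sq_norm_le hη ha x

theorem abs_regKernelDeriv_le (ha : 0 ≤ a) (hη : 0 < η) {e : E} (he : ‖e‖ = 1) (x : E) :
    |regKernelDeriv a η e x| ≤ 2 * a * (η ^ 2) ^ (-a - 1) + 2 * a * (η ^ 2) ^ (-a) := by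
  have hq := sq_norm_add_sq_pos hη x
  have h1 : |inner ℝ x e| ≤ ‖x‖ := by simpa [he] using abs_real_inner_le_norm x e
  have h2 : ‖x‖ ≤ 1 + (‖x‖ ^ 2 + η ^ 2) := by nlinarith [sq_nonneg (‖x‖ - 1), sq_nonneg ‖x‖]
  have h3 := rpow_neg_sq_norm_le hη (b := a + 1) (by linarith) x
  have h4 := rpow_neg_sq_norm_le hη ha x
  rw [show -(a + 1) = -a - 1 by ring] at h3
  have h5 : (‖x‖ ^ 2 + η ^ 2) * (‖x‖ ^ 2 + η ^ 2) ^ (-a - 1) = (‖x‖ ^ 2 + η ^ 2) ^ (-a) := by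
    rw [mul_comm, ← Real.rpow_add_one hq.ne']; congr 1; ring
  have h6 : 0 < (‖x‖ ^ 2 + η ^ 2) ^ (-a - 1) := Real.rpow_pos_of_pos hq _
  unfold regKernelDeriv
  rw [abs_mul, abs_mul, abs_neg, abs_of_nonneg (by linarith : 0 ≤ 2 * a), abs_of_pos h6]
  calc 2 * a * |inner ℝ x e| * (‖x‖ ^ 2 + η ^ 2) ^ (-a - 1)
      ≤ 2 * a * (1 + (‖x‖ ^ 2 + η ^ 2)) * (‖x‖ ^ 2 + η ^ 2) ^ (-a - 1) := by
        gcongr; linarith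
    _ = 2 * a * ((‖x‖ ^ 2 + η ^ 2) ^ (-a - 1) + (‖x‖ ^ 2 + η ^ 2) ^ (-a)) := by
        rw [← h5]; ring
    _ ≤ 2 * a * ((η ^ 2) ^ (-a - 1) + (η ^ 2) ^ (-a)) := by gcongr
    _ = _ := by ring

theorem abs_regKernelDeriv₂_le (ha : 0 ≤ a) (hη : 0 < η) {e : E} (he : ‖e‖ = 1) (x : E) :
    |regKernelDeriv₂ a η e x| ≤ (2 * a + 4 * a * (a + 1)) * (η ^ 2) ^ (-a - 1) := by
  have hq := sq_norm_add_sq_pos hη x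
  have h1 : |inner ℝ x e| ≤ ‖x‖ := by simpa [he] using abs_real_inner_le_norm x e
  have h3 := rpow_neg_sq_norm_le hη (b := a + 1) (by linarith) x
  rw [show -(a + 1) = -a - 1 by ring] at h3
  have h5 : (‖x‖ ^ 2 + η ^ 2) * (‖x‖ ^ 2 + η ^ 2) ^ (-a - 2) = (‖x‖ ^ 2 + η ^ 2) ^ (-a - 1) := by
    rw [mul_comm, ← Real.rpow_add_one hq.ne']; congr 1; ring
  have h6 : 0 < (‖x‖ ^ 2 + η ^ 2) ^ (-a - 2) := Real.rpow_pos_of_pos hq _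
  have h7 : inner ℝ x e ^ 2 ≤ ‖x‖ ^ 2 + η ^ 2 := by
    rw [← sq_abs (inner ℝ x e)]; nlinarith [abs_nonneg (inner ℝ x e), sq_nonneg η]
  have h8 : inner ℝ x e ^ 2 * (‖x‖ ^ 2 + η ^ 2) ^ (-a - 2) ≤ (η ^ 2) ^ (-a - 1) :=
    (mul_le_mul_of_nonneg_right h7 h6.le).trans (h5.trans_le h3)
  have h9 : 0 ≤ inner ℝ x e ^ 2 * (‖x‖ ^ 2 + η ^ 2) ^ (-a - 2) := by positivity
  have h10 : 0 < (‖x‖ ^ 2 + η ^ 2) ^ (-a - 1) := Real.rpow_pos_of_pos hq _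
  unfold regKernelDeriv₂
  rw [he, abs_le]
  have ha' : 0 ≤ 4 * a * (a + 1) := by positivity
  have m1 := mul_le_mul_of_nonneg_left h8 ha'
  have m2 := mul_nonneg ha' h9
  have m3 := mul_le_mul_of_nonneg_left h3 (by linarith : 0 ≤ 2 * a)
  have m4 := mul_nonneg (by linarith : 0 ≤ 2 * a) h10.le
  have m5 := mul_nonneg ha' (h10.le.trans h3)
  constructor <;> nlinarith

/-- The Laplacian of the regularised Newtonian kernel. -/
theorem sum_regKernelDeriv₂ {ι : Type*} [Fintype ι] (b : OrthonormalBasis ι ℝ E) (hη : 0 < η)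
    (ha : (Fintype.card ι : ℝ) = 2 * (a + 1)) (x : E) :
    ∑ i, regKernelDeriv₂ a η (b i) x =
      -(4 * a * (a + 1) * η ^ 2) * (‖x‖ ^ 2 + η ^ 2) ^ (-a - 2) := by
  have hq := sq_norm_add_sq_pos hη x
  have h5 : (‖x‖ ^ 2 + η ^ 2) * (‖x‖ ^ 2 + η ^ 2) ^ (-a - 2) = (‖x‖ ^ 2 + η ^ 2) ^ (-a - 1) := by
    rw [mul_comm, ← Real.rpow_add_one hq.ne']; congr 1; ring
  -- For n = 2(a + 1) the |x|² parts cancel, and only a bump of width η remains.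
  have h6 : ∑ i, inner ℝ x (b i) ^ 2 = ‖x‖ ^ 2 := by
    rw [← b.sum_sq_norm_inner_left x]; simp
  simp only [regKernelDeriv₂, b.norm_eq_one, Finset.sum_add_distrib, ← Finset.sum_mul,
    ← Finset.mul_sum, h6]
  simp only [Finset.sum_const, Finset.card_univ, nsmul_eq_mul, ha]
  rw [← h5]
  ring

end Kernel

end

/-! ### Normal vectors and nearest points on level sets -/

section

section Normal

set_option linter.unusedSectionVars false

variable {V W : Type*} [NormedAddCommGroup V] [InnerProductSpace ℝ V] [CompleteSpace V]
  [NormedAddCommGroup W] [NormedSpace ℝ W] [CompleteSpace W]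

/-- If `p` minimises the distance to `z` on a regular level set of `Φ`, then `z - p` is orthogonal
to the kernel of the differential of `Φ`. -/
theorem inner_sub_eq_zero_of_nearest {Φ : V → W} {Φ' : V →L[ℝ] W} {p z w : V}
    (hΦ : HasStrictFDerivAt Φ Φ' p) (hs : Function.Surjective Φ')
    (hmin : ∀ᶠ q in 𝓝 p, Φ q = Φ p → dist z p ≤ dist z q) (hw : Φ' w = 0) :
    inner ℝ (z - p) w = 0 := by
  have hφ : HasStrictFDerivAt (fun q : V => ‖q - z‖ ^ 2) (2 • innerSL ℝ (p - z)) p := by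
    have h := (hasStrictFDerivAt_norm_sq (p - z)).comp p
      ((hasStrictFDerivAt_id p).sub_const z)
    simpa using h
  have hext : IsLocalExtrOn (fun q : V => ‖q - z‖ ^ 2) {q | Φ q = Φ p} p := by
    left
    have : ∀ᶠ q in 𝓝[{q | Φ q = Φ p}] p, Φ q = Φ p → dist z p ≤ dist z q :=
      hmin.filter_mono nhdsWithin_le_nhds
    filter_upwards [this, self_mem_nhdsWithin] with q h hq
    have := h hq
    rw [dist_comm, dist_eq_norm, dist_comm, dist_eq_norm] at this
    gcongr
  -- Lagrange multipliers. Surjectivity of Φ' excludes Λ₀ = 0, so the differential of the squared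
  -- distance vanishes on the kernel of Φ'.
  obtain ⟨Λ, Λ₀, hne, h⟩ := hext.exists_linear_map_of_hasStrictFDerivAt hΦ hφ
  have hΛ₀ : Λ₀ ≠ 0 := by
    rintro rfl
    apply hne
    refine Prod.ext (LinearMap.ext fun y => ?_) rfl
    obtain ⟨x, rfl⟩ := hs y
    simpa using h x
  have := h w
  rw [hw] at this
  have h2 : inner ℝ (p - z) w = 0 := by
    simpa [hΛ₀, inner_sub_left] using this
  rw [← neg_sub, inner_neg_left, h2, neg_zero]

/-- A tangent vector of a regular level set extends to a continuous field of vectors annihilated by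
the differential. -/
theorem exists_continuous_kernel_field [FiniteDimensional ℝ W] {Φ' : V → V →L[ℝ] W} {p w : V}
    (hc : ContinuousAt Φ' p) (hs : Function.Surjective (Φ' p)) (hw : Φ' p w = 0) :
    ∃ X : V → V, ContinuousAt X p ∧ X p = w ∧
      ∀ᶠ q in 𝓝 p, Function.Surjective (Φ' q) ∧ Φ' q (X q) = 0 := by
  -- Near p the map B q = Φ' q ∘ R stays invertible, so R (B q)⁻¹ is a right inverse of Φ' q.
  -- Subtracting R (B q)⁻¹ Φ' q w from w lands in the kernel.
  obtain ⟨R, hR⟩ := (Φ' p).exists_rightInverse_of_surjective (LinearMap.range_eq_top.2 hs)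
  set B : V → W →L[ℝ] W := fun q => (Φ' q).comp R with hB
  have hB1 : B p = 1 := hR
  have hBc : ContinuousAt B p := hc.clm_comp continuousAt_const
  have hunit : ∀ᶠ q in 𝓝 p, IsUnit (B q) := by
    have : {b : W →L[ℝ] W | IsUnit b} ∈ 𝓝 (B p) := Units.isOpen.mem_nhds (by simp [hB1])
    exact hBc this
  have hinv : ContinuousAt (fun q => Ring.inverse (B q)) p := by
    have h1 : ContinuousAt Ring.inverse (B p) := by
      have := NormedRing.inverse_continuousAt (1 : (W →L[ℝ] W)ˣ)
      simpa [hB1] using this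
    exact ContinuousAt.comp (g := Ring.inverse) h1 hBc
  refine ⟨fun q => w - R (Ring.inverse (B q) (Φ' q w)), ?_, by simp [hw], ?_⟩
  · exact continuousAt_const.sub (R.continuous.continuousAt.comp
      (hinv.clm_apply (hc.clm_apply continuousAt_const)))
  · filter_upwards [hunit] with q hq
    have key : ∀ y, Φ' q (R (Ring.inverse (B q) y)) = y := fun y => by
      have := congrArg (fun T : W →L[ℝ] W => T y) (Ring.mul_inverse_cancel (B q) hq)
      exact this
    exact ⟨fun y => ⟨_, key y⟩, by rw [map_sub, key, sub_self]⟩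

end Normal

variable {k : ℕ}

/-- Limits of unit vectors pointing from nearest points are normal. -/
theorem mem_normalSpace_of_tendsto {N : Set (EuclideanSpace ℝ (Fin k))}
    (hN : IsSmoothSubmanifold N) {p e : ℕ → EuclideanSpace ℝ (Fin k)}
    {p₀ e₀ : EuclideanSpace ℝ (Fin k)} (hp₀ : p₀ ∈ N) (hpN : ∀ j, p j ∈ N)
    (hp : Tendsto p atTop (𝓝 p₀)) (he : Tendsto e atTop (𝓝 e₀))
    (hnear : ∀ j, ∃ z, ∃ s : ℝ, e j = s • (z - p j) ∧ dist z (p j) = infDist z N) :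
    e₀ ∈ normalSpace N p₀ := by
  obtain ⟨c, hN⟩ := hN
  obtain ⟨U, hU, Φ, hΦ, hs, hUN⟩ := hN p₀ hp₀
  intro w hw
  have hfd : Continuous (fderiv ℝ Φ) := hΦ.continuous_fderiv (by simp)
  have hΦ0 : Φ p₀ = 0 := (hUN _ (mem_of_mem_nhds hU)).1 hp₀
  -- Φ vanishes on N near p₀, so its derivative and 0 are both derivatives within N and agree on the
  -- tangent cone. Only this inclusion of the cone in the kernel is needed.
  have hker : fderiv ℝ Φ p₀ w = 0 := by
    have h1 : HasFDerivWithinAt Φ (fderiv ℝ Φ p₀) N p₀ :=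
      (hΦ.differentiable (by simp) p₀).hasFDerivAt.hasFDerivWithinAt
    have h2 : HasFDerivWithinAt Φ (0 : _ →L[ℝ] EuclideanSpace ℝ (Fin c)) N p₀ := by
      refine (hasFDerivWithinAt_const (0 : EuclideanSpace ℝ (Fin c)) p₀ N).congr_of_eventuallyEq
        ?_ hΦ0
      filter_upwards [mem_nhdsWithin_of_mem_nhds hU, self_mem_nhdsWithin] with q hq hqN
        using (hUN q hq).1 hqN
    simpa using h1.unique_on h2 hw
  -- w is tangent at p₀, while e j is normal at p j. The field X carries w to p j, where the inner
  -- product is exactly zero; continuity then gives the limit.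
  obtain ⟨X, hXc, hXw, hX⟩ := exists_continuous_kernel_field hfd.continuousAt hs hker
  have hlim : Tendsto (fun j => inner ℝ (e j) (X (p j))) atTop (𝓝 (inner ℝ e₀ w)) := by
    rw [← hXw]; exact he.inner (hXc.tendsto.comp hp)
  refine tendsto_nhds_unique hlim (tendsto_const_nhds.congr' ?_)
  filter_upwards [hp.eventually hX, hp.eventually (eventually_mem_nhds_iff.2 hU)] with j hj hjU
  obtain ⟨z, s, hes, hz⟩ := hnear j
  have hpj : Φ (p j) = 0 := (hUN _ (mem_of_mem_nhds hjU)).1 (hpN j)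
  rw [hes, inner_smul_left, inner_sub_eq_zero_of_nearest
    (hΦ.contDiffAt.hasStrictFDerivAt (by simp)) hj.1 ?_ hj.2, mul_zero]
  filter_upwards [hjU] with q hq hqp
  rw [hz]
  exact infDist_le_dist_of_mem ((hUN q hq).2 (hqp.trans hpj))

/-! ### The potential near its vacuum -/

namespace IsNondegeneratePotential

variable {f : EuclideanSpace ℝ (Fin k) → ℝ}

theorem contDiff_fderiv (hf : IsNondegeneratePotential f) : ContDiff ℝ ∞ (fderiv ℝ f) :=
  hf.smooth.fderiv_right (by simp)

theorem continuous_fderiv₂ (hf : IsNondegeneratePotential f) :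
    Continuous (fderiv ℝ (fderiv ℝ f)) := hf.contDiff_fderiv.continuous_fderiv (by simp)

/-- By contradiction and compactness: the unit vectors along z − p of a failing sequence converge to
a normal unit vector on which the Hessian is non-positive. Restricting to z whose nearest point is p
avoids any tubular neighbourhood. -/
theorem exists_coercive (hf : IsNondegeneratePotential f) :
    ∃ c : ℝ, 0 < c ∧ ∀ p ∈ vacuum f, ∀ z, dist z p = infDist z (vacuum f) → dist z p ≤ c →
      c * ‖z - p‖ ^ 2 ≤ fderiv ℝ (fderiv ℝ f) p (z - p) (z - p) := by
  refine exists_uniform_pos_of_locally hf.isCompact_vacuum _ (fun p c c' hc' hle h z hz hzc =>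
    (mul_le_mul_of_nonneg_right hle (sq_nonneg _)).trans (h z hz (hzc.trans hle))) ?_
  intro p₀ hp₀
  by_contra! hcon
  have hj : ∀ j : ℕ, ∃ p ∈ vacuum f, dist p p₀ < 1 / (j + 1 : ℝ) ∧
      ∃ z, dist z p = infDist z (vacuum f) ∧ dist z p ≤ 1 / (j + 1 : ℝ) ∧
      fderiv ℝ (fderiv ℝ f) p (z - p) (z - p) < 1 / (j + 1 : ℝ) * ‖z - p‖ ^ 2 := by
    intro j
    have hpos : 0 < 1 / (j + 1 : ℝ) := by positivity
    have h1 := hcon _ hpos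
    have h2 : ∀ᶠ p in 𝓝[vacuum f] p₀, p ∈ vacuum f ∧ dist p p₀ < 1 / (j + 1 : ℝ) :=
      Filter.Eventually.and self_mem_nhdsWithin
        (mem_nhdsWithin_of_mem_nhds (ball_mem_nhds p₀ hpos))
    obtain ⟨p, h3, h4, h5⟩ := (h1.and_eventually h2).exists
    exact ⟨p, h4, h5, h3⟩
  choose p hpN hpd z hz hzd hlt using hj
  set e : ℕ → EuclideanSpace ℝ (Fin k) := fun j => ‖z j - p j‖⁻¹ • (z j - p j) with he
  have hne : ∀ j, ‖z j - p j‖ ≠ 0 := by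
    intro j h0
    have := hlt j
    rw [norm_eq_zero.1 h0] at this
    simp at this
  have heS : ∀ j, e j ∈ sphere (0 : EuclideanSpace ℝ (Fin k)) 1 := by
    intro j
    simp [he, norm_smul, inv_mul_cancel₀ (hne j)]
  obtain ⟨e₀, he₀, ψ, hψ, hlim⟩ := (isCompact_sphere _ _).tendsto_subseq heS
  have h0 : Tendsto (fun j : ℕ => 1 / (j + 1 : ℝ)) atTop (𝓝 0) :=
    tendsto_one_div_add_atTop_nhds_zero_nat
  have hp : Tendsto p atTop (𝓝 p₀) :=
    tendsto_iff_dist_tendsto_zero.2 (squeeze_zero (fun _ => dist_nonneg) (fun j => (hpd j).le) h0)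
  have hpψ := hp.comp hψ.tendsto_atTop
  have hmem : e₀ ∈ normalSpace (vacuum f) p₀ :=
    mem_normalSpace_of_tendsto hf.submanifold_vacuum hp₀ (fun j => hpN (ψ j)) hpψ hlim
      fun j => ⟨z (ψ j), _, rfl, hz (ψ j)⟩
  have hpos := hf.nondegenerate p₀ hp₀ e₀ hmem (by rintro rfl; simp at he₀)
  have hlimA : Tendsto (fun j => fderiv ℝ (fderiv ℝ f) (p (ψ j)) (e (ψ j)) (e (ψ j))) atTop
      (𝓝 (fderiv ℝ (fderiv ℝ f) p₀ e₀ e₀)) := by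
    have h1 : Continuous fun q : EuclideanSpace ℝ (Fin k) × EuclideanSpace ℝ (Fin k) =>
        fderiv ℝ (fderiv ℝ f) q.1 q.2 q.2 :=
      ((hf.continuous_fderiv₂.comp continuous_fst).clm_apply continuous_snd).clm_apply
        continuous_snd
    exact (h1.tendsto (p₀, e₀)).comp (hpψ.prodMk_nhds hlim)
  have hle : fderiv ℝ (fderiv ℝ f) p₀ e₀ e₀ ≤ 0 := by
    refine le_of_tendsto_of_tendsto' hlimA (h0.comp hψ.tendsto_atTop) fun j => ?_
    have h1 := (hlt (ψ j)).le
    have h2 : 0 < ‖z (ψ j) - p (ψ j)‖ := (norm_nonneg _).lt_of_ne' (hne _)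
    simp only [he, map_smul, smul_apply, smul_eq_mul, Function.comp]
    rw [← mul_assoc, ← mul_inv, ← sq, inv_mul_le_iff₀ (by positivity), mul_comm]
    exact h1
  linarith

theorem fderiv₂_symm (hf : IsNondegeneratePotential f) (z v w : EuclideanSpace ℝ (Fin k)) :
    fderiv ℝ (fderiv ℝ f) z v w = fderiv ℝ (fderiv ℝ f) z w v :=
  ((contDiff_infty.1 hf.smooth 2).contDiffAt.isSymmSndFDerivAt (by simp)).eq v w

theorem fderiv_eq_zero (hf : IsNondegeneratePotential f) {p : EuclideanSpace ℝ (Fin k)}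
    (hp : p ∈ vacuum f) : fderiv ℝ f p = 0 := by
  refine IsLocalMin.fderiv_eq_zero (Eventually.of_forall fun z => ?_)
  have h : f p = 0 := hp
  rw [h]
  exact hf.nonneg z

/-- f and its differential vanish on the vacuum, so the Hessian gives the leading terms. M is
uniform because the closed 1-neighbourhood of the vacuum is compact. -/
theorem exists_taylor (hf : IsNondegeneratePotential f) :
    ∃ M : ℝ, 0 ≤ M ∧ ∀ p ∈ vacuum f, ∀ z, ‖z - p‖ ≤ 1 →
      ‖fderiv ℝ (fderiv ℝ f) p‖ ≤ M ∧
      ‖fderiv ℝ (fderiv ℝ f) z - fderiv ℝ (fderiv ℝ f) p‖ ≤ M * ‖z - p‖ ∧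
      ‖fderiv ℝ f z - fderiv ℝ (fderiv ℝ f) p (z - p)‖ ≤ M * ‖z - p‖ ^ 2 ∧
      |f z - 1 / 2 * fderiv ℝ (fderiv ℝ f) p (z - p) (z - p)| ≤ M * ‖z - p‖ ^ 3 := by
  have hK : IsCompact (cthickening 1 (vacuum f)) := hf.isCompact_vacuum.cthickening
  have hD2 : ContDiff ℝ ∞ (fderiv ℝ (fderiv ℝ f)) := hf.contDiff_fderiv.fderiv_right (by simp)
  obtain ⟨M₁, hM₁⟩ := hK.exists_bound_of_continuousOn
    (hD2.continuous_fderiv (by simp)).continuousOn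
  obtain ⟨M₂, hM₂⟩ := hK.exists_bound_of_continuousOn (f := fderiv ℝ (fderiv ℝ f))
    hD2.continuous.continuousOn
  refine ⟨max 0 (max M₁ M₂), le_max_left _ _, fun p hp z hz => ?_⟩
  set M := max 0 (max M₁ M₂)
  have hM0 : 0 ≤ M := le_max_left _ _
  have hM1 : M₁ ≤ M := (le_max_left _ _).trans (le_max_right _ _)
  have hM2 : M₂ ≤ M := (le_max_right _ _).trans (le_max_right _ _)
  have hsub : ∀ q ∈ closedBall p 1, q ∈ cthickening 1 (vacuum f) := fun q hq =>
    mem_cthickening_of_dist_le q p 1 _ hp hq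
  have hp1 : p ∈ closedBall p (1 : ℝ) := mem_closedBall_self zero_le_one
  have lip : ∀ q ∈ closedBall p (1 : ℝ),
      ‖fderiv ℝ (fderiv ℝ f) q - fderiv ℝ (fderiv ℝ f) p‖ ≤ M * ‖q - p‖ := fun q hq =>
    (convex_closedBall p 1).norm_image_sub_le_of_norm_fderiv_le
      (fun x _ => hD2.differentiable (by simp) x) (fun x hx => (hM₁ x (hsub x hx)).trans hM1) hp1 hq
  have hball : ∀ q ∈ closedBall p ‖z - p‖, q ∈ closedBall p (1 : ℝ) := fun q hq =>
    closedBall_subset_closedBall hz hq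
  have hzb : z ∈ closedBall p ‖z - p‖ := by simp [dist_eq_norm]
  have hpb : p ∈ closedBall p ‖z - p‖ := mem_closedBall_self (norm_nonneg _)
  have grad : ∀ q ∈ closedBall p ‖z - p‖,
      ‖fderiv ℝ f q - fderiv ℝ (fderiv ℝ f) p (q - p)‖ ≤ M * ‖z - p‖ ^ 2 := by
    intro q hq
    have hq' : ‖q - p‖ ≤ ‖z - p‖ := by simpa [dist_eq_norm] using hq
    have h := (convex_closedBall p ‖z - p‖).norm_image_sub_le_of_norm_fderiv_le'
      (f := fderiv ℝ f) (φ := fderiv ℝ (fderiv ℝ f) p) (C := M * ‖z - p‖)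
      (fun x _ => hf.contDiff_fderiv.differentiable (by simp) x)
      (fun x hx => (lip x (hball x hx)).trans (by
        have : ‖x - p‖ ≤ ‖z - p‖ := by simpa [dist_eq_norm] using hx
        gcongr)) hpb hq
    rw [hf.fderiv_eq_zero hp, sub_zero] at h
    refine h.trans ?_
    rw [sq, ← mul_assoc]
    gcongr
  refine ⟨(hM₂ p (hsub p hp1)).trans hM2, lip z (hball z hzb), grad z hzb, ?_⟩
  have hsymm : ∀ v w, fderiv ℝ (fderiv ℝ f) p v w = fderiv ℝ (fderiv ℝ f) p w v :=
    hf.fderiv₂_symm p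
  -- By symmetry of the Hessian, the differential of this remainder is the quantity bounded in
  -- `grad`; one more mean value inequality makes the bound cubic.
  have hder : ∀ q, HasFDerivAt
      (fun q => f q - 1 / 2 * fderiv ℝ (fderiv ℝ f) p (q - p) (q - p))
      (fderiv ℝ f q - fderiv ℝ (fderiv ℝ f) p (q - p)) q := by
    intro q
    have hid : HasFDerivAt (fun q => q - p) (ContinuousLinearMap.id ℝ _) q :=
      (hasFDerivAt_id q).sub_const p
    have h1 := ((fderiv ℝ (fderiv ℝ f) p).hasFDerivAt.comp q hid).clm_apply hid
    refine ((hf.smooth.differentiable (by simp) q).hasFDerivAt.sub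
      (h1.const_mul (1 / 2))).congr_fderiv ?_
    ext v
    have := hsymm v (q - p)
    simp only [map_sub, _root_.sub_apply] at this
    simp
    linarith
  have h := (convex_closedBall p ‖z - p‖).norm_image_sub_le_of_norm_hasFDerivWithin_le
    (fun x _ => (hder x).hasFDerivWithinAt) grad hpb hzb
  have hp0 : f p = 0 := hp
  simp only [hp0, sub_self, map_zero, mul_zero, sub_zero, Real.norm_eq_abs] at h
  refine h.trans (le_of_eq ?_)
  ring

theorem fderiv₂_nonneg (hf : IsNondegeneratePotential f) {p : EuclideanSpace ℝ (Fin k)}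
    (hp : p ∈ vacuum f) (v : EuclideanSpace ℝ (Fin k)) :
    0 ≤ fderiv ℝ (fderiv ℝ f) p v v := by
  have hline : ∀ τ : ℝ, HasDerivAt (fun τ : ℝ => p + τ • v) v τ := fun τ => by
    simpa using ((hasDerivAt_id τ).smul_const v).const_add p
  have h1 : ∀ τ : ℝ, HasDerivAt (fun τ : ℝ => -f (p + τ • v)) (-fderiv ℝ f (p + τ • v) v) τ :=
    fun τ => ((hf.smooth.differentiable (by simp) _).hasFDerivAt.comp_hasDerivAt τ (hline τ)).neg
  have h2 : HasDerivAt (fun τ : ℝ => -fderiv ℝ f (p + τ • v) v)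
      (-fderiv ℝ (fderiv ℝ f) p v v) 0 := by
    have h := (hf.contDiff_fderiv.differentiable (by simp) (p + (0 : ℝ) • v)).hasFDerivAt
      |>.comp_hasDerivAt 0 (hline 0)
    exact (h.clm_apply (hasDerivAt_const (0 : ℝ) v)).neg.congr_deriv (by simp)
  have hp0 : f p = 0 := hp
  have := second_deriv_nonpos_of_isLocalMax (Eventually.of_forall h1) h2
    (Eventually.of_forall fun τ => by simpa [hp0] using hf.nonneg _)
  linarith

/-- Cauchy–Schwarz for the Hessian at the vacuum. -/
theorem fderiv₂_sq_le (hf : IsNondegeneratePotential f) {p : EuclideanSpace ℝ (Fin k)}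
    (hp : p ∈ vacuum f) (v w : EuclideanSpace ℝ (Fin k)) :
    fderiv ℝ (fderiv ℝ f) p v w ^ 2 ≤
      fderiv ℝ (fderiv ℝ f) p v v * fderiv ℝ (fderiv ℝ f) p w w := by
  have hsymm : fderiv ℝ (fderiv ℝ f) p v w = fderiv ℝ (fderiv ℝ f) p w v :=
    hf.fderiv₂_symm p v w
  have h := discrim_le_zero (a := fderiv ℝ (fderiv ℝ f) p v v)
    (b := 2 * fderiv ℝ (fderiv ℝ f) p v w) (c := fderiv ℝ (fderiv ℝ f) p w w) fun t => by
      have := hf.fderiv₂_nonneg hp (t • v + w)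
      simp only [map_add, map_smul, _root_.add_apply, smul_apply, smul_eq_mul] at this
      rw [← hsymm] at this
      linarith
  unfold discrim at h
  linarith

/-- Here a, b, c are the Hessian at p on (m, m), (m, v), (v, v) with m = z − p, d = |m| and V = |v|;
E₁, E₂ and F − a/2 are Taylor errors. The leading part ac − b² is non-negative by Cauchy–Schwarz,
and every error has order at least d³. -/
theorem semiconvex_algebra {M d V a b c E₁ E₂ F : ℝ} (hM : 0 ≤ M) (hd0 : 0 ≤ d) (hd1 : d ≤ 1)
    (hV : 0 ≤ V) (hF : 0 ≤ F) (ha : a ≤ M * d ^ 2) (h₀ : |F - 1 / 2 * a| ≤ M * d ^ 3)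
    (h₁ : |E₁| ≤ M * d ^ 2 * V) (h₂ : |E₂| ≤ M * d * V * V) (hb : |b| ≤ M * d * V)
    (hc : |c| ≤ M * V * V) (cs : b ^ 2 ≤ a * c) :
    -(8 * M ^ 2 * d ^ 3 * V ^ 2) ≤ 2 * F * (c + E₂) - (b + E₁) ^ 2 := by
  have bf : |F| ≤ 1 / 2 * (M * d ^ 2) + M * d ^ 3 := by
    rw [abs_of_nonneg hF]
    linarith [(abs_le.1 h₀).2]
  have t1 : |(F - 1 / 2 * a) * c| ≤ M * d ^ 3 * (M * V * V) := by rw [abs_mul]; gcongr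
  have t2 : |F * E₂| ≤ (1 / 2 * (M * d ^ 2) + M * d ^ 3) * (M * d * V * V) := by
    rw [abs_mul]; gcongr
  have t3 : |b * E₁| ≤ M * d * V * (M * d ^ 2 * V) := by rw [abs_mul]; gcongr
  have t4 : |E₁ * E₁| ≤ M * d ^ 2 * V * (M * d ^ 2 * V) := by rw [abs_mul]; gcongr
  have hd4 : M ^ 2 * V ^ 2 * d ^ 4 ≤ M ^ 2 * V ^ 2 * d ^ 3 := by
    have : d ^ 4 ≤ d ^ 3 := pow_le_pow_of_le_one hd0 hd1 (by norm_num)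
    gcongr
  have u1 := (abs_le.1 t1).1
  have u2 := (abs_le.1 t2).1
  have u3 := (abs_le.1 t3).2
  have u4 := (abs_le.1 t4).2
  linear_combination cs + 2 * u1 + 2 * u2 + 2 * u3 + u4 + 3 * hd4

/-- Near its vacuum, a non-degenerate potential satisfies a Łojasiewicz inequality and its square
root is semiconvex. -/
theorem exists_sqrt_semiconvex (hf : IsNondegeneratePotential f) (hne : (vacuum f).Nonempty) :
    ∃ δ K C : ℝ, 0 < δ ∧ 0 ≤ K ∧ 0 ≤ C ∧ ∀ z, infDist z (vacuum f) ≤ δ →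
      2 * √(f z) ≤ K * ‖fderiv ℝ f z‖ ∧
      ∀ v, -(C * (f z * √(f z)) * ‖v‖ ^ 2) ≤
        2 * f z * fderiv ℝ (fderiv ℝ f) z v v - fderiv ℝ f z v ^ 2 := by
  obtain ⟨c, hc, hco⟩ := hf.exists_coercive
  obtain ⟨M, hM, hT⟩ := hf.exists_taylor
  -- Ensures M d ≤ c/4, so the cubic Taylor error takes at most half of the lower bound c d²/2 for
  -- f.
  set δ := min (min c 1) (c / (4 * (M + 1))) with hδdef
  have hδ : 0 < δ := by positivity
  refine ⟨δ, 8 * (M + 1) / c, 8 * M ^ 2 / (c / 4 * √(c / 4)), hδ, by positivity, by positivity,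
    fun z hz => ?_⟩
  obtain ⟨p, hp, hpz⟩ := hf.isCompact_vacuum.exists_infDist_eq_dist hne z
  have hd : ‖z - p‖ ≤ δ := by rw [← dist_eq_norm, ← hpz]; exact hz
  have hd1 : ‖z - p‖ ≤ 1 := hd.trans ((min_le_left _ _).trans (min_le_right _ _))
  have hdc : ‖z - p‖ ≤ c := hd.trans ((min_le_left _ _).trans (min_le_left _ _))
  have hdM : M * ‖z - p‖ ≤ c / 4 := by
    have h1 : ‖z - p‖ ≤ c / (4 * (M + 1)) := hd.trans (min_le_right _ _)
    rw [le_div_iff₀ (by positivity)] at h1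
    nlinarith [norm_nonneg (z - p)]
  obtain ⟨hA, h2, h1, h0⟩ := hT p hp z hd1
  have hcoer := hco p hp z hpz.symm (by rwa [dist_eq_norm])
  set A := fderiv ℝ (fderiv ℝ f) p with hAdef
  set m := z - p with hm
  set d := ‖m‖ with hddef
  have hd0 : 0 ≤ d := norm_nonneg m
  have hAm : A m m ≤ M * d ^ 2 := by
    have := (A.le_opNorm₂ m m)
    have h3 := (le_abs_self _).trans this
    nlinarith [mul_le_mul_of_nonneg_right hA (sq_nonneg d)]
  have hd3 : M * d ^ 3 ≤ c / 4 * d ^ 2 := by nlinarith [mul_le_mul_of_nonneg_right hdM (sq_nonneg d)]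
  have hd3' : d ^ 3 ≤ d ^ 2 := by nlinarith [mul_le_mul_of_nonneg_right hd1 (sq_nonneg d)]
  rw [abs_le] at h0
  have hflow : c / 4 * d ^ 2 ≤ f z := by nlinarith
  have hfup : f z ≤ (M + 1) ^ 2 * d ^ 2 := by
    nlinarith [mul_le_mul_of_nonneg_left hd3' hM, mul_nonneg hM (sq_nonneg d),
      mul_nonneg (sq_nonneg M) (sq_nonneg d), sq_nonneg d]
  refine ⟨?_, fun v => ?_⟩
  · have hs : √(f z) ≤ (M + 1) * d := by
      rw [← Real.sqrt_sq (by positivity : 0 ≤ (M + 1) * d), mul_pow]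
      exact Real.sqrt_le_sqrt hfup
    have hg : c / 4 * d ≤ ‖fderiv ℝ f z‖ := by
      rcases hd0.eq_or_lt with h | hdpos
      · rw [← h]; simp
      have h3 : fderiv ℝ f z m ≤ ‖fderiv ℝ f z‖ * d :=
        (le_abs_self _).trans ((fderiv ℝ f z).le_opNorm m)
      have h4 : |(fderiv ℝ f z - A m) m| ≤ M * d ^ 2 * d :=
        ((fderiv ℝ f z - A m).le_opNorm m).trans (by gcongr)
      have h5 : (fderiv ℝ f z - A m) m = fderiv ℝ f z m - A m m := rfl
      rw [h5, abs_le] at h4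
      have h6 : c / 4 * d * d ≤ ‖fderiv ℝ f z‖ * d := by nlinarith
      exact le_of_mul_le_mul_right h6 hdpos
    calc 2 * √(f z) ≤ 2 * ((M + 1) * d) := by gcongr
      _ = 8 * (M + 1) / c * (c / 4 * d) := by field_simp; ring
      _ ≤ _ := by gcongr
  · have hv := norm_nonneg v
    set V := ‖v‖ with hV
    have e2 : |(fderiv ℝ (fderiv ℝ f) z - A) v v| ≤ M * d * V * V :=
      ((fderiv ℝ (fderiv ℝ f) z - A).le_opNorm₂ v v).trans (by gcongr)
    have e1 : |(fderiv ℝ f z - A m) v| ≤ M * d ^ 2 * V :=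
      ((fderiv ℝ f z - A m).le_opNorm v).trans (by gcongr)
    have b1 : |A m v| ≤ M * d * V := (A.le_opNorm₂ m v).trans (by gcongr)
    have b2 : |A v v| ≤ M * V * V := (A.le_opNorm₂ v v).trans (by gcongr)
    have cs := hf.fderiv₂_sq_le hp m v
    have r1 : fderiv ℝ f z v = A m v + (fderiv ℝ f z - A m) v := by simp
    have r2 : fderiv ℝ (fderiv ℝ f) z v v = A v v + (fderiv ℝ (fderiv ℝ f) z - A) v v := by simp
    have lower : -(8 * M ^ 2 * d ^ 3 * V ^ 2) ≤
        2 * f z * fderiv ℝ (fderiv ℝ f) z v v - fderiv ℝ f z v ^ 2 := by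
      rw [r1, r2]
      exact semiconvex_algebra hM hd0 hd1 hv (hf.nonneg z) hAm (abs_le.2 h0) e1 e2 b1 b2 cs
    -- The right side of `lower` is 4 f^(3/2) D²√f(v, v) where f > 0. An error of order d³ is
    -- therefore admissible, since d² ≲ f gives d³ ≲ f√f.
    refine le_trans (neg_le_neg ?_) lower
    have hsd : √(c / 4) * d ≤ √(f z) := by
      rw [← Real.sqrt_sq hd0, ← Real.sqrt_mul (by positivity)]
      exact Real.sqrt_le_sqrt hflow
    have hff : c / 4 * √(c / 4) * d ^ 3 ≤ f z * √(f z) := by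
      calc c / 4 * √(c / 4) * d ^ 3 = (c / 4 * d ^ 2) * (√(c / 4) * d) := by ring
        _ ≤ _ := mul_le_mul hflow hsd (by positivity) (hf.nonneg z)
    have hq : 0 < c / 4 * √(c / 4) := by positivity
    calc 8 * M ^ 2 * d ^ 3 * V ^ 2
        = 8 * M ^ 2 / (c / 4 * √(c / 4)) * (c / 4 * √(c / 4) * d ^ 3) * V ^ 2 := by
          rw [show 8 * M ^ 2 / (c / 4 * √(c / 4)) * (c / 4 * √(c / 4) * d ^ 3)
            = (8 * M ^ 2 / (c / 4 * √(c / 4)) * (c / 4 * √(c / 4))) * d ^ 3 by ring,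
            div_mul_cancel₀ _ hq.ne']
      _ ≤ _ := by gcongr

end IsNondegeneratePotential

end

/-! ### The nearest point map and the geometry of the boundary -/

section

variable {n k : ℕ}

section NearestPoint

variable {S : Set (EuclideanSpace ℝ (Fin n))}

theorem nearestPoint_spec (hS : IsCompact S) (hne : S.Nonempty) (y : EuclideanSpace ℝ (Fin n)) :
    nearestPoint S y ∈ S ∧ dist y (nearestPoint S y) = infDist y S := by
  refine Classical.epsilon_spec (p := fun z => z ∈ S ∧ dist y z = infDist y S) ?_
  obtain ⟨z, hz, h⟩ := hS.exists_infDist_eq_dist hne y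
  exact ⟨z, hz, h.symm⟩

theorem nearestPoint_of_mem (hS : IsCompact S) {y : EuclideanSpace ℝ (Fin n)} (hy : y ∈ S) :
    nearestPoint S y = y := by
  have h := (nearestPoint_spec hS ⟨y, hy⟩ y).2
  rw [infDist_zero_of_mem hy] at h
  exact (dist_eq_zero.1 h).symm

/-- x₀ itself competes for the minimum, so the triangle inequality bounds the displacement by 2 dist
x x₀. Smoothness of S plays no role. -/
theorem continuousAt_nearestPoint (hS : IsCompact S) {x₀ : EuclideanSpace ℝ (Fin n)}
    (hx₀ : x₀ ∈ S) : ContinuousAt (nearestPoint S) x₀ := by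
  rw [ContinuousAt, nearestPoint_of_mem hS hx₀, tendsto_iff_dist_tendsto_zero]
  have h : Tendsto (fun x => 2 * dist x x₀) (𝓝 x₀) (𝓝 0) := by
    have : Continuous fun x => 2 * dist x x₀ := by fun_prop
    simpa using this.tendsto x₀
  refine squeeze_zero (fun _ => dist_nonneg) (fun x => ?_) h
  have h1 := (nearestPoint_spec hS ⟨x₀, hx₀⟩ x).2
  have h2 := infDist_le_dist_of_mem (x := x) hx₀
  have h3 := dist_triangle_left (nearestPoint S x) x₀ x
  linarith

end NearestPoint

/-- The gradient of a smooth function is a smooth vector field. -/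
theorem exists_gradient_field {φ : EuclideanSpace ℝ (Fin n) → ℝ} (hφ : ContDiff ℝ ∞ φ) :
    ∃ G : EuclideanSpace ℝ (Fin n) → EuclideanSpace ℝ (Fin n), ContDiff ℝ ∞ G ∧
      ∀ p v, inner ℝ (G p) v = fderiv ℝ φ p v := by
  set b := EuclideanSpace.basisFun (Fin n) ℝ
  refine ⟨fun p => ∑ i, fderiv ℝ φ p (b i) • b i, ?_, fun p v => ?_⟩
  · refine ContDiff.sum fun i _ => ?_
    have h : ContDiff ℝ ∞ (fderiv ℝ φ) := hφ.fderiv_right (by simp)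
    exact (h.clm_apply contDiff_const).smul contDiff_const
  · conv_rhs => rw [← b.sum_repr' v]
    simp [sum_inner, inner_smul_left, mul_comm]

/-- `φ` is a smooth defining function of `Ω` near the boundary point `x₀`. -/
structure IsLocalDefining (Ω : Set (EuclideanSpace ℝ (Fin n)))
    (φ : EuclideanSpace ℝ (Fin n) → ℝ) (x₀ : EuclideanSpace ℝ (Fin n)) : Prop where
  smooth : ContDiff ℝ ∞ φ
  eventually : ∀ᶠ y in 𝓝 x₀, (y ∈ Ω ↔ φ y < 0) ∧ (y ∈ frontier Ω ↔ φ y = 0) ∧ fderiv ℝ φ y ≠ 0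

theorem IsLocalDefining.eventually_isLocalDefining {Ω : Set (EuclideanSpace ℝ (Fin n))}
    {φ : EuclideanSpace ℝ (Fin n) → ℝ} {x₀ : EuclideanSpace ℝ (Fin n)}
    (h : IsLocalDefining Ω φ x₀) : ∀ᶠ y in 𝓝 x₀, IsLocalDefining Ω φ y :=
  h.eventually.eventually_nhds.mono fun _ hy => ⟨h.smooth, hy⟩

/-- The point is that the frontier is locally exactly {φ = 0}: points with φ > 0 are not limits of
Ω, and a zero outside the closure would be a local minimum of φ, against dφ ≠ 0. -/
theorem IsSmoothBoundedDomain.exists_isLocalDefining {Ω : Set (EuclideanSpace ℝ (Fin n))}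
    (hΩ : IsSmoothBoundedDomain Ω) {x₀ : EuclideanSpace ℝ (Fin n)} (hx₀ : x₀ ∈ frontier Ω) :
    ∃ φ, IsLocalDefining Ω φ x₀ := by
  obtain ⟨U, hU, φ, hφ, hd, hUφ⟩ := hΩ.smooth_frontier x₀ hx₀
  refine ⟨φ, hφ, ?_⟩
  have hc : ContinuousAt (fderiv ℝ φ) x₀ := (hφ.continuous_fderiv (by simp)).continuousAt
  filter_upwards [eventually_mem_nhds_iff.2 hU, hc.eventually_ne hd] with y hy hdy
  have hyφ := hUφ y (mem_of_mem_nhds hy)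
  refine ⟨hyφ, ?_, hdy⟩
  rw [hΩ.isOpen.frontier_eq]
  constructor
  · rintro ⟨hcl, hn⟩
    rw [hyφ, not_lt] at hn
    refine le_antisymm (le_of_not_gt fun hpos => ?_) hn
    have h1 : ∀ᶠ q in 𝓝 y, q ∉ Ω := by
      filter_upwards [hy, hφ.continuous.continuousAt.eventually (lt_mem_nhds hpos)] with q hq hq'
      rw [hUφ q hq]
      exact not_lt.2 hq'.le
    obtain ⟨q, hq, hq'⟩ := ((mem_closure_iff_frequently.1 hcl).and_eventually h1).exists
    exact hq' hq
  · intro h0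
    refine ⟨?_, by rw [hyφ, h0]; exact lt_irrefl _⟩
    by_contra hcl
    apply hdy
    refine IsLocalMin.fderiv_eq_zero ?_
    have h1 : ∀ᶠ q in 𝓝 y, q ∉ Ω := by
      filter_upwards [isClosed_closure.isOpen_compl.mem_nhds hcl] with q hq hq'
        using hq (subset_closure hq')
    filter_upwards [hy, h1] with q hq hq'
    rw [hUφ q hq, not_lt] at hq'
    rwa [h0]

theorem IsSmoothBoundedDomain.isCompact_frontier {Ω : Set (EuclideanSpace ℝ (Fin n))}
    (hΩ : IsSmoothBoundedDomain Ω) : IsCompact (frontier Ω) :=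
  (isCompact_of_isClosed_isBounded isClosed_closure hΩ.isBounded.closure).of_isClosed_subset
    isClosed_frontier frontier_subset_closure

theorem norm_sub_smul_sq {ν x : EuclideanSpace ℝ (Fin n)} (hν : ‖ν‖ = 1) (c : ℝ) :
    ‖x - c • ν‖ ^ 2 = ‖x‖ ^ 2 - 2 * c * inner ℝ x ν + c ^ 2 := by
  rw [norm_sub_sq_real, inner_smul_right, norm_smul, hν, mul_one, Real.norm_eq_abs, sq_abs]
  ring

/-- The uniform exterior ball condition, locally. -/
theorem IsLocalDefining.exists_exterior_ball {Ω : Set (EuclideanSpace ℝ (Fin n))}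
    {φ : EuclideanSpace ℝ (Fin n) → ℝ} {x₀ : EuclideanSpace ℝ (Fin n)}
    (h : IsLocalDefining Ω φ x₀)
    {G : EuclideanSpace ℝ (Fin n) → EuclideanSpace ℝ (Fin n)} (hG : ContDiff ℝ ∞ G)
    (hGφ : ∀ p v, inner ℝ (G p) v = fderiv ℝ φ p v) (hG0 : G x₀ ≠ 0) :
    ∃ c : ℝ, 0 < c ∧ ∀ᶠ y in 𝓝 x₀, y ∈ frontier Ω → ∀ z ∈ Ω,
      c ≤ dist z (y - c • (-(‖G y‖⁻¹ • G y))) := by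
  obtain ⟨M, hM⟩ := (isCompact_closedBall x₀ 1).exists_bound_of_continuousOn
    ((h.smooth.fderiv_right (m := ∞) (by simp)).continuous_fderiv (by simp)).continuousOn
  obtain ⟨R, hR, hRΩ⟩ := Metric.eventually_nhds_iff.1 h.eventually
  have hg0 : 0 < ‖G x₀‖ := norm_pos_iff.2 hG0
  -- The first two bounds keep a violating z inside the chart and the unit ball; the last makes ‖G
  -- y‖/(2c) dominate the bound M on D²φ.
  set c := min (min (1 / 4) (R / 4)) (‖G x₀‖ / 2 / (2 * (|M| + 1))) with hc
  have hc0 : 0 < c := by positivity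
  refine ⟨c, hc0, ?_⟩
  have hGe : ∀ᶠ y in 𝓝 x₀, ‖G x₀‖ / 2 < ‖G y‖ :=
    hG.continuous.norm.continuousAt.eventually (lt_mem_nhds (by linarith))
  filter_upwards [hGe, ball_mem_nhds x₀ (by positivity : 0 < min (1 / 2) (R / 2))]
    with y hGy hyb hyS z hz
  by_contra! hlt
  have hGy0 : 0 < ‖G y‖ := lt_trans (by positivity) hGy
  set ν := -(‖G y‖⁻¹ • G y) with hν
  have hν1 : ‖ν‖ = 1 := by
    rw [hν, norm_neg, norm_smul, norm_inv, norm_norm, inv_mul_cancel₀ hGy0.ne']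
  have hyR : dist y x₀ < R / 2 := (mem_ball.1 hyb).trans_le (min_le_right _ _)
  have hy1 : dist y x₀ < 1 / 2 := (mem_ball.1 hyb).trans_le (min_le_left _ _)
  have hcR : c ≤ R / 4 := (min_le_left _ _).trans (min_le_right _ _)
  have hc1 : c ≤ 1 / 4 := (min_le_left _ _).trans (min_le_left _ _)
  have hcG : c * (2 * (|M| + 1)) ≤ ‖G x₀‖ / 2 :=
    (le_div_iff₀ (by positivity)).1 (min_le_right _ _)
  have hzy : dist z y < 2 * c := by
    have h1 := dist_triangle z (y - c • ν) y
    have h2 : dist (y - c • ν) y = c := by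
      rw [dist_eq_norm, sub_sub_cancel_left, norm_neg, norm_smul, hν1, mul_one,
        Real.norm_of_nonneg hc0.le]
    linarith
  have hzx : dist z x₀ < min 1 R := by
    have := dist_triangle z y x₀
    exact lt_min (by linarith) (by linarith)
  have hzφ : φ z < 0 := (hRΩ (hzx.trans_le (min_le_right _ _))).1.1 hz
  have hyφ : φ y = 0 := (hRΩ (by linarith : dist y x₀ < R)).2.1.1 hyS
  have hball := convex_closedBall x₀ (1 : ℝ)
  have hyB : y ∈ closedBall x₀ (1 : ℝ) := by rw [mem_closedBall]; linarith
  have hzB : z ∈ closedBall x₀ (1 : ℝ) := hzx.le.trans (min_le_left _ _)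
  have hDlip : ∀ q ∈ closedBall x₀ (1 : ℝ), ‖fderiv ℝ φ q - fderiv ℝ φ y‖ ≤ |M| * ‖q - y‖ :=
    fun q hq => hball.norm_image_sub_le_of_norm_fderiv_le
      (fun x _ => (h.smooth.fderiv_right (m := ∞) (by simp)).differentiable (by simp) x)
      (fun x hx => (hM x hx).trans (le_abs_self M)) hyB hq
  have hseg : ∀ q ∈ segment ℝ y z, ‖fderiv ℝ φ q - fderiv ℝ φ y‖ ≤ |M| * ‖z - y‖ := by
    intro q hq
    refine (hDlip q (hball.segment_subset hyB hzB hq)).trans ?_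
    gcongr
    obtain ⟨θ, hθ, rfl⟩ := (segment_eq_image' ℝ y z) ▸ hq
    rw [add_sub_cancel_left, norm_smul, Real.norm_of_nonneg hθ.1]
    nlinarith [hθ.2, norm_nonneg (z - y)]
  have htay := (convex_segment y z).norm_image_sub_le_of_norm_fderiv_le'
    (fun x _ => h.smooth.differentiable (by simp) x) hseg (left_mem_segment ℝ y z)
    (right_mem_segment ℝ y z)
  rw [hyφ, sub_zero, Real.norm_eq_abs, abs_le] at htay
  have hin : fderiv ℝ φ y (z - y) = -(‖G y‖ * inner ℝ (z - y) ν) := by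
    rw [← hGφ, hν, inner_neg_right, inner_smul_right, real_inner_comm]
    field_simp
  have hd : dist z (y - c • ν) ^ 2 < c ^ 2 := by gcongr
  have he : z - (y - c • ν) = (z - y) - (-c) • ν := by rw [neg_smul]; abel
  rw [dist_eq_norm, he, norm_sub_smul_sq hν1] at hd
  -- Inside the ball, z − y points outward by more than |z − y|²/(2c). The linear term of φ then
  -- beats the Taylor error and forces φ z ≥ 0.
  have hi : ‖z - y‖ ^ 2 < -(2 * c * inner ℝ (z - y) ν) := by linarith
  have h1 : |M| * ‖z - y‖ ^ 2 ≤ (‖G y‖ / (2 * c)) * ‖z - y‖ ^ 2 := by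
    gcongr
    rw [le_div_iff₀ (by positivity)]
    nlinarith [abs_nonneg M]
  have h2 : (‖G y‖ / (2 * c)) * ‖z - y‖ ^ 2 ≤ ‖G y‖ / (2 * c) * (-(2 * c * inner ℝ (z - y) ν)) := by
    gcongr
  have h3 : ‖G y‖ / (2 * c) * (-(2 * c * inner ℝ (z - y) ν)) = fderiv ℝ φ y (z - y) := by
    rw [hin]; field_simp
  nlinarith [htay.1]

/-- The nearest point map is of class `C²` at boundary points, and its differential is the identity
modulo the normal direction. -/
theorem IsLocalDefining.contDiffAt_nearestPoint {Ω : Set (EuclideanSpace ℝ (Fin n))}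
    (hS : IsCompact (frontier Ω)) {φ : EuclideanSpace ℝ (Fin n) → ℝ}
    {x₀ : EuclideanSpace ℝ (Fin n)} (h : IsLocalDefining Ω φ x₀) (hx₀ : x₀ ∈ frontier Ω)
    {G : EuclideanSpace ℝ (Fin n) → EuclideanSpace ℝ (Fin n)} (hG : ContDiff ℝ ∞ G)
    (hGφ : ∀ p v, inner ℝ (G p) v = fderiv ℝ φ p v) :
    ContDiffAt ℝ 2 (nearestPoint (frontier Ω)) x₀ ∧
      ∀ v, ∃ s : ℝ, v - fderiv ℝ (nearestPoint (frontier Ω)) x₀ v = s • G x₀ := by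
  set P := nearestPoint (frontier Ω) with hP
  have hG0 : ∀ q, fderiv ℝ φ q ≠ 0 → G q ≠ 0 := by
    intro q hq h0
    apply hq
    ext v
    rw [← hGφ, h0, inner_zero_left]
    rfl
  have hx := h.eventually.self_of_nhds
  have hφ0 : φ x₀ = 0 := hx.2.1.1 hx₀
  have hGx := hG0 x₀ hx.2.2
  have hPx : P x₀ = x₀ := nearestPoint_of_mem hS hx₀
  -- Normal coordinates: Ψ sends (P x, λ) to (x, 0) when x = P x + λ G(P x). The inverse function
  -- theorem then shows that P and λ are C².
  set Ψ : EuclideanSpace ℝ (Fin n) × ℝ → EuclideanSpace ℝ (Fin n) × ℝ :=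
    fun q => (q.1 + q.2 • G q.1, φ q.1) with hΨ
  have hΨc : ContDiff ℝ ∞ Ψ := by
    have h1 : ContDiff ℝ ∞ fun q : EuclideanSpace ℝ (Fin n) × ℝ => G q.1 :=
      hG.comp contDiff_fst
    have h2 : ContDiff ℝ ∞ fun q : EuclideanSpace ℝ (Fin n) × ℝ => φ q.1 :=
      h.smooth.comp contDiff_fst
    exact (contDiff_fst.add (contDiff_snd.smul h1)).prodMk h2
  have hΨ2 : ContDiffAt ℝ 2 Ψ (x₀, 0) := (contDiff_infty.1 hΨc 2).contDiffAt
  set L := fderiv ℝ Ψ (x₀, 0) with hL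
  have hΨ0 : Ψ (x₀, 0) = (x₀, 0) := by simp [hΨ, hφ0]
  have hΨd : HasFDerivAt Ψ L (x₀, 0) := (hΨ2.differentiableAt (by simp)).hasFDerivAt
  have hLa : ∀ a b, L (a, b) = (a + b • G x₀, fderiv ℝ φ x₀ a) := by
    intro a b
    have h1 : HasFDerivAt (fun q : EuclideanSpace ℝ (Fin n) × ℝ => G q.1)
        ((fderiv ℝ G x₀).comp (ContinuousLinearMap.fst ℝ _ ℝ)) (x₀, 0) :=
      ((hG.differentiable (by simp) x₀).hasFDerivAt).comp (x₀, (0 : ℝ)) hasFDerivAt_fst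
    have h2 : HasFDerivAt (fun q : EuclideanSpace ℝ (Fin n) × ℝ => φ q.1)
        ((fderiv ℝ φ x₀).comp (ContinuousLinearMap.fst ℝ _ ℝ)) (x₀, 0) :=
      ((h.smooth.differentiable (by simp) x₀).hasFDerivAt).comp (x₀, (0 : ℝ)) hasFDerivAt_fst
    have h3 := (hasFDerivAt_fst.add (hasFDerivAt_snd.smul h1)).prodMk h2
    have h4 := hΨd.unique h3
    rw [h4]
    simp
  have hinj : Function.Injective L := by
    rw [injective_iff_map_eq_zero]
    rintro ⟨a, b⟩ hab
    rw [hLa, Prod.mk_eq_zero] at hab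
    have ha : a = -(b • G x₀) := eq_neg_of_add_eq_zero_left hab.1
    have h2 := hab.2
    rw [← hGφ, ha, inner_neg_right, inner_smul_right, real_inner_self_eq_norm_sq, neg_eq_zero,
      mul_eq_zero] at h2
    have hb : b = 0 := h2.resolve_right (by simpa using hGx)
    simp [ha, hb]
  set Le : (EuclideanSpace ℝ (Fin n) × ℝ) ≃L[ℝ] (EuclideanSpace ℝ (Fin n) × ℝ) :=
    (LinearEquiv.ofInjectiveEndo (L : _ →ₗ[ℝ] _) hinj).toContinuousLinearEquiv with hLe
  have hLeL : (Le : _ →L[ℝ] _) = L := by ext v <;> rfl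
  have hΨd' : HasFDerivAt Ψ (Le : _ →L[ℝ] _) (x₀, 0) := by rw [hLeL]; exact hΨd
  set g := hΨ2.localInverse hΨd' (by simp) with hg
  have hgc : ContDiffAt ℝ 2 g (x₀, 0) := by
    have := hΨ2.to_localInverse hΨd' (by simp)
    rwa [hΨ0] at this
  have hleft : ∀ᶠ q in 𝓝 (x₀, (0 : ℝ)), g (Ψ q) = q :=
    (hΨ2.hasStrictFDerivAt' hΨd' (by simp)).eventually_left_inverse
  have hPc : ContinuousAt P x₀ := continuousAt_nearestPoint hS hx₀
  have hPt : Tendsto P (𝓝 x₀) (𝓝 x₀) := by simpa [ContinuousAt, hPx] using hPc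
  set lam : EuclideanSpace ℝ (Fin n) → ℝ :=
    fun x => inner ℝ (G (P x)) (x - P x) / ‖G (P x)‖ ^ 2 with hlam
  have hlamt : Tendsto lam (𝓝 x₀) (𝓝 0) := by
    have h1 : ContinuousAt lam x₀ := by
      have hGP : ContinuousAt (fun x => G (P x)) x₀ :=
        ContinuousAt.comp (g := G) hG.continuous.continuousAt hPc
      refine ContinuousAt.div (hGP.inner (continuousAt_id.sub hPc)) (hGP.norm.pow 2) ?_
      rw [hPx]
      simpa using hGx
    have h2 : lam x₀ = 0 := by simp [hlam, hPx]
    simpa [ContinuousAt, h2] using h1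
  have hnear : ∀ᶠ x in 𝓝 x₀, x = P x + lam x • G (P x) := by
    filter_upwards [hPt.eventually h.eventually.eventually_nhds] with x hx
    have hx1 := hx.self_of_nhds
    have hPS := nearestPoint_spec hS ⟨x₀, hx₀⟩ x
    have hφP : φ (P x) = 0 := hx1.2.1.1 hPS.1
    have hne := hG0 _ hx1.2.2
    have hsurj : Function.Surjective (fderiv ℝ φ (P x)) := by
      obtain ⟨v, hv⟩ := DFunLike.ne_iff.1 hx1.2.2
      intro t
      refine ⟨(t / fderiv ℝ φ (P x) v) • v, ?_⟩
      rw [map_smul, smul_eq_mul, div_mul_cancel₀]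
      simpa using hv
    -- The part of x − P x orthogonal to the gradient. It is tangent, so minimality makes it
    -- orthogonal to x − P x as well, hence to itself.
    set w := (x - P x) - lam x • G (P x) with hw
    have hw0 : inner ℝ (G (P x)) w = 0 := by
      have : ‖G (P x)‖ ^ 2 ≠ 0 := by simpa using hne
      rw [hw, inner_sub_right, inner_smul_right, real_inner_self_eq_norm_sq, hlam]
      field_simp
      ring
    have h3 := inner_sub_eq_zero_of_nearest (z := x) (w := w)
      (h.smooth.contDiffAt.hasStrictFDerivAt (x := P x) (by simp)) hsurj ?_
      (by rw [← hGφ]; exact hw0)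
    · have h4 : inner ℝ w w = 0 := by
        conv_lhs => rw [hw]
        rw [inner_sub_left, inner_smul_left, hw0, h3]
        simp
      have h5 : w = 0 := inner_self_eq_zero.1 h4
      rw [hw, sub_eq_zero] at h5
      rw [← h5]
      abel
    · filter_upwards [hx] with q hq hqP
      rw [hPS.2]
      exact infDist_le_dist_of_mem (hq.2.1.2 (hqP.trans hφP))
  have hgP : ∀ᶠ x in 𝓝 x₀, g (x, 0) = (P x, lam x) := by
    have ht : Tendsto (fun x => (P x, lam x)) (𝓝 x₀) (𝓝 (x₀, (0 : ℝ))) :=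
      hPt.prodMk_nhds hlamt
    filter_upwards [hnear, ht.eventually hleft, hPt.eventually h.eventually] with x hx1 hx2 hx3
    have hφP : φ (P x) = 0 := hx3.2.1.1 (nearestPoint_spec hS ⟨x₀, hx₀⟩ x).1
    rw [← hx2]
    simp only [hΨ, ← hx1, hφP]
  have hg0 : ContDiffAt ℝ 2 (fun x : EuclideanSpace ℝ (Fin n) => g (x, 0)) x₀ :=
    ContDiffAt.comp (g := g) x₀ hgc (contDiffAt_id.prodMk contDiffAt_const)
  have hP2 : ContDiffAt ℝ 2 P x₀ :=
    (contDiff_fst.contDiffAt.comp x₀ hg0).congr_of_eventuallyEq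
      (hgP.mono fun x hx => by simp [hx])
  have hlam2 : ContDiffAt ℝ 2 lam x₀ :=
    (contDiff_snd.contDiffAt.comp x₀ hg0).congr_of_eventuallyEq
      (hgP.mono fun x hx => by simp [hx])
  refine ⟨hP2, fun v => ⟨fderiv ℝ lam x₀ v, ?_⟩⟩
  have hPd : HasFDerivAt P (fderiv ℝ P x₀) x₀ := (hP2.differentiableAt (by simp)).hasFDerivAt
  have hld : HasFDerivAt lam (fderiv ℝ lam x₀) x₀ :=
    (hlam2.differentiableAt (by simp)).hasFDerivAt
  have hGd : HasFDerivAt (fun x => G (P x)) ((fderiv ℝ G (P x₀)).comp (fderiv ℝ P x₀)) x₀ :=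
    ((hG.differentiable (by simp) (P x₀)).hasFDerivAt).comp x₀ hPd
  have h1 := hPd.add (hld.smul hGd)
  have h2 : HasFDerivAt (P + lam • fun x => G (P x)) (ContinuousLinearMap.id ℝ _) x₀ :=
    (hasFDerivAt_id x₀).congr_of_eventuallyEq (hnear.mono fun x hx => hx.symm)
  have h3 := congrArg (fun T => T v) (h2.unique h1)
  have h4 : lam x₀ = 0 := by simp [hlam, hPx]
  simp only [ContinuousLinearMap.id_apply, h4, zero_smul, hPx, _root_.add_apply,
    ContinuousLinearMap.smulRight_apply, zero_add] at h3
  rw [sub_eq_iff_eq_add']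
  simpa using h3

/-- Uniform geometry of the boundary of a smooth bounded domain: the nearest point map is `C²` with
bounds in a neighbourhood of uniform size, and there are a unit inner normal and an exterior ball of
uniform size. -/
theorem IsSmoothBoundedDomain.exists_uniform_geometry {Ω : Set (EuclideanSpace ℝ (Fin n))}
    (hΩ : IsSmoothBoundedDomain Ω) : ∃ κ : ℝ, 0 < κ ∧ ∀ y ∈ frontier Ω,
      (∀ x ∈ ball y κ, ContDiffAt ℝ 2 (nearestPoint (frontier Ω)) x ∧
        ‖fderiv ℝ (nearestPoint (frontier Ω)) x‖ ≤ 1 / κ ∧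
        ‖fderiv ℝ (fderiv ℝ (nearestPoint (frontier Ω))) x‖ ≤ 1 / κ) ∧
      ∃ ν : EuclideanSpace ℝ (Fin n), ‖ν‖ = 1 ∧
        (∀ v, ∃ s : ℝ, v - fderiv ℝ (nearestPoint (frontier Ω)) y v = s • ν) ∧
        (∀ᶠ t in 𝓝[>] (0 : ℝ), y + t • ν ∈ Ω) ∧ ∀ z ∈ Ω, κ ≤ dist z (y - κ • ν) := by
  have hS := hΩ.isCompact_frontier
  refine exists_uniform_pos_of_locally hS _ ?_ ?_
  · rintro y c c' hc' hle ⟨h1, ν, hν, h2, h3, h4⟩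
    have hcc : 1 / c ≤ 1 / c' := one_div_le_one_div_of_le hc' hle
    refine ⟨fun x hx => ?_, ν, hν, h2, h3, fun z hz => ?_⟩
    · obtain ⟨a1, a2, a3⟩ := h1 x (ball_subset_ball hle hx)
      exact ⟨a1, a2.trans hcc, a3.trans hcc⟩
    · have a1 := h4 z hz
      have a2 := dist_triangle z (y - c' • ν) (y - c • ν)
      have a3 : dist (y - c' • ν) (y - c • ν) = c - c' := by
        rw [dist_eq_norm, sub_sub_sub_cancel_left, ← sub_smul, norm_smul, hν, mul_one,
          Real.norm_of_nonneg (by linarith)]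
      linarith
  · intro x₀ hx₀
    obtain ⟨φ, hφ⟩ := hΩ.exists_isLocalDefining hx₀
    obtain ⟨G, hG, hGφ⟩ := exists_gradient_field hφ.smooth
    have hGne : ∀ q, fderiv ℝ φ q ≠ 0 → G q ≠ 0 := by
      intro q hq h0
      apply hq
      ext v
      rw [← hGφ, h0, inner_zero_left]
      rfl
    have hP2 := (hφ.contDiffAt_nearestPoint hS hx₀ hG hGφ).1
    set P := nearestPoint (frontier Ω) with hP
    have hD1 : ContDiffAt ℝ 1 (fderiv ℝ P) x₀ := hP2.fderiv_right (by norm_num)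
    obtain ⟨c₀, hc₀, hext⟩ := hφ.exists_exterior_ball hG hGφ
      (hGne x₀ hφ.eventually.self_of_nhds.2.2)
    set M := max ‖fderiv ℝ P x₀‖ ‖fderiv ℝ (fderiv ℝ P) x₀‖ + 1 with hM
    have hM0 : 0 < M := by positivity
    have hev : ∀ᶠ x in 𝓝 x₀, ContDiffAt ℝ 2 P x ∧ ‖fderiv ℝ P x‖ ≤ M ∧
        ‖fderiv ℝ (fderiv ℝ P) x‖ ≤ M := by
      have e1 : ∀ᶠ x in 𝓝 x₀, ‖fderiv ℝ P x‖ < M :=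
        hD1.continuousAt.norm.eventually
          (gt_mem_nhds (lt_of_le_of_lt (le_max_left _ _) (lt_add_one _)))
      have e2 : ∀ᶠ x in 𝓝 x₀, ‖fderiv ℝ (fderiv ℝ P) x‖ < M :=
        (hD1.fderiv_right (m := 0) (by simp)).continuousAt.norm.eventually
          (gt_mem_nhds (lt_of_le_of_lt (le_max_right _ _) (lt_add_one _)))
      filter_upwards [hP2.eventually (by simp), e1, e2] with x a1 a2 a3 using ⟨a1, a2.le, a3.le⟩
    obtain ⟨R, hR, hball⟩ := Metric.eventually_nhds_iff.1 hev
    -- One constant serves as radius of regularity, reciprocal derivative bound and exterior radius,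
    -- since each property survives shrinking it.
    set c := min (min c₀ (R / 2)) (1 / M) with hc
    have hc0 : 0 < c := by positivity
    have hcM : M ≤ 1 / c := by
      rw [le_one_div hM0 hc0]; exact min_le_right _ _
    have hcR : c ≤ R / 2 := (min_le_left _ _).trans (min_le_right _ _)
    have hcc : c ≤ c₀ := (min_le_left _ _).trans (min_le_left _ _)
    refine ⟨c, hc0, ?_⟩
    have hevS : ∀ᶠ y in 𝓝[frontier Ω] x₀, y ∈ frontier Ω := self_mem_nhdsWithin
    filter_upwards [hevS, mem_nhdsWithin_of_mem_nhds hext,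
      mem_nhdsWithin_of_mem_nhds (ball_mem_nhds x₀ (half_pos hR)),
      mem_nhdsWithin_of_mem_nhds hφ.eventually_isLocalDefining] with y hyS hye hyR hyφ
    have hGy : 0 < ‖G y‖ := norm_pos_iff.2 (hGne y hyφ.eventually.self_of_nhds.2.2)
    set ν := -(‖G y‖⁻¹ • G y) with hν
    have hν1 : ‖ν‖ = 1 := by
      rw [hν, norm_neg, norm_smul, norm_inv, norm_norm, inv_mul_cancel₀ hGy.ne']
    refine ⟨fun x hx => ?_, ν, hν1, fun v => ?_, ?_, fun z hz => ?_⟩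
    · have hx' : dist x x₀ < R := by
        have := dist_triangle x y x₀
        have a := mem_ball.1 hx
        have b := mem_ball.1 hyR
        linarith
      obtain ⟨a1, a2, a3⟩ := hball hx'
      exact ⟨a1, a2.trans hcM, a3.trans hcM⟩
    · obtain ⟨s, hs⟩ := (hyφ.contDiffAt_nearestPoint hS hyS hG hGφ).2 v
      refine ⟨-(s * ‖G y‖), ?_⟩
      rw [hs, hν, smul_neg, neg_smul, neg_neg, smul_smul, mul_assoc, mul_inv_cancel₀ hGy.ne',
        mul_one]
    · have hline : HasDerivAt (fun τ : ℝ => y + τ • ν) ν 0 := by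
        simpa using ((hasDerivAt_id (0 : ℝ)).smul_const ν).const_add y
      have hder : HasDerivAt (fun τ : ℝ => φ (y + τ • ν)) (fderiv ℝ φ y ν) 0 := by
        have a := (hφ.smooth.differentiable (by simp) (y + (0 : ℝ) • ν)).hasFDerivAt
          |>.comp_hasDerivAt 0 hline
        exact a.congr_deriv (by simp)
      have hneg : fderiv ℝ φ y ν < 0 := by
        rw [← hGφ, hν, inner_neg_right, inner_smul_right, real_inner_self_eq_norm_sq]
        have : 0 < ‖G y‖⁻¹ * ‖G y‖ ^ 2 := by positivity
        linarith
      have hφy : φ y = 0 := hyφ.eventually.self_of_nhds.2.1.1 hyS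
      have h0 : φ (y + (0 : ℝ) • ν) = 0 := by simpa using hφy
      have hsl : ∀ᶠ t in 𝓝[>] (0 : ℝ), slope (fun τ : ℝ => φ (y + τ • ν)) 0 t < 0 :=
        ((hasDerivAt_iff_tendsto_slope.1 hder).mono_left
          (nhdsWithin_mono _ fun t ht => ne_of_gt ht)).eventually (gt_mem_nhds hneg)
      have hcont : Tendsto (fun τ : ℝ => y + τ • ν) (𝓝[>] 0) (𝓝 y) := by
        have := hline.continuousAt.tendsto
        simp only [zero_smul, add_zero] at this
        exact this.mono_left nhdsWithin_le_nhds
      filter_upwards [hsl, hcont.eventually hyφ.eventually, self_mem_nhdsWithin] with t a1 a2 a3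
      rw [a2.1]
      have ht : (0 : ℝ) < t := a3
      rw [slope_def_field, h0, sub_zero, sub_zero, div_neg_iff] at a1
      rcases a1 with a1 | a1
      · linarith [a1.2]
      · exact a1.1
    · have a1 := hye hyS z hz
      have a2 := dist_triangle z (y - c • ν) (y - c₀ • ν)
      have a3 : dist (y - c • ν) (y - c₀ • ν) = c₀ - c := by
        rw [dist_eq_norm, sub_sub_sub_cancel_left, ← sub_smul, norm_smul, hν1, mul_one,
          Real.norm_of_nonneg (by linarith)]
      linarith

end

/-! ### Frobenius norms and Taylor expansion of the boundary data -/

section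

variable {n k : ℕ}

theorem frobNorm_nonneg (A : EuclideanSpace ℝ (Fin n) →L[ℝ] EuclideanSpace ℝ (Fin k)) :
    0 ≤ frobNorm A := Real.sqrt_nonneg _

theorem norm_apply_single_le_frobNorm
    (A : EuclideanSpace ℝ (Fin n) →L[ℝ] EuclideanSpace ℝ (Fin k)) (i : Fin n) :
    ‖A (EuclideanSpace.single i 1)‖ ≤ frobNorm A :=
  Real.le_sqrt_of_sq_le (Finset.single_le_sum
    (f := fun i => ‖A (EuclideanSpace.single i 1)‖ ^ 2) (fun _ _ => sq_nonneg _)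
    (Finset.mem_univ i))

theorem frobNorm_sq (A : EuclideanSpace ℝ (Fin n) →L[ℝ] EuclideanSpace ℝ (Fin k)) :
    frobNorm A ^ 2 = ∑ i, ‖A (EuclideanSpace.single i 1)‖ ^ 2 :=
  Real.sq_sqrt (Finset.sum_nonneg fun _ _ => sq_nonneg _)

theorem frobNorm_le_of_forall {A : EuclideanSpace ℝ (Fin n) →L[ℝ] EuclideanSpace ℝ (Fin k)} {c : ℝ}
    (h : ∀ i, ‖A (EuclideanSpace.single i 1)‖ ≤ c) : frobNorm A ≤ n * c := by
  rcases Nat.eq_zero_or_pos n with rfl | hn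
  · simp [frobNorm]
  have hc : 0 ≤ c := (norm_nonneg _).trans (h ⟨0, hn⟩)
  refine Real.sqrt_le_iff.2 ⟨by positivity, ?_⟩
  have hn1 : (1 : ℝ) ≤ n := by exact_mod_cast hn
  calc ∑ i, ‖A (EuclideanSpace.single i 1)‖ ^ 2 ≤ ∑ _i : Fin n, c ^ 2 := by
        gcongr with i; exact h i
    _ = n * c ^ 2 := by simp
    _ ≤ n * (n * c ^ 2) := le_mul_of_one_le_left (by positivity) hn1
    _ = (n * c) ^ 2 := by ring

theorem sum_smul_single (v : EuclideanSpace ℝ (Fin n)) :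
    ∑ i, v i • EuclideanSpace.single i (1 : ℝ) = v := by
  simpa using (EuclideanSpace.basisFun (Fin n) ℝ).sum_repr v

/-- A linear map that is bounded by `c` on the standard basis is bounded by `n c`. -/
theorem norm_apply_le_of_forall_single {F : Type*} [NormedAddCommGroup F] [NormedSpace ℝ F]
    (A : EuclideanSpace ℝ (Fin n) →L[ℝ] F) {c : ℝ}
    (h : ∀ i, ‖A (EuclideanSpace.single i 1)‖ ≤ c) (v : EuclideanSpace ℝ (Fin n)) :
    ‖A v‖ ≤ n * c * ‖v‖ := by
  have hA : A v = ∑ i, v i • A (EuclideanSpace.single i 1) := by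
    conv_lhs => rw [← sum_smul_single v]
    simp
  rw [hA]
  calc ‖∑ i, v i • A (EuclideanSpace.single i 1)‖
      ≤ ∑ i, ‖v i • A (EuclideanSpace.single i 1)‖ := norm_sum_le _ _
    _ ≤ ∑ _i : Fin n, ‖v‖ * c := by
        gcongr with i
        rw [norm_smul]
        exact mul_le_mul (PiLp.norm_apply_le v i) (h i) (norm_nonneg _) (norm_nonneg _)
    _ = n * c * ‖v‖ := by simp; ring

theorem continuous_frobNorm :
    Continuous (frobNorm : (EuclideanSpace ℝ (Fin n) →L[ℝ] EuclideanSpace ℝ (Fin k)) → ℝ) := by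
  unfold frobNorm
  fun_prop

section BoundaryData

variable {S : Set (EuclideanSpace ℝ (Fin n))}
  {ub : EuclideanSpace ℝ (Fin n) → EuclideanSpace ℝ (Fin k)}

/-- The nearest point map takes values in S, so near x the extension is G composed with it, for a
local C² extension G of the data. -/
theorem contDiffAt_normalExtension (hS : IsCompact S) {x : EuclideanSpace ℝ (Fin n)} (hx : x ∈ S)
    (hP : ContDiffAt ℝ 2 (nearestPoint S) x) (hub : IsC2On S ub) :
    ContDiffAt ℝ 2 (normalExtension S ub) x := by
  obtain ⟨G, hG, hGu⟩ := hub x hx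
  have hPx := nearestPoint_of_mem hS hx
  have ht : Tendsto (nearestPoint S) (𝓝 x) (𝓝[S] x) := by
    refine tendsto_nhdsWithin_iff.2 ⟨?_, Eventually.of_forall fun z =>
      (nearestPoint_spec hS ⟨x, hx⟩ z).1⟩
    simpa [ContinuousAt, hPx] using hP.continuousAt
  have hG' : ContDiffAt ℝ 2 G (nearestPoint S x) := by rwa [hPx]
  refine (hG'.comp x hP).congr_of_eventuallyEq ?_
  filter_upwards [ht.eventually hGu] with z hz
  exact hz.symm

/-- An unbounded real supremum defaults to 0, so boundedness is needed before the supremum controls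
pointwise values. -/
theorem bddAbove_tangentialGradNorm (hS : IsCompact S)
    (hP : ∀ x ∈ S, ContDiffAt ℝ 2 (nearestPoint S) x) (hub : IsC2On S ub) :
    BddAbove (range fun x : S => tangentialGradNorm S ub x) := by
  have hc : ContinuousOn (tangentialGradNorm S ub) S := fun x hx => by
    have h1 : ContDiffAt ℝ 1 (fderiv ℝ (normalExtension S ub)) x :=
      (contDiffAt_normalExtension hS hx (hP x hx) hub).fderiv_right (by norm_num)
    exact (ContinuousAt.comp (g := frobNorm) continuous_frobNorm.continuousAt
      h1.continuousAt).continuousWithinAt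
  have := hS.bddAbove_image hc
  rwa [image_eq_range] at this

theorem bddAbove_tangentialHessNorm (hS : IsCompact S)
    (hP : ∀ x ∈ S, ContDiffAt ℝ 2 (nearestPoint S) x) (hub : IsC2On S ub) :
    BddAbove (range fun x : S => tangentialHessNorm S ub x) := by
  have hc : ContinuousOn (tangentialHessNorm S ub) S := fun x hx => by
    have h1 : ContDiffAt ℝ 1 (fderiv ℝ (normalExtension S ub)) x :=
      (contDiffAt_normalExtension hS hx (hP x hx) hub).fderiv_right (by norm_num)
    have h2 : ContDiffAt ℝ 0 (fderiv ℝ (fderiv ℝ (normalExtension S ub))) x :=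
      h1.fderiv_right (by simp)
    have h3 : ContDiffAt ℝ 1 (fderiv ℝ (nearestPoint S)) x :=
      (hP x hx).fderiv_right (by norm_num)
    have h4 : ∀ i : Fin n, ContDiffAt ℝ 0
        (fun z => fderiv ℝ (nearestPoint S) z (EuclideanSpace.single i 1)) x := fun i =>
      (h3.of_le (by simp)).clm_apply contDiffAt_const
    have h5 : ∀ i j : Fin n, ContinuousAt (fun z => ‖fderiv ℝ (fderiv ℝ (normalExtension S ub)) z
        (fderiv ℝ (nearestPoint S) z (EuclideanSpace.single i 1))
        (fderiv ℝ (nearestPoint S) z (EuclideanSpace.single j 1))‖ ^ 2) x := fun i j =>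
      ((h2.clm_apply (h4 i)).clm_apply (h4 j)).continuousAt.norm.pow 2
    exact (ContinuousAt.sqrt (tendsto_finsetSum _ fun i _ => tendsto_finsetSum _ fun j _ =>
      h5 i j)).continuousWithinAt
  have := hS.bddAbove_image hc
  rwa [image_eq_range] at this

theorem norm_fderiv_normalExtension_le (x v : EuclideanSpace ℝ (Fin n)) :
    ‖fderiv ℝ (normalExtension S ub) x v‖ ≤ n * tangentialGradNorm S ub x * ‖v‖ :=
  norm_apply_le_of_forall_single _ (norm_apply_single_le_frobNorm _) v

theorem norm_fderiv₂_normalExtension_le (x v w : EuclideanSpace ℝ (Fin n)) :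
    ‖fderiv ℝ (fderiv ℝ (normalExtension S ub)) x (fderiv ℝ (nearestPoint S) x v)
      (fderiv ℝ (nearestPoint S) x w)‖ ≤ n * (n * tangentialHessNorm S ub x * ‖w‖) * ‖v‖ := by
  set B := fderiv ℝ (fderiv ℝ (normalExtension S ub)) x
  set D := fderiv ℝ (nearestPoint S) x
  refine norm_apply_le_of_forall_single (((B.flip (D w))).comp D) (fun i => ?_) v
  refine norm_apply_le_of_forall_single ((B (D (EuclideanSpace.single i 1))).comp D)
    (fun j => ?_) w
  refine Real.le_sqrt_of_sq_le ?_
  refine le_trans ?_ (Finset.single_le_sum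
    (f := fun i => ∑ j, ‖B (D (EuclideanSpace.single i 1)) (D (EuclideanSpace.single j 1))‖ ^ 2)
    (fun _ _ => Finset.sum_nonneg fun _ _ => sq_nonneg _) (Finset.mem_univ i))
  exact Finset.single_le_sum
    (f := fun j => ‖B (D (EuclideanSpace.single i 1)) (D (EuclideanSpace.single j 1))‖ ^ 2)
    (fun _ _ => sq_nonneg _) (Finset.mem_univ j)

/-- Second-order Taylor expansion of boundary data along the hypersurface. -/
theorem norm_boundary_taylor_le (hS : IsCompact S) {κ M₁ M₂ : ℝ} (hκ : 0 < κ)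
    (hgeo : ∀ y ∈ S, ∀ x ∈ ball y κ, ContDiffAt ℝ 2 (nearestPoint S) x ∧
        ‖fderiv ℝ (nearestPoint S) x‖ ≤ 1 / κ ∧
        ‖fderiv ℝ (fderiv ℝ (nearestPoint S)) x‖ ≤ 1 / κ)
    (hub : IsC2On S ub) (h₁ : ∀ x ∈ S, tangentialGradNorm S ub x ≤ M₁)
    (h₂ : ∀ x ∈ S, tangentialHessNorm S ub x ≤ M₂) {x y : EuclideanSpace ℝ (Fin n)}
    (hx : x ∈ S) (hy : y ∈ S) (hxy : dist x y < κ) :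
    ‖ub x - ub y - fderiv ℝ (normalExtension S ub) y (fderiv ℝ (nearestPoint S) y (x - y))‖ ≤
      (n / κ * M₁ + n ^ 2 / κ ^ 2 * M₂) * ‖x - y‖ ^ 2 := by
  set P := nearestPoint S with hP
  set g := normalExtension S ub with hg
  set m := x - y with hm
  have hPS : ∀ z, P z ∈ S := fun z => (nearestPoint_spec hS ⟨x, hx⟩ z).1
  have hPP : ∀ z ∈ S, P z = z := fun z hz => nearestPoint_of_mem hS hz
  have hP2 : ∀ z ∈ S, ContDiffAt ℝ 2 P z := fun z hz => (hgeo z hz z (mem_ball_self hκ)).1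
  have hg2 : ∀ z ∈ S, ContDiffAt ℝ 2 g z := fun z hz =>
    contDiffAt_normalExtension hS hz (hP2 z hz) hub
  -- P maps this segment to a curve in S from y to x; the expansion follows from bounding the second
  -- derivative of the data along that curve.
  set c : ℝ → EuclideanSpace ℝ (Fin n) := fun t => y + t • m with hc
  have hcd : ∀ t, HasDerivAt c m t := fun t => by
    exact (((hasDerivAt_id t).smul_const m).const_add y).congr_deriv (by simp)
  have hcb : ∀ t ∈ Icc (0 : ℝ) 1, c t ∈ ball y κ := by
    intro t ht
    rw [mem_ball, dist_eq_norm, hc, add_sub_cancel_left, norm_smul, Real.norm_of_nonneg ht.1]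
    rw [dist_eq_norm] at hxy
    nlinarith [ht.2, norm_nonneg m]
  have hPd : ∀ t ∈ Icc (0 : ℝ) 1, HasFDerivAt P (fderiv ℝ P (c t)) (c t) := fun t ht =>
    ((hgeo y hy _ (hcb t ht)).1.differentiableAt (by simp)).hasFDerivAt
  have hγ : ∀ t ∈ Icc (0 : ℝ) 1, HasDerivAt (fun t => P (c t)) (fderiv ℝ P (c t) m) t :=
    fun t ht => (hPd t ht).comp_hasDerivAt t (hcd t)
  have hγ' : ∀ t ∈ Icc (0 : ℝ) 1, HasDerivAt (fun t => fderiv ℝ P (c t) m)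
      (fderiv ℝ (fderiv ℝ P) (c t) m m) t := by
    intro t ht
    have h1 : ContDiffAt ℝ 1 (fderiv ℝ P) (c t) :=
      (hgeo y hy _ (hcb t ht)).1.fderiv_right (by norm_num)
    have h2 := (h1.differentiableAt (by simp)).hasFDerivAt.comp_hasDerivAt t (hcd t)
    exact (h2.clm_apply (hasDerivAt_const t m)).congr_deriv (by simp)
  -- Differentiating P ∘ P = P shows that the velocity is fixed by DP, so the Hessian norm, which
  -- sees only vectors in the range of DP, applies to it.
  have htan : ∀ t ∈ Icc (0 : ℝ) 1,
      fderiv ℝ P (P (c t)) (fderiv ℝ P (c t) m) = fderiv ℝ P (c t) m := by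
    intro t ht
    have h1 : HasFDerivAt P (fderiv ℝ P (P (c t))) (P (c t)) :=
      ((hP2 _ (hPS _)).differentiableAt (by simp)).hasFDerivAt
    have h2 := h1.comp (c t) (hPd t ht)
    have h3 : P ∘ P = P := funext fun z => hPP _ (hPS z)
    rw [h3] at h2
    exact (congrArg (fun T => T m) (h2.unique (hPd t ht)))
  have hG : ∀ t ∈ Icc (0 : ℝ) 1, HasDerivAt (fun t => g (P (c t)))
      (fderiv ℝ g (P (c t)) (fderiv ℝ P (c t) m)) t := fun t ht =>
    HasFDerivAt.comp_hasDerivAt (l := g) (f := fun t => P (c t)) t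
      ((hg2 _ (hPS (c t))).differentiableAt (by simp)).hasFDerivAt (hγ t ht)
  have hG' : ∀ t ∈ Icc (0 : ℝ) 1,
      HasDerivAt (fun t => fderiv ℝ g (P (c t)) (fderiv ℝ P (c t) m))
      (fderiv ℝ (fderiv ℝ g) (P (c t)) (fderiv ℝ P (c t) m) (fderiv ℝ P (c t) m) +
        fderiv ℝ g (P (c t)) (fderiv ℝ (fderiv ℝ P) (c t) m m)) t := by
    intro t ht
    have h1 : ContDiffAt ℝ 1 (fderiv ℝ g) (P (c t)) :=
      (hg2 _ (hPS _)).fderiv_right (by norm_num)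
    have h2 := (h1.differentiableAt (by simp)).hasFDerivAt.comp_hasDerivAt t (hγ t ht)
    exact h2.clm_apply (hγ' t ht)
  have hM₁ : 0 ≤ M₁ := (frobNorm_nonneg _).trans (h₁ x hx)
  have hM₂ : 0 ≤ M₂ := (Real.sqrt_nonneg _).trans (h₂ x hx)
  set B := (n / κ * M₁ + n ^ 2 / κ ^ 2 * M₂) * ‖m‖ ^ 2 with hB
  have hbd : ∀ t ∈ Icc (0 : ℝ) 1,
      ‖fderiv ℝ (fderiv ℝ g) (P (c t)) (fderiv ℝ P (c t) m) (fderiv ℝ P (c t) m) +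
        fderiv ℝ g (P (c t)) (fderiv ℝ (fderiv ℝ P) (c t) m m)‖ ≤ B := by
    intro t ht
    obtain ⟨-, b1, b2⟩ := hgeo y hy _ (hcb t ht)
    have hv : ‖fderiv ℝ P (c t) m‖ ≤ 1 / κ * ‖m‖ := (fderiv ℝ P (c t)).le_of_opNorm_le b1 m
    have hw : ‖fderiv ℝ (fderiv ℝ P) (c t) m m‖ ≤ 1 / κ * ‖m‖ * ‖m‖ :=
      (ContinuousLinearMap.le_opNorm₂ _ m m).trans (by gcongr)
    have t1 := norm_fderiv₂_normalExtension_le (S := S) (ub := ub) (P (c t))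
      (fderiv ℝ P (c t) m) (fderiv ℝ P (c t) m)
    rw [← hP, ← hg, htan t ht] at t1
    have t2 := norm_fderiv_normalExtension_le (S := S) (ub := ub) (P (c t))
      (fderiv ℝ (fderiv ℝ P) (c t) m m)
    have h₁' := h₁ _ (hPS (c t))
    have h₂' := h₂ _ (hPS (c t))
    calc _ ≤ _ := norm_add_le _ _
      _ ≤ n * (n * M₂ * (1 / κ * ‖m‖)) * (1 / κ * ‖m‖) + n * M₁ * (1 / κ * ‖m‖ * ‖m‖) := by
        refine add_le_add (t1.trans ?_) (t2.trans ?_) <;> gcongr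
      _ = B := by rw [hB]; field_simp; ring
  have h0 : (0 : ℝ) ∈ Icc (0 : ℝ) 1 := ⟨le_rfl, zero_le_one⟩
  have h1 : (1 : ℝ) ∈ Icc (0 : ℝ) 1 := ⟨zero_le_one, le_rfl⟩
  have hB0 : 0 ≤ B := by positivity
  have step1 : ∀ t ∈ Icc (0 : ℝ) 1, ‖fderiv ℝ g (P (c t)) (fderiv ℝ P (c t) m) -
      fderiv ℝ g (P (c 0)) (fderiv ℝ P (c 0) m)‖ ≤ B := by
    intro t ht
    have := (convex_Icc (0 : ℝ) 1).norm_image_sub_le_of_norm_hasDerivWithin_le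
      (fun s hs => (hG' s hs).hasDerivWithinAt) hbd h0 ht
    refine this.trans ?_
    rw [sub_zero, Real.norm_of_nonneg ht.1]
    exact mul_le_of_le_one_right hB0 ht.2
  have step2 := (convex_Icc (0 : ℝ) 1).norm_image_sub_le_of_norm_hasDerivWithin_le
    (f := fun t => g (P (c t)) - t • fderiv ℝ g (P (c 0)) (fderiv ℝ P (c 0) m))
    (fun s hs => (((hG s hs).sub ((hasDerivAt_id s).smul_const _)).congr_deriv
      (by rw [one_smul])).hasDerivWithinAt) step1 h0 h1
  have hc0 : c 0 = y := by simp [hc]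
  have hc1 : c 1 = x := by simp [hc, hm]
  have e1 : g x = ub x := by rw [hg, normalExtension, ← hP, hPP x hx]
  have e2 : g y = ub y := by rw [hg, normalExtension, ← hP, hPP y hy]
  simp only [hc0, hc1, hPP x hx, hPP y hy, e1, e2, one_smul, zero_smul, sub_zero, norm_one,
    mul_one] at step2
  rwa [sub_right_comm] at step2

/-- Differentials of functions with given boundary values in tangential directions. -/
theorem apply_fderiv_nearestPoint {K : Set (EuclideanSpace ℝ (Fin n))} (hS : IsCompact S)
    (hSK : S ⊆ K) {y : EuclideanSpace ℝ (Fin n)} (hy : y ∈ S)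
    (hP : ContDiffAt ℝ 2 (nearestPoint S) y)
    {u : EuclideanSpace ℝ (Fin n) → EuclideanSpace ℝ (Fin k)} (hu : ∀ x ∈ S, u x = ub x)
    {A : EuclideanSpace ℝ (Fin n) →L[ℝ] EuclideanSpace ℝ (Fin k)}
    (hA : HasFDerivWithinAt u A K y) (v : EuclideanSpace ℝ (Fin n)) :
    A (fderiv ℝ (nearestPoint S) y v) = fderiv ℝ (normalExtension S ub) y v := by
  have hPS : ∀ z, nearestPoint S z ∈ S := fun z => (nearestPoint_spec hS ⟨y, hy⟩ z).1
  have hPy := nearestPoint_of_mem hS hy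
  have hPd := (hP.differentiableAt (by simp)).hasFDerivAt
  rw [← hPy] at hA
  have h1 := hA.comp_hasFDerivAt y hPd (Eventually.of_forall fun z => hSK (hPS z))
  have h2 : u ∘ nearestPoint S = normalExtension S ub := funext fun z => hu _ (hPS z)
  rw [h2] at h1
  rw [h1.fderiv]
  rfl

end BoundaryData

end

/-! ### Potentials with bounded kernels -/

section

section Parametric

set_option linter.unusedSectionVars false

variable {E : Type*} [NormedAddCommGroup E] [InnerProductSpace ℝ E] [MeasurableSpace E]
  [BorelSpace E] [SecondCountableTopology E]

/-- Differentiation under the integral sign for potentials with a bounded smooth kernel. -/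
theorem hasDerivAt_integral_kernel {μ : Measure E} {Γ Γ' : E → ℝ} {C : ℝ} {e : E}
    (hΓ : Continuous Γ) (hΓ' : Continuous Γ') (hb : ∀ x, |Γ x| ≤ C) (hb' : ∀ x, |Γ' x| ≤ C)
    (hd : ∀ x τ, HasDerivAt (fun τ : ℝ => Γ (x + τ • e)) (Γ' (x + τ • e)) τ)
    {b : E → E} (hbm : Measurable b) {m : E → ℝ} (hm : Integrable m μ) (x : E) (τ : ℝ) :
    HasDerivAt (fun τ : ℝ => ∫ z, Γ (x + τ • e - b z) * m z ∂μ)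
      (∫ z, Γ' (x + τ • e - b z) * m z ∂μ) τ := by
  have hmeas : ∀ {Φ : E → ℝ}, Continuous Φ → ∀ x : E,
      AEStronglyMeasurable (fun z => Φ (x - b z) * m z) μ := fun hΦ x =>
    (hΦ.measurable.comp (measurable_const.sub hbm)).aestronglyMeasurable.mul
      hm.aestronglyMeasurable
  refine (hasDerivAt_integral_of_dominated_loc_of_deriv_le (bound := fun z => C * |m z|)
    (F' := fun (τ : ℝ) z => Γ' (x + τ • e - b z) * m z) univ_mem
    (Eventually.of_forall fun τ => hmeas hΓ _) ?_ (hmeas hΓ' _) ?_ (hm.abs.const_mul C) ?_).2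
  · refine Integrable.mono' (hm.abs.const_mul C) (hmeas hΓ _) (Eventually.of_forall fun z => ?_)
    rw [norm_mul, Real.norm_eq_abs, Real.norm_eq_abs]
    gcongr
    exact hb _
  · refine Eventually.of_forall fun z τ _ => ?_
    rw [norm_mul, Real.norm_eq_abs, Real.norm_eq_abs]
    gcongr
    exact hb' _
  · refine Eventually.of_forall fun z τ _ => ?_
    have h := (hd (x - b z) τ).mul_const (m z)
    have e1 : ∀ τ : ℝ, x - b z + τ • e = x + τ • e - b z := fun τ => by abel
    simpa only [e1] using h

theorem integrable_kernel {μ : Measure E} {Γ : E → ℝ} {C : ℝ} (hΓ : Continuous Γ)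
    (hb : ∀ x, |Γ x| ≤ C) {b : E → E} (hbm : Measurable b) {m : E → ℝ} (hm : Integrable m μ)
    (x : E) : Integrable (fun z => Γ (x - b z) * m z) μ := by
  refine Integrable.mono' (hm.abs.const_mul C)
    ((hΓ.measurable.comp (measurable_const.sub hbm)).aestronglyMeasurable.mul
      hm.aestronglyMeasurable) (Eventually.of_forall fun z => ?_)
  rw [norm_mul, Real.norm_eq_abs, Real.norm_eq_abs]
  gcongr
  exact hb _

theorem continuous_integral_kernel {μ : Measure E} {Γ : E → ℝ} {C : ℝ} (hΓ : Continuous Γ)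
    (hb : ∀ x, |Γ x| ≤ C) {b : E → E} (hbm : Measurable b) {m : E → ℝ} (hm : Integrable m μ) :
    Continuous fun x => ∫ z, Γ (x - b z) * m z ∂μ := by
  refine continuous_of_dominated (bound := fun z => C * |m z|)
    (fun x => (integrable_kernel hΓ hb hbm hm x).aestronglyMeasurable)
    (fun x => Eventually.of_forall fun z => ?_) (hm.abs.const_mul C)
    (Eventually.of_forall fun z => by fun_prop)
  rw [norm_mul, Real.norm_eq_abs, Real.norm_eq_abs]
  gcongr
  exact hb _

end Parametric

/-! ### The regularised Green kernel outside a ball -/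

section Reflection

set_option linter.unusedSectionVars false

variable {E : Type*} [NormedAddCommGroup E] [InnerProductSpace ℝ E] {a η ρ : ℝ} {o : E}

theorem continuous_rpow_sq_norm (hη : 0 < η) (b : ℝ) :
    Continuous fun x : E => (‖x‖ ^ 2 + η ^ 2) ^ b :=
  Continuous.rpow_const (by fun_prop) fun x => Or.inl (sq_norm_add_sq_pos hη x).ne'

theorem continuous_regKernel (hη : 0 < η) : Continuous (regKernel a η : E → ℝ) :=
  continuous_rpow_sq_norm hη _

theorem continuous_regKernelDeriv (hη : 0 < η) (e : E) : Continuous (regKernelDeriv a η e) := by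
  have := continuous_rpow_sq_norm (E := E) hη (-a - 1)
  unfold regKernelDeriv
  fun_prop

theorem continuous_regKernelDeriv₂ (hη : 0 < η) (e : E) : Continuous (regKernelDeriv₂ a η e) := by
  have h1 := continuous_rpow_sq_norm (E := E) hη (-a - 1)
  have h2 := continuous_rpow_sq_norm (E := E) hη (-a - 2)
  unfold regKernelDeriv₂
  fun_prop

/-- The squared ratio of the distance to the centre and the radius of a sphere. -/
def reflFactor (o : E) (ρ : ℝ) (z : E) : ℝ := ‖z - o‖ ^ 2 / ρ ^ 2

/-- The reflection of `z` in the sphere of centre `o` and radius `ρ`. -/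
def reflPoint (o : E) (ρ : ℝ) (z : E) : E := o + (reflFactor o ρ z)⁻¹ • (z - o)

theorem one_le_reflFactor (hρ : 0 < ρ) {z : E} (hz : ρ ≤ dist z o) : 1 ≤ reflFactor o ρ z := by
  rw [dist_eq_norm] at hz
  rw [reflFactor, one_le_div (by positivity)]
  gcongr

/-- The regularised form of the classical identity for inversion. It turns the reflected kernel into
the power of a base that exceeds |x − z|² + η² by an explicit product. -/
theorem reflFactor_mul_sq_dist (hρ : 0 < ρ) {z : E} (hz : ρ ≤ dist z o) (x : E) :
    reflFactor o ρ z * (‖x - reflPoint o ρ z‖ ^ 2 + η ^ 2) =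
      ‖x - z‖ ^ 2 + η ^ 2 + (reflFactor o ρ z - 1) * (‖x - o‖ ^ 2 - ρ ^ 2 + η ^ 2) := by
  have hκ := one_le_reflFactor hρ hz
  have hκ0 : reflFactor o ρ z ≠ 0 := by positivity
  have e1 : x - reflPoint o ρ z = (x - o) - (reflFactor o ρ z)⁻¹ • (z - o) := by
    rw [reflPoint]; abel
  have e2 : x - z = (x - o) - (z - o) := by abel
  have e3 : ‖z - o‖ ^ 2 = reflFactor o ρ z * ρ ^ 2 := by
    rw [reflFactor, div_mul_cancel₀ _ (by positivity)]
  rw [e1, e2, norm_sub_sq_real (x - o) ((reflFactor o ρ z)⁻¹ • (z - o)),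
    norm_sub_sq_real (x - o) (z - o), inner_smul_right, norm_smul, mul_pow, e3,
    norm_inv, Real.norm_of_nonneg (by positivity)]
  field_simp
  ring

theorem dist_reflPoint_le (hρ : 0 < ρ) {z : E} (hz : ρ ≤ dist z o) :
    dist (reflPoint o ρ z) o ≤ ρ := by
  have h0 : 0 < ‖z - o‖ := by rw [← dist_eq_norm]; exact hρ.trans_le hz
  rw [dist_eq_norm] at hz ⊢
  rw [reflPoint, add_sub_cancel_left, norm_smul, norm_inv, reflFactor,
    Real.norm_of_nonneg (by positivity)]
  rw [inv_div, div_mul_eq_mul_div, div_le_iff₀ (by positivity)]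
  have := mul_le_mul_of_nonneg_left hz (by positivity : 0 ≤ ρ * ‖z - o‖)
  nlinarith

/-- The regularised Green kernel of the exterior of a ball. -/
def extGreen (a η : ℝ) (o : E) (ρ : ℝ) (x z : E) : ℝ :=
  regKernel a η (x - z) - reflFactor o ρ z ^ (-a) * regKernel a η (x - reflPoint o ρ z)

theorem extGreen_eq (hη : 0 < η) (hρ : 0 < ρ) {z : E} (hz : ρ ≤ dist z o) (x : E) :
    extGreen a η o ρ x z = (‖x - z‖ ^ 2 + η ^ 2) ^ (-a) -
      (‖x - z‖ ^ 2 + η ^ 2 +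
        (reflFactor o ρ z - 1) * (‖x - o‖ ^ 2 - ρ ^ 2 + η ^ 2)) ^ (-a) := by
  have hκ := one_le_reflFactor hρ hz
  rw [extGreen, regKernel, regKernel, ← Real.mul_rpow (by positivity) (by positivity),
    reflFactor_mul_sq_dist hρ hz]

/-- The two terms are the same decreasing power, the second at a larger base. The regularised kernel
need not vanish on the sphere, but its sign is all that the comparison needs there. -/
theorem extGreen_nonneg (ha : 0 ≤ a) (hη : 0 < η) (hρ : 0 < ρ) {x z : E} (hz : ρ ≤ dist z o)
    (hx : ρ ≤ dist x o) : 0 ≤ extGreen a η o ρ x z := by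
  have hκ := one_le_reflFactor hρ hz
  have hq := sq_norm_add_sq_pos hη (x - z)
  rw [dist_eq_norm] at hx
  have hx2 : ρ ^ 2 ≤ ‖x - o‖ ^ 2 := by gcongr
  rw [extGreen_eq hη hρ hz, sub_nonneg]
  refine Real.rpow_le_rpow_of_nonpos hq ?_ (by linarith)
  have : 0 ≤ (reflFactor o ρ z - 1) * (‖x - o‖ ^ 2 - ρ ^ 2 + η ^ 2) :=
    mul_nonneg (by linarith) (by nlinarith [sq_nonneg η])
  linarith

/-- The convex function s ↦ s^(−a) lies above its tangent line at A. -/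
theorem rpow_neg_sub_rpow_neg_le {A B : ℝ} (hA : 0 < A) (hAB : A ≤ B) (ha : 0 ≤ a) :
    A ^ (-a) - B ^ (-a) ≤ a * A ^ (-a - 1) * (B - A) := by
  have hB : 0 < B := hA.trans_le hAB
  have h1 : B ^ (-a) = A ^ (-a) * (B / A) ^ (-a) := by
    rw [← Real.mul_rpow hA.le (by positivity), mul_div_cancel₀ _ hA.ne']
  have h2 : 1 - a * (B / A - 1) ≤ (B / A) ^ (-a) := by
    rw [Real.rpow_def_of_pos (by positivity)]
    have h3 := Real.add_one_le_exp (Real.log (B / A) * -a)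
    have h4 := Real.log_le_sub_one_of_pos (by positivity : 0 < B / A)
    nlinarith
  have h5 : 0 < A ^ (-a) := Real.rpow_pos_of_pos hA _
  have h6 : A ^ (-a - 1) = A ^ (-a) / A := Real.rpow_sub_one hA.ne' _
  rw [h1, h6]
  calc A ^ (-a) - A ^ (-a) * (B / A) ^ (-a) ≤ A ^ (-a) - A ^ (-a) * (1 - a * (B / A - 1)) := by
        gcongr
    _ = a * (A ^ (-a) / A) * (B - A) := by field_simp; ring

/-- Boundary decay of the regularised Green kernel. -/
theorem extGreen_le (ha : 0 ≤ a) (hη : 0 < η) (hρ : 0 < ρ) {y ν z : E} {t : ℝ} (hν : ‖ν‖ = 1)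
    (ht : 0 < t) (ht1 : t ≤ 1) (hηt : η ^ 2 ≤ t) (hz : ρ ≤ dist z (y - ρ • ν))
    (hxz : 0 < ‖y + t • ν - z‖) (hxz2 : ‖y + t • ν - z‖ ≤ 2) :
    extGreen a η (y - ρ • ν) ρ (y + t • ν) z ≤
      (1 + a * ((4 * ρ + 8) * (2 * ρ + 2) / ρ ^ 2)) * t * ‖y + t • ν - z‖ ^ (-(2 * a + 1)) := by
  have hκ := one_le_reflFactor hρ hz
  set o := y - ρ • ν with ho
  set x := y + t • ν with hx
  set r := ‖x - z‖ with hr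
  have hxo : ‖x - o‖ = ρ + t := by
    rw [hx, ho, show y + t • ν - (y - ρ • ν) = (ρ + t) • ν by rw [add_smul]; abel, norm_smul, hν,
      mul_one, Real.norm_of_nonneg (by positivity)]
  have hq := sq_norm_add_sq_pos hη (x - z)
  rw [← hr] at hq
  have hC : 0 ≤ a * ((4 * ρ + 8) * (2 * ρ + 2) / ρ ^ 2) := by positivity
  have hrp : 0 < r ^ (-(2 * a + 1)) := Real.rpow_pos_of_pos hxz _
  have hpow : ∀ b : ℝ, 0 ≤ b → (r ^ 2 + η ^ 2) ^ (-b) ≤ r ^ (-(2 * b)) := by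
    intro b hb
    have h1 : r ^ (-(2 * b)) = (r ^ 2) ^ (-b) := by
      rw [← Real.rpow_natCast, ← Real.rpow_mul hxz.le]; congr 1; push_cast; ring
    rw [h1]
    exact Real.rpow_le_rpow_of_nonpos (by positivity) (by nlinarith [sq_nonneg η]) (by linarith)
  -- For r < t the plain bound r^(−2a) is at most t r^(−2a−1). Otherwise κ − 1 = O(r) and |x − o|² −
  -- ρ² + η² = O(t), the latter because η² ≤ t.
  rcases lt_or_ge r t with hrt | hrt
  · have h1 : extGreen a η o ρ x z ≤ (r ^ 2 + η ^ 2) ^ (-a) := by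
      rw [extGreen]
      exact sub_le_self _ <| mul_nonneg (Real.rpow_nonneg (by positivity) _) (regKernel_pos hη _).le
    have h2 : r ^ (-(2 * a)) = r * r ^ (-(2 * a + 1)) := by
      rw [mul_comm r, ← Real.rpow_add_one hxz.ne']; congr 1; ring
    calc extGreen a η o ρ x z ≤ r * r ^ (-(2 * a + 1)) := (h1.trans (hpow a ha)).trans h2.le
      _ ≤ 1 * t * r ^ (-(2 * a + 1)) := by rw [one_mul]; gcongr
      _ ≤ _ := by gcongr; linarith
  · rw [extGreen_eq hη hρ hz, ← hr, hxo]
    have hT0 : 0 ≤ (ρ + t) ^ 2 - ρ ^ 2 + η ^ 2 := by nlinarith [sq_nonneg η]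
    have hT : (ρ + t) ^ 2 - ρ ^ 2 + η ^ 2 ≤ (2 * ρ + 2) * t := by nlinarith
    have hzo : ‖z - o‖ ≤ ρ + 2 * r := by
      have h1 := norm_sub_le (x - o) (x - z)
      rw [sub_sub_sub_cancel_left, hxo, ← hr] at h1
      linarith
    have hκ2 : reflFactor o ρ z - 1 ≤ (4 * ρ + 8) / ρ ^ 2 * r := by
      rw [reflFactor, div_sub_one (by positivity), div_mul_eq_mul_div]
      gcongr
      nlinarith [norm_nonneg (z - o)]
    refine (rpow_neg_sub_rpow_neg_le hq (le_add_of_nonneg_right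
      (mul_nonneg (by linarith) hT0)) ha).trans ?_
    rw [add_sub_cancel_left]
    have h3 := hpow (a + 1) (by linarith)
    rw [show -(a + 1) = -a - 1 by ring] at h3
    have h4 : r ^ (-(2 * (a + 1))) * r = r ^ (-(2 * a + 1)) := by
      rw [← Real.rpow_add_one hxz.ne']; congr 1; ring
    calc a * (r ^ 2 + η ^ 2) ^ (-a - 1) *
          ((reflFactor o ρ z - 1) * ((ρ + t) ^ 2 - ρ ^ 2 + η ^ 2))
        ≤ a * r ^ (-(2 * (a + 1))) * ((4 * ρ + 8) / ρ ^ 2 * r * ((2 * ρ + 2) * t)) := by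
          gcongr
      _ = a * ((4 * ρ + 8) * (2 * ρ + 2) / ρ ^ 2) * t * (r ^ (-(2 * (a + 1))) * r) := by
          ring
      _ ≤ _ := by rw [h4]; gcongr; linarith

end Reflection

/-! ### Integrals of radial kernels and Hölder's inequality -/

section Radial

variable {n : ℕ}

theorem setIntegral_comp_sub_ball (f : EuclideanSpace ℝ (Fin n) → ℝ)
    (x : EuclideanSpace ℝ (Fin n)) (R : ℝ) :
    ∫ z in ball x R, f (x - z) = ∫ z in ball 0 R, f z := by
  have hpre : (fun z => x - z) ⁻¹' ball 0 R = ball x R := by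
    ext z
    simp [dist_eq_norm, norm_sub_rev]
  have h := (Measure.measurePreserving_sub_left (volume : Measure (EuclideanSpace ℝ (Fin n))) x)
  rw [← hpre, h.setIntegral_preimage_emb ((MeasurableEquiv.subLeft x).measurableEmbedding)]

theorem integrableOn_norm_rpow_ball (hn : 1 ≤ n) {α : ℝ} (hα : α < n) (R : ℝ) :
    IntegrableOn (fun z : EuclideanSpace ℝ (Fin n) => ‖z‖ ^ (-α)) (ball 0 R) := by
  refine integrableOn_ball_of_norm_le_rpow (C := 1) (α := α) (by simpa using hn) (by simpa using hα)
    (Eventually.of_forall fun z => ?_) (Measurable.aestronglyMeasurable (by fun_prop))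
  rw [one_mul, Real.norm_of_nonneg (by positivity)]

theorem integrableOn_norm_sub_rpow_ball (hn : 1 ≤ n) {α : ℝ} (hα : α < n)
    (x : EuclideanSpace ℝ (Fin n)) (R : ℝ) :
    IntegrableOn (fun z : EuclideanSpace ℝ (Fin n) => ‖x - z‖ ^ (-α)) (ball x R) := by
  have hpre : (fun z => x - z) ⁻¹' ball 0 R = ball x R := by
    ext z
    simp [dist_eq_norm, norm_sub_rev]
  have h := (Measure.measurePreserving_sub_left (volume : Measure (EuclideanSpace ℝ (Fin n))) x)
  rw [← hpre]
  exact (h.integrableOn_comp_preimage ((MeasurableEquiv.subLeft x).measurableEmbedding)).2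
    (integrableOn_norm_rpow_ball hn hα R)

theorem setIntegral_norm_sub_rpow_ball (α : ℝ) (x : EuclideanSpace ℝ (Fin n)) {R : ℝ}
    (hR : 0 < R) :
    ∫ z in ball x R, ‖x - z‖ ^ (-α) =
      R ^ ((n : ℝ) - α) * ∫ z in ball (0 : EuclideanSpace ℝ (Fin n)) 1, ‖z‖ ^ (-α) := by
  rw [setIntegral_comp_sub_ball (fun z => ‖z‖ ^ (-α))]
  have h := Measure.setIntegral_comp_smul_of_pos
    (volume : Measure (EuclideanSpace ℝ (Fin n))) (fun z => ‖z‖ ^ (-α)) (ball 0 1) hR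
  rw [smul_unitBall_of_pos hR] at h
  have h2 : ∀ z : EuclideanSpace ℝ (Fin n), ‖R • z‖ ^ (-α) = R ^ (-α) * ‖z‖ ^ (-α) := fun z => by
    rw [norm_smul, Real.norm_of_nonneg hR.le, Real.mul_rpow hR.le (norm_nonneg z)]
  simp only [h2, integral_const_mul, finrank_euclideanSpace, Fintype.card_fin, smul_eq_mul] at h
  rw [eq_inv_mul_iff_mul_eq₀ (by positivity)] at h
  rw [← h, sub_eq_add_neg, Real.rpow_add hR, Real.rpow_natCast]
  ring

/-- Potential estimate: the kernel `|x - z|^{1-n}` maps `L^p` to bounded functions for `p > n`. -/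
theorem exists_setIntegral_kernel_le (hn : 2 ≤ n) {p : ℝ} (hp : (n : ℝ) < p) :
    ∃ C : ℝ, 0 < C ∧ ∀ (x : EuclideanSpace ℝ (Fin n)) (R : ℝ), 0 < R →
      ∀ D ⊆ ball x R, MeasurableSet D → ∀ F : EuclideanSpace ℝ (Fin n) → ℝ,
      (∀ z ∈ D, 0 ≤ F z) → MemLp F (ENNReal.ofReal p) (volume.restrict D) → ∀ A : ℝ, 0 ≤ A →
      IntegrableOn (fun z => ‖x - z‖ ^ (-((n : ℝ) - 1)) * (F z + A)) D ∧
      ∫ z in D, ‖x - z‖ ^ (-((n : ℝ) - 1)) * (F z + A) ≤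
        C * (R ^ (1 - n / p) * (eLpNorm F (ENNReal.ofReal p) (volume.restrict D)).toReal
          + A * R) := by
  have hn1 : 1 ≤ n := by omega
  have hnR : (2 : ℝ) ≤ n := by exact_mod_cast hn
  have hp0 : 0 < p := by linarith
  have hp1 : 1 < p := by linarith
  set q := p / (p - 1) with hq
  have hpq : p.HolderConjugate q := Real.HolderConjugate.conjExponent hp1
  have hq0 : 0 < q := hpq.symm.pos
  set α := (n : ℝ) - 1 with hα
  have hαn : α < n := by linarith
  -- Here p > n enters: it makes |z|^(1−n) locally q-integrable for the conjugate exponent q.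
  have hαq : α * q < n := by
    rw [hq, ← mul_div_assoc, div_lt_iff₀ (by linarith)]
    nlinarith
  set I₁ := ∫ z in ball (0 : EuclideanSpace ℝ (Fin n)) 1, ‖z‖ ^ (-α) with hI₁
  set I₂ := ∫ z in ball (0 : EuclideanSpace ℝ (Fin n)) 1, ‖z‖ ^ (-(α * q)) with hI₂
  have hI₁0 : 0 ≤ I₁ := integral_nonneg fun z => by positivity
  have hI₂0 : 0 ≤ I₂ := integral_nonneg fun z => by positivity
  refine ⟨I₁ + I₂ ^ (1 / q) + 1, by positivity, ?_⟩
  intro x R hR D hD hDm F hF hFp A hA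
  have hg0 : ∀ z, 0 ≤ ‖x - z‖ ^ (-α) := fun z => by positivity
  have hgI : IntegrableOn (fun z => ‖x - z‖ ^ (-α)) D :=
    (integrableOn_norm_sub_rpow_ball hn1 hαn x R).mono_set hD
  have hgq : ∀ z, (‖x - z‖ ^ (-α)) ^ q = ‖x - z‖ ^ (-(α * q)) := fun z => by
    rw [← Real.rpow_mul (norm_nonneg _), neg_mul]
  have hgIq : IntegrableOn (fun z => ‖x - z‖ ^ (-(α * q))) (ball x R) :=
    integrableOn_norm_sub_rpow_ball hn1 hαq x R
  have hgL : MemLp (fun z => ‖x - z‖ ^ (-α)) (ENNReal.ofReal q) (volume.restrict D) := by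
    rw [← integrable_norm_rpow_iff hgI.aestronglyMeasurable (by simpa using hq0) (by simp),
      ENNReal.toReal_ofReal hq0.le]
    simp only [Real.norm_of_nonneg (hg0 _), hgq]
    exact hgIq.mono_set hD
  have hFae : 0 ≤ᵐ[volume.restrict D] F :=
    (ae_restrict_iff' hDm).2 (Eventually.of_forall hF)
  have := hpq.ennrealOfReal
  have hFg : IntegrableOn (fun z => F z * ‖x - z‖ ^ (-α)) D := by
    exact MemLp.integrable_mul hFp hgL
  have hsplit : ∀ z, ‖x - z‖ ^ (-α) * (F z + A) = F z * ‖x - z‖ ^ (-α) + A * ‖x - z‖ ^ (-α) :=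
    fun z => by ring
  simp only [hsplit]
  refine ⟨hFg.add (hgI.const_mul A), ?_⟩
  rw [integral_add hFg (hgI.const_mul A), integral_const_mul]
  have h1 := integral_mul_le_Lp_mul_Lq_of_nonneg hpq hFae
    (Eventually.of_forall hg0) hFp hgL
  have h2 : (eLpNorm F (ENNReal.ofReal p) (volume.restrict D)).toReal =
      (∫ z in D, F z ^ p) ^ (1 / p) := by
    rw [hFp.eLpNorm_eq_integral_rpow_norm (by simpa using hp0) (by simp),
      ENNReal.toReal_ofReal (by positivity), ENNReal.toReal_ofReal hp0.le, one_div]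
    congr 1
    refine setIntegral_congr_fun hDm fun z hz => ?_
    simp only [Real.norm_of_nonneg (hF z hz)]
  have h3 : (∫ z in D, (‖x - z‖ ^ (-α)) ^ q) ^ (1 / q) ≤ R ^ (1 - n / p) * I₂ ^ (1 / q) := by
    simp only [hgq]
    have h4 : ∫ z in D, ‖x - z‖ ^ (-(α * q)) ≤ R ^ (n - α * q) * I₂ := by
      rw [← setIntegral_norm_sub_rpow_ball _ x hR]
      exact setIntegral_mono_set hgIq (Eventually.of_forall fun z => by positivity)
        hD.eventuallyLE
    refine (Real.rpow_le_rpow (integral_nonneg fun z => by positivity) h4 (by positivity)).trans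
      (le_of_eq ?_)
    rw [Real.mul_rpow (by positivity) hI₂0, ← Real.rpow_mul hR.le]
    congr 2
    have h5 : 1 / q = 1 - 1 / p := by
      have := hpq.inv_add_inv_eq_one
      rw [one_div, one_div]; linarith
    rw [sub_mul, mul_assoc, mul_one_div_cancel hq0.ne', h5, hα]
    ring
  have h6 : ∫ z in D, ‖x - z‖ ^ (-α) ≤ R * I₁ := by
    have h7 := setIntegral_norm_sub_rpow_ball α x hR
    rw [hα, sub_sub_cancel, Real.rpow_one] at h7
    rw [← hI₁] at *
    exact (setIntegral_mono_set (integrableOn_norm_sub_rpow_ball hn1 hαn x R)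
      (Eventually.of_forall hg0) hD.eventuallyLE).trans h7.le
  have hN : 0 ≤ (∫ z in D, F z ^ p) ^ (1 / p) := by rw [← h2]; exact ENNReal.toReal_nonneg
  rw [h2]
  have hI₂q : 0 ≤ I₂ ^ (1 / q) := by positivity
  have hRp : 0 < R ^ (1 - n / p) := by positivity
  calc _ ≤ (∫ z in D, F z ^ p) ^ (1 / p) * (R ^ (1 - n / p) * I₂ ^ (1 / q)) + A * (R * I₁) := by
        refine add_le_add (h1.trans ?_) ?_ <;> gcongr
    _ = I₂ ^ (1 / q) * (R ^ (1 - n / p) * (∫ z in D, F z ^ p) ^ (1 / p)) + I₁ * (A * R) := by ring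
    _ ≤ (I₁ + I₂ ^ (1 / q) + 1) * (R ^ (1 - n / p) * (∫ z in D, F z ^ p) ^ (1 / p)) +
        (I₁ + I₂ ^ (1 / q) + 1) * (A * R) := by
        gcongr <;> linarith
    _ = _ := by ring

end Radial

end

/-! ### Construction of the barrier -/

section

variable {n : ℕ}

/-- The constant in the lower bound for the Laplacian of a regularised Newtonian potential. -/
def newtonConst (n : ℕ) (a : ℝ) : ℝ :=
  4 * a * (a + 1) * 2 ^ (-a - 2) * volume.real (ball (0 : EuclideanSpace ℝ (Fin n)) 1)

theorem newtonConst_pos {a : ℝ} (ha : 0 < a) : 0 < newtonConst n a := by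
  have : 0 < volume.real (ball (0 : EuclideanSpace ℝ (Fin n)) 1) :=
    ENNReal.toReal_pos (measure_ball_pos volume _ one_pos).ne' measure_ball_lt_top.ne
  unfold newtonConst
  positivity

/-- Minus the Laplacian of a regularised Newtonian potential dominates its density. -/
theorem newtonConst_mul_le {a η c : ℝ} (ha : 0 < a) (hna : (n : ℝ) = 2 * (a + 1)) (hη : 0 < η)
    (hc : 0 ≤ c) {D : Set (EuclideanSpace ℝ (Fin n))} (hD : MeasurableSet D)
    {m : EuclideanSpace ℝ (Fin n) → ℝ} (hm : IntegrableOn m D) (hm0 : ∀ z ∈ D, 0 ≤ m z)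
    {x : EuclideanSpace ℝ (Fin n)} (hxD : ball x η ⊆ D) (hmc : ∀ z ∈ ball x η, c ≤ m z) :
    newtonConst n a * c ≤
      ∫ z in D, 4 * a * (a + 1) * η ^ 2 * (‖x - z‖ ^ 2 + η ^ 2) ^ (-a - 2) * m z := by
  have hΨc : Continuous fun v : EuclideanSpace ℝ (Fin n) =>
      4 * a * (a + 1) * η ^ 2 * (‖v‖ ^ 2 + η ^ 2) ^ (-a - 2) :=
    continuous_const.mul (continuous_rpow_sq_norm hη _)
  have hΨ0 : ∀ v : EuclideanSpace ℝ (Fin n),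
      0 ≤ 4 * a * (a + 1) * η ^ 2 * (‖v‖ ^ 2 + η ^ 2) ^ (-a - 2) := fun v => by positivity
  have hint : IntegrableOn
      (fun z => 4 * a * (a + 1) * η ^ 2 * (‖x - z‖ ^ 2 + η ^ 2) ^ (-a - 2) * m z) D := by
    refine integrable_kernel (C := 4 * a * (a + 1) * η ^ 2 * (η ^ 2) ^ (-a - 2)) hΨc
      (fun v => ?_) measurable_id hm x
    rw [abs_of_nonneg (hΨ0 v)]
    have := rpow_neg_sq_norm_le hη (b := a + 2) (by linarith) v
    rw [show -(a + 2) = -a - 2 by ring] at this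
    gcongr
  have hvol : volume.real (ball x η) =
      η ^ n * volume.real (ball (0 : EuclideanSpace ℝ (Fin n)) 1) := by
    simp [Measure.real, Measure.addHaar_ball_of_pos volume x hη, ENNReal.toReal_ofReal,
      pow_nonneg hη.le]
  -- On this ball the bump is at least its value at distance η. Since n = 2(a + 1), the powers of η
  -- cancel against the volume, leaving a constant free of η.
  have hlow : ∀ z ∈ ball x η, 4 * a * (a + 1) * η ^ 2 * (2 * η ^ 2) ^ (-a - 2) * c ≤
      4 * a * (a + 1) * η ^ 2 * (‖x - z‖ ^ 2 + η ^ 2) ^ (-a - 2) * m z := by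
    intro z hz
    have h1 : ‖x - z‖ < η := by rwa [mem_ball', dist_eq_norm] at hz
    have h2 : ‖x - z‖ ^ 2 ≤ η ^ 2 := by gcongr
    have h3 : (2 * η ^ 2) ^ (-a - 2) ≤ (‖x - z‖ ^ 2 + η ^ 2) ^ (-a - 2) :=
      Real.rpow_le_rpow_of_nonpos (by positivity) (by linarith) (by linarith)
    have h4 := hmc z hz
    gcongr
  have hconst : newtonConst n a * c =
      volume.real (ball x η) * (4 * a * (a + 1) * η ^ 2 * (2 * η ^ 2) ^ (-a - 2) * c) := by
    have h1 : η ^ n * (η ^ 2 * (2 * η ^ 2) ^ (-a - 2)) = (2 : ℝ) ^ (-a - 2) := by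
      rw [Real.mul_rpow (by norm_num) (by positivity), ← Real.rpow_natCast η 2,
        ← Real.rpow_mul hη.le, ← Real.rpow_natCast η n, hna]
      have h2 : η ^ (2 * (a + 1)) * (η ^ ((2 : ℕ) : ℝ) * η ^ (((2 : ℕ) : ℝ) * (-a - 2))) = 1 := by
        rw [← Real.rpow_add hη, ← Real.rpow_add hη]
        have : 2 * (a + 1) + (((2 : ℕ) : ℝ) + ((2 : ℕ) : ℝ) * (-a - 2)) = 0 := by
          push_cast; ring
        rw [this, Real.rpow_zero]
      linear_combination (2 : ℝ) ^ (-a - 2) * h2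
    rw [hvol, newtonConst, ← h1]
    ring
  rw [hconst]
  calc _ = ∫ _z in ball x η, 4 * a * (a + 1) * η ^ 2 * (2 * η ^ 2) ^ (-a - 2) * c := by
        rw [setIntegral_const, smul_eq_mul]
    _ ≤ ∫ z in ball x η, 4 * a * (a + 1) * η ^ 2 * (‖x - z‖ ^ 2 + η ^ 2) ^ (-a - 2) * m z :=
        setIntegral_mono_on (integrableOn_const measure_ball_lt_top.ne) (hint.mono_set hxD)
          measurableSet_ball hlow
    _ ≤ _ := setIntegral_mono_set hint ((ae_restrict_iff' hD).2 (Eventually.of_forall fun z hz =>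
        mul_nonneg (hΨ0 _) (hm0 z hz))) hxD.eventuallyLE

set_option maxHeartbeats 1600000 in
/-- Potentials in the exterior of a ball as barriers: supersolutions that vanish linearly at a
boundary point, with a slope controlled by the `L^p` norm of the source, `p > n`. -/
theorem exists_barrier (hn : 3 ≤ n) {p : ℝ} (hp : (n : ℝ) < p) {ρ : ℝ} (hρ : 0 < ρ) :
    ∃ C : ℝ, 0 < C ∧ ∀ (y ν : EuclideanSpace ℝ (Fin n)) (s : ℝ), ‖ν‖ = 1 → 0 < s → s ≤ 1 →
      ∀ D : Set (EuclideanSpace ℝ (Fin n)), IsOpen D → D ⊆ ball y s →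
      (∀ z ∈ D, ρ ≤ dist z (y - ρ • ν)) →
      ∀ (F : EuclideanSpace ℝ (Fin n) → ℝ) (B : ℝ), ContinuousOn F D → (∀ z ∈ D, 0 ≤ F z) →
      (∀ z ∈ D, F z ≤ B) → ∀ A : ℝ, 0 < A → ∀ K ⊆ D, IsCompact K → ∀ t : ℝ, 0 < t → t < s →
      ∃ (w : EuclideanSpace ℝ (Fin n) → ℝ) (w₁ w₂ : Fin n → EuclideanSpace ℝ (Fin n) → ℝ),
        Continuous w ∧ (∀ x, ρ ≤ dist x (y - ρ • ν) → 0 ≤ w x) ∧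
        (∀ i x (τ : ℝ), HasDerivAt (fun τ : ℝ => w (x + τ • EuclideanSpace.single i 1))
          (w₁ i (x + τ • EuclideanSpace.single i 1)) τ) ∧
        (∀ i x (τ : ℝ), HasDerivAt (fun τ : ℝ => w₁ i (x + τ • EuclideanSpace.single i 1))
          (w₂ i (x + τ • EuclideanSpace.single i 1)) τ) ∧
        (∀ x ∈ K, ∑ i, w₂ i x < -(F x + A)) ∧
        w (y + t • ν) ≤ C * t * (s ^ (1 - n / p) *
          (eLpNorm F (ENNReal.ofReal p) (volume.restrict D)).toReal + A * s) := by
  obtain ⟨C₀, hC₀, hker⟩ := exists_setIntegral_kernel_le (n := n) (by omega) hp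
  have hnR : (3 : ℝ) ≤ n := by exact_mod_cast hn
  have hp0 : 0 < p := by linarith
  set a : ℝ := ((n : ℝ) - 2) / 2 with ha'
  have ha : 0 < a := by linarith
  have hna : (n : ℝ) = 2 * (a + 1) := by rw [ha']; ring
  set c := newtonConst n a with hcdef
  have hc : 0 < c := newtonConst_pos ha
  set Cg := 1 + a * ((4 * ρ + 8) * (2 * ρ + 2) / ρ ^ 2) with hCg
  have hCg0 : 0 < Cg := by positivity
  refine ⟨Cg * (2 / c) * (C₀ * 2), by positivity, ?_⟩
  intro y ν s hν hs hs1 D hD hDs hDρ F B hFc hF0 hFB A hA K hKD hK t ht hts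
  set o := y - ρ • ν with ho
  have hDm := hD.measurableSet
  have hDfin : volume D < ⊤ := (measure_mono hDs).trans_lt measure_ball_lt_top
  have : IsFiniteMeasure (volume.restrict D) := ⟨by simpa using hDfin⟩
  have hFm : AEStronglyMeasurable F (volume.restrict D) := hFc.aestronglyMeasurable hDm
  -- Openness of D upgrades the inequality to a strict one, which separates the compact K from the
  -- sphere by some d > 0.
  have hDo : ∀ z ∈ D, ρ < dist z o := by
    have h1 : D ⊆ interior (ball o ρ)ᶜ :=
      interior_maximal (fun z hz => by simpa using hDρ z hz) hD
    rw [interior_compl, closure_ball _ hρ.ne'] at h1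
    intro z hz
    simpa using h1 hz
  obtain ⟨d, hd, hdK⟩ : ∃ d : ℝ, 0 < d ∧ ∀ x ∈ K, ρ + d ≤ dist x o := by
    rcases K.eq_empty_or_nonempty with rfl | hne
    · exact ⟨1, one_pos, by simp⟩
    · obtain ⟨x₀, hx₀, hmin⟩ := hK.exists_isMinOn hne
        (f := fun x => dist x o) (by fun_prop)
      exact ⟨dist x₀ o - ρ, by linarith [hDo x₀ (hKD hx₀)], fun x hx => by
        have : dist x₀ o ≤ dist x o := hmin hx
        linarith⟩
  obtain ⟨η₁, hη₁, hη₁K⟩ : ∃ η₁ : ℝ, 0 < η₁ ∧ ∀ x ∈ K, ∀ z, dist z x < η₁ →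
      z ∈ D ∧ F x - A / 4 ≤ F z := by
    refine exists_uniform_pos_of_locally hK _ (fun x c c' _ hle h z hz => h z (hz.trans_le hle)) ?_
    intro x₀ hx₀
    have hcx : ContinuousAt F x₀ := hFc.continuousAt (hD.mem_nhds (hKD hx₀))
    have hev : ∀ᶠ z in 𝓝 x₀, z ∈ D ∧ dist (F z) (F x₀) < A / 8 :=
      Filter.Eventually.and (hD.mem_nhds (hKD hx₀))
        (hcx.eventually (ball_mem_nhds _ (by positivity)))
    obtain ⟨r, hr, hball⟩ := Metric.eventually_nhds_iff.1 hev
    refine ⟨r / 2, half_pos hr, mem_nhdsWithin_of_mem_nhds ?_⟩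
    filter_upwards [ball_mem_nhds x₀ (half_pos hr)] with x hx z hz
    have h1 := hball (by linarith [mem_ball.1 hx] : dist x x₀ < r)
    have h2 := hball (by linarith [mem_ball.1 hx, dist_triangle z x x₀] : dist z x₀ < r)
    rw [Real.dist_eq, abs_lt] at h1 h2
    exact ⟨h2.1, by linarith [h1.2.2, h2.2.1]⟩
  -- With the factor 2/c the direct potential has −Δ at least 2F + 3A/2 on K. The reflected one
  -- takes away at most A/4, so F + A is exceeded strictly.
  set m : EuclideanSpace ℝ (Fin n) → ℝ := fun z => 2 / c * (F z + A) with hm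
  set M := 2 / c * (|B| + A) with hM
  have hM0 : 0 < M := by positivity
  have hm0 : ∀ z ∈ D, 0 ≤ m z := fun z hz => by have := hF0 z hz; positivity
  have hmM : ∀ z ∈ D, m z ≤ M := fun z hz => by
    have := (hFB z hz).trans (le_abs_self B)
    simp only [hm, hM]
    gcongr
  have hmI : IntegrableOn m D := by
    refine Integrable.mono' (integrable_const M) ((hFm.add aestronglyMeasurable_const).const_mul _)
      ((ae_restrict_iff' hDm).2 (Eventually.of_forall fun z hz => ?_))
    rw [Real.norm_of_nonneg (hm0 z hz)]
    exact hmM z hz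
  have hκm : Measurable fun z : EuclideanSpace ℝ (Fin n) => reflFactor o ρ z ^ (-a) := by
    unfold reflFactor
    fun_prop
  have hκ1 : ∀ z ∈ D, reflFactor o ρ z ^ (-a) ≤ 1 := fun z hz =>
    Real.rpow_le_one_of_one_le_of_nonpos (one_le_reflFactor hρ (hDρ z hz)) (by linarith)
  have hκ0 : ∀ z : EuclideanSpace ℝ (Fin n), 0 ≤ reflFactor o ρ z ^ (-a) := fun z =>
    Real.rpow_nonneg (by unfold reflFactor; positivity) _
  set m₂ : EuclideanSpace ℝ (Fin n) → ℝ := fun z => reflFactor o ρ z ^ (-a) * m z with hm₂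
  have hm₂0 : ∀ z ∈ D, 0 ≤ m₂ z := fun z hz => mul_nonneg (hκ0 z) (hm0 z hz)
  have hm₂M : ∀ z ∈ D, m₂ z ≤ M := fun z hz =>
    (mul_le_of_le_one_left (hm0 z hz) (hκ1 z hz)).trans (hmM z hz)
  have hm₂I : IntegrableOn m₂ D := by
    refine Integrable.mono' (integrable_const M)
      (hκm.aestronglyMeasurable.mul hmI.aestronglyMeasurable)
      ((ae_restrict_iff' hDm).2 (Eventually.of_forall fun z hz => ?_))
    rw [Real.norm_of_nonneg (hm₂0 z hz)]
    exact hm₂M z hz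
  have hrefl : Measurable (reflPoint o ρ : EuclideanSpace ℝ (Fin n) → _) := by
    unfold reflPoint reflFactor
    fun_prop
  -- Reflected points lie in the closed ball about o, at distance at least d from K, so η²X bounds
  -- the reflected contribution to the Laplacian there.
  set X := 4 * a * (a + 1) * (d ^ 2) ^ (-a - 2) * M * volume.real D with hX
  have hX0 : 0 ≤ X := by positivity
  set η := min (min t η₁) (A / (4 * (X + 1))) with hηdef
  have hη : 0 < η := by positivity
  have hηt : η ≤ t := (min_le_left _ _).trans (min_le_left _ _)
  have hηη₁ : η ≤ η₁ := (min_le_left _ _).trans (min_le_right _ _)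
  have hη1 : η ≤ 1 := by linarith
  have hηX : η ^ 2 * X ≤ A / 4 := by
    have h1 : η * (4 * (X + 1)) ≤ A := (le_div_iff₀ (by positivity)).1 (min_le_right _ _)
    have h2 : η ^ 2 ≤ η := by nlinarith
    nlinarith
  have hη2t : η ^ 2 ≤ t := by nlinarith
  have he : ∀ i : Fin n, ‖EuclideanSpace.single i (1 : ℝ)‖ = 1 := fun i => by simp
  obtain ⟨C₁, hb0, hb1, hb2⟩ : ∃ C₁ : ℝ,
      (∀ v : EuclideanSpace ℝ (Fin n), |regKernel a η v| ≤ C₁) ∧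
      (∀ (i : Fin n) (v : EuclideanSpace ℝ (Fin n)),
        |regKernelDeriv a η (EuclideanSpace.single i 1) v| ≤ C₁) ∧
      (∀ (i : Fin n) (v : EuclideanSpace ℝ (Fin n)),
        |regKernelDeriv₂ a η (EuclideanSpace.single i 1) v| ≤ C₁) :=
    ⟨max ((η ^ 2) ^ (-a)) (max (2 * a * (η ^ 2) ^ (-a - 1) + 2 * a * (η ^ 2) ^ (-a))
        ((2 * a + 4 * a * (a + 1)) * (η ^ 2) ^ (-a - 1))),
      fun v => by
        rw [abs_of_pos (regKernel_pos hη v)]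
        exact (regKernel_le ha.le hη v).trans (le_max_left _ _),
      fun i v => (abs_regKernelDeriv_le ha.le hη (he i) v).trans
        ((le_max_left _ _).trans (le_max_right _ _)),
      fun i v => (abs_regKernelDeriv₂_le ha.le hη (he i) v).trans
        ((le_max_right _ _).trans (le_max_right _ _))⟩
  -- The barrier and its first and second line derivatives are all Φ of the corresponding kernels.
  set Φ : (EuclideanSpace ℝ (Fin n) → ℝ) → EuclideanSpace ℝ (Fin n) → ℝ := fun Γ x =>
    (∫ z in D, Γ (x - z) * m z) - ∫ z in D, Γ (x - reflPoint o ρ z) * m₂ z with hΦ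
  have hΦeq : ∀ x, Φ (regKernel a η) x = ∫ z in D, extGreen a η o ρ x z * m z := by
    intro x
    refine (integral_sub
      (integrable_kernel (continuous_regKernel hη) hb0 measurable_id hmI x)
      (integrable_kernel (continuous_regKernel hη) hb0 hrefl hm₂I x)).symm.trans ?_
    refine integral_congr_ae (Eventually.of_forall fun z => ?_)
    simp only [extGreen, hm₂, id]
    ring
  refine ⟨Φ (regKernel a η), fun i => Φ (regKernelDeriv a η (EuclideanSpace.single i 1)),
    fun i => Φ (regKernelDeriv₂ a η (EuclideanSpace.single i 1)), ?_, ?_, ?_, ?_, ?_, ?_⟩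
  · exact (continuous_integral_kernel (continuous_regKernel hη) hb0 measurable_id hmI).sub
      (continuous_integral_kernel (continuous_regKernel hη) hb0 hrefl hm₂I)
  · intro x hx
    rw [hΦeq]
    exact setIntegral_nonneg hDm fun z hz =>
      mul_nonneg (extGreen_nonneg ha.le hη hρ (hDρ z hz) hx) (hm0 z hz)
  · intro i x τ
    exact (hasDerivAt_integral_kernel (continuous_regKernel hη) (continuous_regKernelDeriv hη _)
      hb0 (hb1 i) (fun x τ => hasDerivAt_regKernel hη x _ τ) measurable_id hmI x τ).sub
      (hasDerivAt_integral_kernel (continuous_regKernel hη) (continuous_regKernelDeriv hη _)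
      hb0 (hb1 i) (fun x τ => hasDerivAt_regKernel hη x _ τ) hrefl hm₂I x τ)
  · intro i x τ
    exact (hasDerivAt_integral_kernel (continuous_regKernelDeriv hη _)
      (continuous_regKernelDeriv₂ hη _) (hb1 i) (hb2 i)
      (fun x τ => hasDerivAt_regKernelDeriv hη x _ τ) measurable_id hmI x τ).sub
      (hasDerivAt_integral_kernel (continuous_regKernelDeriv hη _)
      (continuous_regKernelDeriv₂ hη _) (hb1 i) (hb2 i)
      (fun x τ => hasDerivAt_regKernelDeriv hη x _ τ) hrefl hm₂I x τ)
  · intro x hx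
    have hsum : ∀ v : EuclideanSpace ℝ (Fin n),
        ∑ i, regKernelDeriv₂ a η (EuclideanSpace.single i 1) v =
          -(4 * a * (a + 1) * η ^ 2 * (‖v‖ ^ 2 + η ^ 2) ^ (-a - 2)) := fun v => by
      have := sum_regKernelDeriv₂ (EuclideanSpace.basisFun (Fin n) ℝ) (a := a) hη
        (by simpa using hna) v
      simp only [EuclideanSpace.basisFun_apply] at this
      rw [this]; ring
    have hsumint : ∀ {b : EuclideanSpace ℝ (Fin n) → EuclideanSpace ℝ (Fin n)}, Measurable b →
        ∀ {μ : EuclideanSpace ℝ (Fin n) → ℝ}, IntegrableOn μ D →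
        ∑ i, ∫ z in D, regKernelDeriv₂ a η (EuclideanSpace.single i 1) (x - b z) * μ z =
          -∫ z in D, 4 * a * (a + 1) * η ^ 2 * (‖x - b z‖ ^ 2 + η ^ 2) ^ (-a - 2) * μ z := by
      intro b hb μ hμ
      rw [← integral_finsetSum _ fun i _ =>
        integrable_kernel (continuous_regKernelDeriv₂ hη _) (hb2 i) hb hμ x, ← integral_neg]
      refine integral_congr_ae (Eventually.of_forall fun z => ?_)
      simp only [← Finset.sum_mul, hsum]
      ring
    have h1 : c * (2 / c * (F x - A / 4 + A)) ≤
        ∫ z in D, 4 * a * (a + 1) * η ^ 2 * (‖x - z‖ ^ 2 + η ^ 2) ^ (-a - 2) * m z := by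
      refine newtonConst_mul_le ha hna hη ?_ hDm hmI hm0
        (fun z hz => (hη₁K x hx z ((mem_ball.1 hz).trans_le hηη₁)).1) fun z hz => ?_
      · have := hF0 x (hKD hx)
        have : 0 ≤ F x - A / 4 + A := by linarith
        positivity
      · have := (hη₁K x hx z ((mem_ball.1 hz).trans_le hηη₁)).2
        simp only [hm]
        gcongr
    have h2 : ∫ z in D, 4 * a * (a + 1) * η ^ 2 *
        (‖x - reflPoint o ρ z‖ ^ 2 + η ^ 2) ^ (-a - 2) * m₂ z ≤ A / 4 := by
      have h3 : ∀ z ∈ D, 4 * a * (a + 1) * η ^ 2 *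
          (‖x - reflPoint o ρ z‖ ^ 2 + η ^ 2) ^ (-a - 2) * m₂ z ≤
          4 * a * (a + 1) * η ^ 2 * (d ^ 2) ^ (-a - 2) * M := by
        intro z hz
        have h4 : d ≤ ‖x - reflPoint o ρ z‖ := by
          rw [← dist_eq_norm]
          have := dist_triangle x (reflPoint o ρ z) o
          have := dist_reflPoint_le hρ (hDρ z hz)
          linarith [hdK x hx]
        have h5 : d ^ 2 ≤ ‖x - reflPoint o ρ z‖ ^ 2 := by gcongr
        have h6 : (‖x - reflPoint o ρ z‖ ^ 2 + η ^ 2) ^ (-a - 2) ≤ (d ^ 2) ^ (-a - 2) :=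
          Real.rpow_le_rpow_of_nonpos (by positivity) (by nlinarith) (by linarith)
        have h7 := hm₂M z hz
        have h8 := hm₂0 z hz
        gcongr
      have h9 : 0 ≤ 4 * a * (a + 1) * η ^ 2 * (d ^ 2) ^ (-a - 2) * M := by positivity
      calc _ ≤ ∫ _z in D, 4 * a * (a + 1) * η ^ 2 * (d ^ 2) ^ (-a - 2) * M :=
            integral_mono_of_nonneg ((ae_restrict_iff' hDm).2 (Eventually.of_forall fun z hz => by
              have := hm₂0 z hz
              simp only [Pi.zero_apply]
              positivity)) (integrable_const _)
              ((ae_restrict_iff' hDm).2 (Eventually.of_forall h3))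
        _ = η ^ 2 * X := by rw [setIntegral_const, smul_eq_mul, hX]; ring
        _ ≤ A / 4 := hηX
    have e₁ := hsumint measurable_id hmI
    have e₂ := hsumint hrefl hm₂I
    simp only [id] at e₁
    simp only [hΦ, Finset.sum_sub_distrib]
    rw [e₁, e₂]
    have h10 : c * (2 / c * (F x - A / 4 + A)) = 2 * (F x - A / 4 + A) := by
      rw [← mul_assoc, mul_div_cancel₀ _ hc.ne']
    have := hF0 x (hKD hx)
    linarith
  · rw [hΦeq]
    have hpos : 0 < 2 * s := by positivity
    have hsub : D ⊆ ball (y + t • ν) (2 * s) := by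
      intro z hz
      have h1 := mem_ball.1 (hDs hz)
      have h2 := dist_triangle_right z (y + t • ν) y
      have h3 : dist (y + t • ν) y = t := by
        rw [dist_eq_norm, add_sub_cancel_left, norm_smul, hν, mul_one, Real.norm_of_nonneg ht.le]
      rw [mem_ball]
      linarith
    have hFp : MemLp F (ENNReal.ofReal p) (volume.restrict D) :=
      MemLp.of_bound hFm |B| ((ae_restrict_iff' hDm).2 (Eventually.of_forall fun z hz => by
        rw [Real.norm_of_nonneg (hF0 z hz)]
        exact (hFB z hz).trans (le_abs_self B)))
    obtain ⟨hI, hle⟩ := hker (y + t • ν) (2 * s) hpos D hsub hDm F hF0 hFp A hA.le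
    have hne : ∀ᵐ z ∂(volume.restrict D), z ≠ y + t • ν := by
      have : Nonempty (Fin n) := ⟨⟨0, by omega⟩⟩
      exact ae_restrict_of_ae (Measure.ae_ne volume (y + t • ν))
    have hpt : ∀ᵐ z ∂(volume.restrict D), extGreen a η o ρ (y + t • ν) z * m z ≤
        Cg * t * (2 / c) * (‖y + t • ν - z‖ ^ (-((n : ℝ) - 1)) * (F z + A)) := by
      filter_upwards [hne, ae_restrict_mem hDm] with z hz hzD
      have h1 : 0 < ‖y + t • ν - z‖ := norm_pos_iff.2 (sub_ne_zero.2 (Ne.symm hz))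
      have h2 : ‖y + t • ν - z‖ ≤ 2 := by
        have := mem_ball'.1 (hsub hzD)
        rw [dist_eq_norm] at this
        linarith
      have h3 := extGreen_le ha.le hη hρ hν ht (by linarith) hη2t (hDρ z hzD) h1 h2
      rw [show 2 * a + 1 = (n : ℝ) - 1 by rw [hna]; ring] at h3
      calc _ ≤ Cg * t * ‖y + t • ν - z‖ ^ (-((n : ℝ) - 1)) * m z :=
            mul_le_mul_of_nonneg_right h3 (hm0 z hzD)
        _ = _ := by simp only [hm]; ring
    have hnn : 0 ≤ᵐ[volume.restrict D] fun z => extGreen a η o ρ (y + t • ν) z * m z := by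
      refine (ae_restrict_iff' hDm).2 (Eventually.of_forall fun z hz => ?_)
      refine mul_nonneg (extGreen_nonneg ha.le hη hρ (hDρ z hz) ?_) (hm0 z hz)
      rw [dist_eq_norm, ho, show y + t • ν - (y - ρ • ν) = (t + ρ) • ν by rw [add_smul]; abel,
        norm_smul, hν, mul_one, Real.norm_of_nonneg (by positivity)]
      linarith
    have hint := integral_mono_of_nonneg hnn (hI.const_mul (Cg * t * (2 / c))) hpt
    rw [integral_const_mul] at hint
    set L := (eLpNorm F (ENNReal.ofReal p) (volume.restrict D)).toReal with hL
    have hL0 : 0 ≤ L := ENNReal.toReal_nonneg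
    have h2s : (2 * s) ^ (1 - n / p) ≤ 2 * s ^ (1 - n / p) := by
      rw [Real.mul_rpow (by norm_num) hs.le]
      gcongr
      calc (2 : ℝ) ^ (1 - n / p) ≤ 2 ^ (1 : ℝ) :=
            Real.rpow_le_rpow_of_exponent_le (by norm_num)
              (by have : 0 ≤ n / p := by positivity
                  linarith)
        _ = 2 := Real.rpow_one 2
    calc _ ≤ Cg * t * (2 / c) * (C₀ * ((2 * s) ^ (1 - n / p) * L + A * (2 * s))) :=
          hint.trans (by gcongr)
      _ ≤ Cg * t * (2 / c) * (C₀ * (2 * s ^ (1 - n / p) * L + A * (2 * s))) := by gcongr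
      _ = _ := by ring

end

/-! ### The differential inequality for the test function -/

section

variable {n k : ℕ}

/-- The second derivative of `√(f ∘ U)` along a curve `U` with velocity `V`. -/
theorem hasDerivAt_sqrt_comp {f : EuclideanSpace ℝ (Fin k) → ℝ} (hf : ContDiff ℝ ∞ f)
    {U V : ℝ → EuclideanSpace ℝ (Fin k)} {a : EuclideanSpace ℝ (Fin k)}
    (hU : ∀ᶠ τ in 𝓝 (0 : ℝ), HasDerivAt U (V τ) τ) (hV : HasDerivAt V a 0) (hpos : 0 < f (U 0)) :
    ∃ q₁ : ℝ → ℝ, (∀ᶠ τ in 𝓝 (0 : ℝ), HasDerivAt (fun τ => √(f (U τ))) (q₁ τ) τ) ∧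
      HasDerivAt q₁ ((2 * f (U 0) * fderiv ℝ (fderiv ℝ f) (U 0) (V 0) (V 0) -
        fderiv ℝ f (U 0) (V 0) ^ 2) / (4 * (f (U 0) * √(f (U 0)))) +
        fderiv ℝ f (U 0) a / (2 * √(f (U 0)))) 0 := by
  have hU0 := hU.self_of_nhds
  have hfd : Differentiable ℝ f := hf.differentiable (by simp)
  have hfd' : Differentiable ℝ (fderiv ℝ f) :=
    (hf.fderiv_right (m := ∞) (by simp)).differentiable (by simp)
  have hposev : ∀ᶠ τ in 𝓝 (0 : ℝ), 0 < f (U τ) :=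
    (hf.continuous.continuousAt.comp hU0.continuousAt).eventually (lt_mem_nhds hpos)
  have hfU : ∀ᶠ τ in 𝓝 (0 : ℝ), HasDerivAt (fun τ => f (U τ)) (fderiv ℝ f (U τ) (V τ)) τ :=
    hU.mono fun τ h => (hfd _).hasFDerivAt.comp_hasDerivAt τ h
  refine ⟨fun τ => fderiv ℝ f (U τ) (V τ) / (2 * √(f (U τ))), ?_, ?_⟩
  · filter_upwards [hfU, hposev] with τ h1 h2 using h1.sqrt h2.ne'
  · have h1 : HasDerivAt (fun τ => fderiv ℝ f (U τ))
        (fderiv ℝ (fderiv ℝ f) (U 0) (V 0)) 0 := (hfd' _).hasFDerivAt.comp_hasDerivAt 0 hU0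
    have h2 := h1.clm_apply hV
    have h3 := (hfU.self_of_nhds.sqrt hpos.ne').const_mul 2
    have hs : 0 < √(f (U 0)) := Real.sqrt_pos.2 hpos
    refine (h2.div h3 (by positivity)).congr_deriv ?_
    have hsq : √(f (U 0)) ^ 2 = f (U 0) := Real.sq_sqrt hpos.le
    set S := √(f (U 0)) with hS
    rw [← hsq]
    field_simp
    ring

/-- Gradients of functions that are `C¹` up to the boundary are bounded. -/
theorem exists_bound_fderiv {Ω : Set (EuclideanSpace ℝ (Fin n))} (hΩ : IsOpen Ω)
    (hc : IsCompact (closure Ω)) {u : EuclideanSpace ℝ (Fin n) → EuclideanSpace ℝ (Fin k)}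
    (hu : ContDiffOn ℝ 1 u (closure Ω)) : ∃ B : ℝ, ∀ x ∈ Ω, ‖fderiv ℝ u x‖ ≤ B := by
  suffices h : ∃ B : ℝ, ∀ x ∈ closure Ω, x ∈ Ω → ‖fderiv ℝ u x‖ ≤ B from
    h.imp fun B hB x hx => hB x (subset_closure hx) hx
  refine exists_uniform_of_locally hc _ (fun x c c' hcc h hx => (h hx).trans hcc) ?_
  intro x₀ hx₀
  have h1 : ContDiffWithinAt ℝ (0 + 1) u (closure Ω) x₀ := by simpa using hu x₀ hx₀
  obtain ⟨V, hV, -, f', hf', hcf⟩ := (contDiffWithinAt_succ_iff_hasFDerivWithinAt (by simp)).1 h1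
  rw [insert_eq_of_mem hx₀] at hV
  have hcont : ContinuousWithinAt f' V x₀ := hcf.continuousWithinAt
  have hcont' : ContinuousWithinAt f' (closure Ω) x₀ := hcont.mono_of_mem_nhdsWithin hV
  refine ⟨‖f' x₀‖ + 1, ?_⟩
  filter_upwards [hcont'.norm.eventually (gt_mem_nhds (lt_add_one _)),
    eventually_eventually_nhdsWithin.2 hV, hV] with x h2 h3 h4 hxΩ
  have hnx : 𝓝[closure Ω] x = 𝓝 x :=
    nhdsWithin_eq_nhds.2 (mem_of_superset (hΩ.mem_nhds hxΩ) subset_closure)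
  have hVx : V ∈ 𝓝 x := by rw [← hnx]; exact h3
  rw [((hf' x h4).hasFDerivAt hVx).fderiv]
  exact h2.le

/-- Line derivatives of a smooth function and their sum, the Laplacian. -/
theorem hasDerivAt_line {Ω : Set (EuclideanSpace ℝ (Fin n))} (hΩ : IsOpen Ω)
    {u : EuclideanSpace ℝ (Fin n) → EuclideanSpace ℝ (Fin k)} (hu : ContDiffOn ℝ ∞ u Ω)
    {x : EuclideanSpace ℝ (Fin n)} (hx : x ∈ Ω) (e : EuclideanSpace ℝ (Fin n)) :
    (∀ᶠ τ in 𝓝 (0 : ℝ), HasDerivAt (fun τ : ℝ => u (x + τ • e)) (fderiv ℝ u (x + τ • e) e) τ) ∧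
    HasDerivAt (fun τ : ℝ => fderiv ℝ u (x + τ • e) e) (fderiv ℝ (fderiv ℝ u) x e e) 0 := by
  have hline : ∀ τ : ℝ, HasDerivAt (fun τ : ℝ => x + τ • e) e τ := fun τ => by
    simpa using ((hasDerivAt_id τ).smul_const e).const_add x
  have hat : ∀ z ∈ Ω, ContDiffAt ℝ ∞ u z := fun z hz => hu.contDiffAt (hΩ.mem_nhds hz)
  constructor
  · have : ∀ᶠ τ in 𝓝 (0 : ℝ), x + τ • e ∈ Ω :=
      (hline 0).continuousAt.eventually (hΩ.mem_nhds (by simpa using hx))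
    filter_upwards [this] with τ hτ
    exact ((hat _ hτ).differentiableAt (by simp)).hasFDerivAt.comp_hasDerivAt τ (hline τ)
  · have h1 : ContDiffAt ℝ ∞ (fderiv ℝ u) (x + (0 : ℝ) • e) := by
      simpa using (hat x hx).fderiv_right (m := ∞) (by simp)
    have h2 := (h1.differentiableAt (by simp)).hasFDerivAt.comp_hasDerivAt 0 (hline 0)
    exact (h2.clm_apply (hasDerivAt_const (0 : ℝ) e)).congr_deriv (by simp)

theorem laplacian_eq_sum_fderiv (u : EuclideanSpace ℝ (Fin n) → EuclideanSpace ℝ (Fin k))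
    (x : EuclideanSpace ℝ (Fin n)) : Laplacian.laplacian u x =
      ∑ i, fderiv ℝ (fderiv ℝ u) x (EuclideanSpace.single i 1) (EuclideanSpace.single i 1) := by
  rw [InnerProductSpace.laplacian_eq_iteratedFDeriv_orthonormalBasis u
    (EuclideanSpace.basisFun (Fin n) ℝ)]
  simp [iteratedFDeriv_two_apply]

/-- A function that is twice differentiable along the coordinate lines has non-positive Laplacian at
a local maximum. -/
theorem sum_second_deriv_nonpos {H : EuclideanSpace ℝ (Fin n) → ℝ} {x : EuclideanSpace ℝ (Fin n)}
    (hmax : IsLocalMax H x) {φ₁ : Fin n → ℝ → ℝ} {c : Fin n → ℝ}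
    (h₁ : ∀ i, ∀ᶠ τ in 𝓝 (0 : ℝ),
      HasDerivAt (fun τ : ℝ => H (x + τ • EuclideanSpace.single i 1)) (φ₁ i τ) τ)
    (h₂ : ∀ i, HasDerivAt (φ₁ i) (c i) 0) : ∑ i, c i ≤ 0 := by
  refine Finset.sum_nonpos fun i _ => second_deriv_nonpos_of_isLocalMax (h₁ i) (h₂ i) ?_
  have hcont : Continuous fun τ : ℝ => x + τ • EuclideanSpace.single i (1 : ℝ) := by fun_prop
  have h0 : Tendsto (fun τ : ℝ => x + τ • EuclideanSpace.single i (1 : ℝ)) (𝓝 0) (𝓝 x) := by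
    simpa using hcont.tendsto 0
  have := h0.eventually hmax
  simpa [IsLocalMax, IsMaxFilter] using this

theorem hasDerivAt_sq_norm_sub_line (x y : EuclideanSpace ℝ (Fin n)) (i : Fin n) :
    (∀ τ : ℝ, HasDerivAt (fun τ : ℝ => ‖x + τ • EuclideanSpace.single i (1 : ℝ) - y‖ ^ 2)
      (2 * (x i - y i + τ)) τ) ∧ HasDerivAt (fun τ : ℝ => 2 * (x i - y i + τ)) 2 0 := by
  constructor
  · intro τ
    have h : HasDerivAt (fun τ : ℝ => x + τ • EuclideanSpace.single i (1 : ℝ) - y)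
        (EuclideanSpace.single i 1) τ := by
      simpa using (((hasDerivAt_id τ).smul_const (EuclideanSpace.single i (1 : ℝ))).const_add
        x).sub_const y
    refine h.norm_sq.congr_deriv ?_
    rw [EuclideanSpace.inner_single_right]
    simp
    ring
  · simpa using ((hasDerivAt_id (0 : ℝ)).const_add (x i - y i)).const_mul 2

/-- The comparison function `⟨u - u(y) - L(· - y), e⟩ + K √f(u) - A₀ |· - y|²`. -/
def testFunction (f : EuclideanSpace ℝ (Fin k) → ℝ)
    (u : EuclideanSpace ℝ (Fin n) → EuclideanSpace ℝ (Fin k))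
    (L : EuclideanSpace ℝ (Fin n) →L[ℝ] EuclideanSpace ℝ (Fin k)) (e : EuclideanSpace ℝ (Fin k))
    (K A₀ : ℝ) (y x : EuclideanSpace ℝ (Fin n)) : ℝ :=
  inner ℝ (u x - u y - L (x - y)) e + K * √(f (u x)) - A₀ * ‖x - y‖ ^ 2

/-- The comparison function minus a strict supersolution has no interior local maximum. -/
theorem not_isLocalMax_testFunction {Ω : Set (EuclideanSpace ℝ (Fin n))} (hΩ : IsOpen Ω)
    {f : EuclideanSpace ℝ (Fin k) → ℝ} (hf : IsNondegeneratePotential f) {ε : ℝ}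
    {u : EuclideanSpace ℝ (Fin n) → EuclideanSpace ℝ (Fin k)} (hu : ContDiffOn ℝ ∞ u Ω)
    (heq : ∀ x ∈ Ω, Laplacian.laplacian u x = (1 / ε ^ 2) • gradient f (u x))
    {L : EuclideanSpace ℝ (Fin n) →L[ℝ] EuclideanSpace ℝ (Fin k)} {e : EuclideanSpace ℝ (Fin k)}
    (he : ‖e‖ ≤ 1) {K C A₀ : ℝ} (hK : 0 ≤ K) (hC : 0 ≤ C) {x y : EuclideanSpace ℝ (Fin n)}
    (hx : x ∈ Ω) (hfK : 2 * √(f (u x)) ≤ K * ‖fderiv ℝ f (u x)‖)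
    (hfC : ∀ v, -(C * (f (u x) * √(f (u x))) * ‖v‖ ^ 2) ≤
        2 * f (u x) * fderiv ℝ (fderiv ℝ f) (u x) v v - fderiv ℝ f (u x) v ^ 2)
    {w : EuclideanSpace ℝ (Fin n) → ℝ} {w₁ w₂ : Fin n → EuclideanSpace ℝ (Fin n) → ℝ}
    (hw₁ : ∀ i x (τ : ℝ), HasDerivAt (fun τ : ℝ => w (x + τ • EuclideanSpace.single i 1))
      (w₁ i (x + τ • EuclideanSpace.single i 1)) τ)
    (hw₂ : ∀ i x (τ : ℝ), HasDerivAt (fun τ : ℝ => w₁ i (x + τ • EuclideanSpace.single i 1))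
      (w₂ i (x + τ • EuclideanSpace.single i 1)) τ)
    (hw : ∑ i, w₂ i x < -(K * C * frobNorm (fderiv ℝ u x) ^ 2 + 2 * n * A₀)) :
    ¬ IsLocalMax (fun x => testFunction f u L e K A₀ y x - w x) x := by
  intro hmax
  set E : Fin n → EuclideanSpace ℝ (Fin n) := fun i => EuclideanSpace.single i 1 with hE
  have hF0 : 0 ≤ K * C * frobNorm (fderiv ℝ u x) ^ 2 := by positivity
  have hL : ∀ i (τ : ℝ), HasDerivAt (fun τ : ℝ => L (x + τ • E i - y)) (L (E i)) τ := fun i τ => by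
    have h : HasDerivAt (fun τ : ℝ => x + τ • E i - y) (E i) τ := by
      simpa using (((hasDerivAt_id τ).smul_const (E i)).const_add x).sub_const y
    exact L.hasFDerivAt.comp_hasDerivAt τ h
  have hin : ∀ i, ∀ᶠ τ in 𝓝 (0 : ℝ), HasDerivAt
      (fun τ : ℝ => inner ℝ (u (x + τ • E i) - u y - L (x + τ • E i - y)) e)
      (inner ℝ (fderiv ℝ u (x + τ • E i) (E i) - L (E i)) e) τ := fun i => by
    filter_upwards [(hasDerivAt_line hΩ hu hx (E i)).1] with τ hτ
    simpa using ((hτ.sub_const (u y)).sub (hL i τ)).inner ℝ (hasDerivAt_const τ e)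
  have hin' : ∀ i, HasDerivAt
      (fun τ : ℝ => inner ℝ (fderiv ℝ u (x + τ • E i) (E i) - L (E i)) e)
      (inner ℝ (fderiv ℝ (fderiv ℝ u) x (E i) (E i)) e) 0 := fun i => by
    simpa using (((hasDerivAt_line hΩ hu hx (E i)).2.sub_const (L (E i)))).inner ℝ
      (hasDerivAt_const (0 : ℝ) e)
  have hw2' : ∀ i, HasDerivAt (fun τ : ℝ => w₁ i (x + τ • E i)) (w₂ i x) 0 := fun i => by
    simpa using hw₂ i x 0
  have hlap := heq x hx
  rw [laplacian_eq_sum_fderiv] at hlap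
  have hsumin : ∑ i, inner ℝ (fderiv ℝ (fderiv ℝ u) x (E i) (E i)) e =
      1 / ε ^ 2 * inner ℝ (gradient f (u x)) e := by
    rw [← sum_inner, hlap, inner_smul_left]
    simp
  -- Where f(u) = 0 the square root may fail to be differentiable. There K√f(u) attains its minimum
  -- 0, so dropping it preserves the local maximum, and ∇f(u) vanishes too.
  rcases (hf.nonneg (u x)).eq_or_lt with h0 | hpos
  · have hgrad : gradient f (u x) = 0 := by
      rw [gradient, hf.fderiv_eq_zero h0.symm, map_zero]
    have hmax' : IsLocalMax (fun x => inner ℝ (u x - u y - L (x - y)) e - A₀ * ‖x - y‖ ^ 2 - w x)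
        x := by
      filter_upwards [hmax] with z hz
      simp only [testFunction, ← h0, Real.sqrt_zero, mul_zero, add_zero] at hz
      have : 0 ≤ K * √(f (u z)) := by positivity
      linarith
    have h1 := sum_second_deriv_nonpos hmax'
      (φ₁ := fun i τ => inner ℝ (fderiv ℝ u (x + τ • E i) (E i) - L (E i)) e
        - A₀ * (2 * (x i - y i + τ)) - w₁ i (x + τ • E i))
      (c := fun i => inner ℝ (fderiv ℝ (fderiv ℝ u) x (E i) (E i)) e - A₀ * 2 - w₂ i x)
      (fun i => by
        filter_upwards [hin i] with τ hτ
        exact (hτ.sub (((hasDerivAt_sq_norm_sub_line x y i).1 τ).const_mul A₀)).sub (hw₁ i x τ))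
      (fun i => ((hin' i).sub ((hasDerivAt_sq_norm_sub_line x y i).2.const_mul A₀)).sub (hw2' i))
    rw [Finset.sum_sub_distrib, Finset.sum_sub_distrib, hsumin, hgrad] at h1
    simp at h1
    linarith
  · choose q₁ hq₁ hq₂ using fun i => hasDerivAt_sqrt_comp hf.smooth
      (hasDerivAt_line hΩ hu hx (E i)).1 (hasDerivAt_line hΩ hu hx (E i)).2 (by simpa using hpos)
    simp only [zero_smul, add_zero] at hq₂
    have hs : 0 < √(f (u x)) := Real.sqrt_pos.2 hpos
    have hs₂ : ∑ i, fderiv ℝ f (u x) (fderiv ℝ (fderiv ℝ u) x (E i) (E i)) / (2 * √(f (u x))) =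
        fderiv ℝ f (u x) ((1 / ε ^ 2) • gradient f (u x)) / (2 * √(f (u x))) := by
      rw [← Finset.sum_div, ← map_sum, hlap]
    have h1 := sum_second_deriv_nonpos hmax
      (φ₁ := fun i τ => inner ℝ (fderiv ℝ u (x + τ • E i) (E i) - L (E i)) e + K * q₁ i τ
        - A₀ * (2 * (x i - y i + τ)) - w₁ i (x + τ • E i))
      (fun i => by
        filter_upwards [hin i, hq₁ i] with τ hτ hτ'
        exact ((hτ.add (hτ'.const_mul K)).sub
          (((hasDerivAt_sq_norm_sub_line x y i).1 τ).const_mul A₀)).sub (hw₁ i x τ))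
      (fun i => (((hin' i).add ((hq₂ i).const_mul K)).sub
        ((hasDerivAt_sq_norm_sub_line x y i).2.const_mul A₀)).sub (hw2' i))
    rw [Finset.sum_sub_distrib, Finset.sum_sub_distrib, Finset.sum_add_distrib, hsumin,
      ← Finset.mul_sum, Finset.sum_add_distrib, hs₂] at h1
    have hgf : fderiv ℝ f (u x) (gradient f (u x)) = ‖fderiv ℝ f (u x)‖ ^ 2 := by
      have h2 : fderiv ℝ f (u x) (gradient f (u x)) =
          inner ℝ (gradient f (u x)) (gradient f (u x)) := by
        conv_rhs => rw [gradient, InnerProductSpace.toDual_symm_apply]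
        rw [gradient]
      rw [h2, real_inner_self_eq_norm_sq, gradient, LinearIsometryEquiv.norm_map]
    have hgn : ‖gradient f (u x)‖ = ‖fderiv ℝ f (u x)‖ := by
      rw [gradient, LinearIsometryEquiv.norm_map]
    -- Semiconvexity of √f, summed over coordinate directions; the 4 in the denominator is given
    -- away.
    have hquad : -(C * frobNorm (fderiv ℝ u x) ^ 2) ≤
        ∑ i, (2 * f (u x) * fderiv ℝ (fderiv ℝ f) (u x) (fderiv ℝ u x (E i)) (fderiv ℝ u x (E i)) -
          fderiv ℝ f (u x) (fderiv ℝ u x (E i)) ^ 2) / (4 * (f (u x) * √(f (u x)))) := by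
      rw [frobNorm_sq, Finset.mul_sum, ← Finset.sum_neg_distrib]
      refine Finset.sum_le_sum fun i _ => ?_
      rw [le_div_iff₀ (by positivity)]
      refine le_trans ?_ (hfC _)
      have : 0 ≤ C * (f (u x) * √(f (u x))) * ‖fderiv ℝ u x (E i)‖ ^ 2 := by positivity
      simp only [hE] at this ⊢
      nlinarith
    have hine : -‖fderiv ℝ f (u x)‖ ≤ inner ℝ (gradient f (u x)) e := by
      have h2 := abs_real_inner_le_norm (gradient f (u x)) e
      rw [hgn] at h2
      have h3 := (abs_le.1 h2).1
      nlinarith [norm_nonneg (fderiv ℝ f (u x))]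
    -- The Łojasiewicz inequality makes the ε⁻² term of K√f(u) absorb ε⁻²⟨∇f(u), e⟩.
    have hKf : ‖fderiv ℝ f (u x)‖ ≤ K * (‖fderiv ℝ f (u x)‖ ^ 2 / (2 * √(f (u x)))) := by
      rw [← mul_div_assoc, le_div_iff₀ (by positivity)]
      nlinarith [norm_nonneg (fderiv ℝ f (u x))]
    have hsplit : fderiv ℝ f (u x) ((1 / ε ^ 2) • gradient f (u x)) / (2 * √(f (u x))) =
        1 / ε ^ 2 * (‖fderiv ℝ f (u x)‖ ^ 2 / (2 * √(f (u x)))) := by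
      rw [map_smul, hgf, smul_eq_mul, mul_div_assoc]
    have hε : 0 ≤ 1 / ε ^ 2 * (inner ℝ (gradient f (u x)) e +
        K * (‖fderiv ℝ f (u x)‖ ^ 2 / (2 * √(f (u x))))) := by
      have : 0 ≤ 1 / ε ^ 2 := by positivity
      exact mul_nonneg this (by linarith)
    rw [hsplit] at h1
    have hKq := mul_le_mul_of_nonneg_left hquad hK
    simp only [Finset.sum_const, Finset.card_univ, Fintype.card_fin, nsmul_eq_mul] at h1
    nlinarith

end

/-! ### Comparison and the normal derivative -/

section

variable {n k : ℕ}

/-- A one-sided first order bound along `ν` bounds the derivative in the direction `ν`. -/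
theorem norm_apply_sub_le_of_inner_le {Ω : Set (EuclideanSpace ℝ (Fin n))}
    {u : EuclideanSpace ℝ (Fin n) → EuclideanSpace ℝ (Fin k)} {y ν : EuclideanSpace ℝ (Fin n)}
    {A L : EuclideanSpace ℝ (Fin n) →L[ℝ] EuclideanSpace ℝ (Fin k)}
    (hA : HasFDerivWithinAt u A (closure Ω) y) (hν : ∀ᶠ t : ℝ in 𝓝[>] 0, y + t • ν ∈ Ω)
    {N A₀ : ℝ} (hN : 0 ≤ N) (h : ∀ e : EuclideanSpace ℝ (Fin k), ‖e‖ ≤ 1 → ∀ᶠ t : ℝ in 𝓝[>] 0,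
      inner ℝ (u (y + t • ν) - u y - L (t • ν)) e ≤ t * N + A₀ * t ^ 2) :
    ‖A ν - L ν‖ ≤ N := by
  have hlim : Tendsto (fun t : ℝ => t⁻¹ • (u (y + t • ν) - u y)) (𝓝[>] 0) (𝓝 (A ν)) := by
    have hc : Continuous fun t : ℝ => t • ν := by fun_prop
    refine hA.lim ((by simpa using hc.tendsto 0 : Tendsto _ (𝓝 (0 : ℝ)) _).mono_left
      nhdsWithin_le_nhds) (hν.mono fun t ht => subset_closure ht) (tendsto_const_nhds.congr' ?_)
    filter_upwards [self_mem_nhdsWithin] with t ht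
    rw [inv_smul_smul₀ (ne_of_gt ht)]
  have hin : ∀ e : EuclideanSpace ℝ (Fin k), ‖e‖ ≤ 1 → inner ℝ (A ν - L ν) e ≤ N := by
    intro e he
    have h1 : Tendsto (fun t : ℝ => inner ℝ (t⁻¹ • (u (y + t • ν) - u y) - L ν) e) (𝓝[>] 0)
        (𝓝 (inner ℝ (A ν - L ν) e)) := (hlim.sub_const _).inner tendsto_const_nhds
    have h2 : Tendsto (fun t : ℝ => N + A₀ * t) (𝓝[>] 0) (𝓝 N) := by
      have : Continuous fun t : ℝ => N + A₀ * t := by fun_prop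
      simpa using (this.tendsto 0).mono_left nhdsWithin_le_nhds
    refine le_of_tendsto_of_tendsto h1 h2 ?_
    filter_upwards [h e he, self_mem_nhdsWithin] with t ht ht0
    have ht0' : 0 < t := ht0
    have h3 : t⁻¹ • (u (y + t • ν) - u y) - L ν = t⁻¹ • (u (y + t • ν) - u y - L (t • ν)) := by
      rw [map_smul, smul_sub _ (u (y + t • ν) - u y), inv_smul_smul₀ ht0'.ne']
    rw [h3, real_inner_smul_left, inv_mul_le_iff₀ ht0']
    linarith
  rcases eq_or_ne (A ν - L ν) 0 with h0 | h0
  · simpa [h0] using hN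
  · have h1 := hin (‖A ν - L ν‖⁻¹ • (A ν - L ν)) (norm_smul_inv_norm h0).le
    rwa [real_inner_smul_right, real_inner_self_eq_norm_sq, sq,
      inv_mul_cancel_left₀ (norm_ne_zero_iff.2 h0)] at h1

/-- Comparison of the test function with the barrier. -/
theorem testFunction_le {Ω : Set (EuclideanSpace ℝ (Fin n))} (hΩ : IsOpen Ω)
    (hΩc : IsCompact (closure Ω)) {f : EuclideanSpace ℝ (Fin k) → ℝ}
    (hf : IsNondegeneratePotential f) {ε : ℝ}
    {ub u : EuclideanSpace ℝ (Fin n) → EuclideanSpace ℝ (Fin k)} (hu : IsSmoothSolution Ω f ε ub u)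
    {L : EuclideanSpace ℝ (Fin n) →L[ℝ] EuclideanSpace ℝ (Fin k)} {e : EuclideanSpace ℝ (Fin k)}
    (he : ‖e‖ ≤ 1) {K C A₀ : ℝ} (hK : 0 ≤ K) (hC : 0 ≤ C) {y ν o : EuclideanSpace ℝ (Fin n)}
    {s ρ N t : ℝ}
    (hfKC : ∀ x ∈ Ω ∩ ball y s, 2 * √(f (u x)) ≤ K * ‖fderiv ℝ f (u x)‖ ∧
      ∀ v, -(C * (f (u x) * √(f (u x))) * ‖v‖ ^ 2) ≤
        2 * f (u x) * fderiv ℝ (fderiv ℝ f) (u x) v v - fderiv ℝ f (u x) v ^ 2)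
    (ho : ∀ z ∈ Ω, ρ ≤ dist z o)
    (hfr : ∀ x ∈ frontier Ω, dist x y ≤ s → testFunction f u L e K A₀ y x ≤ 0)
    (hsp : ∀ x ∈ closure Ω, dist x y = s → testFunction f u L e K A₀ y x ≤ 0)
    (hbar : ∀ S ⊆ Ω ∩ ball y s, IsCompact S →
      ∃ (w : EuclideanSpace ℝ (Fin n) → ℝ) (w₁ w₂ : Fin n → EuclideanSpace ℝ (Fin n) → ℝ),
        Continuous w ∧ (∀ x, ρ ≤ dist x o → 0 ≤ w x) ∧
        (∀ i x (τ : ℝ), HasDerivAt (fun τ : ℝ => w (x + τ • EuclideanSpace.single i 1))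
          (w₁ i (x + τ • EuclideanSpace.single i 1)) τ) ∧
        (∀ i x (τ : ℝ), HasDerivAt (fun τ : ℝ => w₁ i (x + τ • EuclideanSpace.single i 1))
          (w₂ i (x + τ • EuclideanSpace.single i 1)) τ) ∧
        (∀ x ∈ S, ∑ i, w₂ i x < -(K * C * frobNorm (fderiv ℝ u x) ^ 2 + 2 * n * A₀)) ∧
        w (y + t • ν) ≤ N)
    (htΩ : y + t • ν ∈ Ω) (hts : dist (y + t • ν) y ≤ s) :
    testFunction f u L e K A₀ y (y + t • ν) ≤ N := by
  set h := testFunction f u L e K A₀ y with hh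
  set Q := closure Ω ∩ closedBall y s with hQ
  have hQc : IsCompact Q := hΩc.inter_right isClosed_closedBall
  have huc : ContinuousOn u Q := hu.contDiffOn_closure.continuousOn.mono inter_subset_left
  have hhc : ContinuousOn h Q := by
    have h1 : ContinuousOn (fun x => f (u x)) Q := hf.smooth.continuous.comp_continuousOn huc
    have h2 : ContinuousOn (fun x => u x - u y - L (x - y)) Q :=
      (huc.sub continuousOn_const).sub (by fun_prop : Continuous fun x => L (x - y)).continuousOn
    exact ((h2.inner continuousOn_const).add (continuousOn_const.mul h1.sqrt)).sub
      (by fun_prop : Continuous fun x => A₀ * ‖x - y‖ ^ 2).continuousOn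
  have hoc : ∀ z ∈ closure Ω, ρ ≤ dist z o := by
    have : closure Ω ⊆ {z | ρ ≤ dist z o} :=
      closure_minimal ho (isClosed_le continuous_const (by fun_prop))
    exact this
  -- Since h ≤ 0 on the boundary of the region, {h ≥ τ} is a compact subset of its interior, where a
  -- barrier is available. The barrier depends on τ, but N does not.
  refine le_of_forall_pos_le_add fun τ hτ => ?_
  set S := Q ∩ h ⁻¹' Ici τ with hS
  have hSc : IsCompact S :=
    hQc.of_isClosed_subset (hhc.preimage_isClosed_of_isClosed hQc.isClosed isClosed_Ici)
      inter_subset_left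
  have hSD : S ⊆ Ω ∩ ball y s := by
    rintro x ⟨⟨hx1, hx2⟩, hx3⟩
    have hx3' : τ ≤ h x := hx3
    constructor
    · by_contra hx
      have : x ∈ frontier Ω := by
        rw [frontier, hΩ.interior_eq]; exact ⟨hx1, hx⟩
      linarith [hfr x this hx2]
    · rcases (mem_closedBall.1 hx2).lt_or_eq with hlt | heq
      · exact hlt
      · linarith [hsp x hx1 heq]
  obtain ⟨w, w₁, w₂, hwc, hw0, hw1, hw2, hwS, hwN⟩ := hbar S hSD hSc
  have htQ : y + t • ν ∈ Q := ⟨subset_closure htΩ, hts⟩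
  obtain ⟨x, hxQ, hmax⟩ := hQc.exists_isMaxOn ⟨_, htQ⟩ (hhc.sub hwc.continuousOn)
  have hle : h (y + t • ν) - w (y + t • ν) ≤ h x - w x := hmax htQ
  -- A maximum above τ would, as w ≥ 0, lie in S, and so be an interior local maximum.
  by_cases hx : h x - w x ≤ τ
  · linarith
  exfalso
  push Not at hx
  have hxS : x ∈ S := ⟨hxQ, by
    have := hw0 x (hoc x hxQ.1)
    simp only [mem_preimage, mem_Ici]
    linarith⟩
  have hxD := hSD hxS
  have hloc : IsLocalMax (fun x => h x - w x) x := by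
    have hnhd : Ω ∩ ball y s ∈ 𝓝 x := (hΩ.inter isOpen_ball).mem_nhds hxD
    filter_upwards [hnhd] with z hz
    exact hmax ⟨subset_closure hz.1, ball_subset_closedBall hz.2⟩
  exact not_isLocalMax_testFunction hΩ hf hu.smooth hu.eqn he hK hC hxD.1 (hfKC x hxD).1
    (hfKC x hxD).2 hw1 hw2 (hwS x hxS) hloc

/-- The normal derivative at a boundary point is controlled by tangential Taylor bounds of the
boundary data, by the oscillation of the solution, and by a barrier. -/
theorem norm_apply_normal_le {Ω : Set (EuclideanSpace ℝ (Fin n))} (hΩ : IsOpen Ω)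
    (hΩc : IsCompact (closure Ω)) {f : EuclideanSpace ℝ (Fin k) → ℝ}
    (hf : IsNondegeneratePotential f) {ε : ℝ}
    {ub u : EuclideanSpace ℝ (Fin n) → EuclideanSpace ℝ (Fin k)} (hu : IsSmoothSolution Ω f ε ub u)
    {A L : EuclideanSpace ℝ (Fin n) →L[ℝ] EuclideanSpace ℝ (Fin k)} {K C : ℝ} (hK : 0 ≤ K)
    (hC : 0 ≤ C) {y ν o : EuclideanSpace ℝ (Fin n)} (hA : HasFDerivWithinAt u A (closure Ω) y)
    (hν : ‖ν‖ = 1) (hνΩ : ∀ᶠ t : ℝ in 𝓝[>] 0, y + t • ν ∈ Ω) {s ρ N ℓ τ b A₀ : ℝ} (hs : 0 < s)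
    (hfKC : ∀ x ∈ Ω ∩ ball y s, 2 * √(f (u x)) ≤ K * ‖fderiv ℝ f (u x)‖ ∧
      ∀ v, -(C * (f (u x) * √(f (u x))) * ‖v‖ ^ 2) ≤
        2 * f (u x) * fderiv ℝ (fderiv ℝ f) (u x) v v - fderiv ℝ f (u x) v ^ 2)
    (ho : ∀ z ∈ Ω, ρ ≤ dist z o) (hN : 0 ≤ N) (hℓ0 : 0 ≤ ℓ) (hτ0 : 0 ≤ τ) (hb0 : 0 ≤ b)
    (hℓ : ∀ v, ‖L v‖ ≤ ℓ * ‖v‖) (hf0 : ∀ x ∈ frontier Ω, f (u x) = 0)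
    (hτ : ∀ x ∈ frontier Ω, dist x y ≤ s → ‖u x - u y - L (x - y)‖ ≤ τ * ‖x - y‖ ^ 2)
    (hb : ∀ x ∈ closure Ω, dist x y ≤ s → ‖u x - u y‖ + K * √(f (u x)) ≤ b)
    (hA₀ : A₀ * s = τ * s + b / s + ℓ)
    (hbar : ∀ t : ℝ, 0 < t → t < s → ∀ S ⊆ Ω ∩ ball y s, IsCompact S →
      ∃ (w : EuclideanSpace ℝ (Fin n) → ℝ) (w₁ w₂ : Fin n → EuclideanSpace ℝ (Fin n) → ℝ),
        Continuous w ∧ (∀ x, ρ ≤ dist x o → 0 ≤ w x) ∧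
        (∀ i x (τ : ℝ), HasDerivAt (fun τ : ℝ => w (x + τ • EuclideanSpace.single i 1))
          (w₁ i (x + τ • EuclideanSpace.single i 1)) τ) ∧
        (∀ i x (τ : ℝ), HasDerivAt (fun τ : ℝ => w₁ i (x + τ • EuclideanSpace.single i 1))
          (w₂ i (x + τ • EuclideanSpace.single i 1)) τ) ∧
        (∀ x ∈ S, ∑ i, w₂ i x < -(K * C * frobNorm (fderiv ℝ u x) ^ 2 + 2 * n * A₀)) ∧
        w (y + t • ν) ≤ t * N) :
    ‖A ν‖ ≤ ℓ + N := by
  -- On the sphere A₀s² covers the oscillation b and the linear part ℓs; on ∂Ω it is enough that A₀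
  -- ≥ τ.
  have hA₀s : A₀ * s ^ 2 = τ * s ^ 2 + b + ℓ * s := by
    calc A₀ * s ^ 2 = A₀ * s * s := by ring
      _ = τ * s ^ 2 + b + ℓ * s := by rw [hA₀]; field_simp
  have hA₀τ : τ ≤ A₀ := by
    have : 0 ≤ b + ℓ * s := by positivity
    have hs2 : 0 < s ^ 2 := by positivity
    nlinarith
  have hinner : ∀ (v e : EuclideanSpace ℝ (Fin k)), ‖e‖ ≤ 1 → inner ℝ v e ≤ ‖v‖ := fun v e he =>
    (real_inner_le_norm v e).trans (mul_le_of_le_one_right (norm_nonneg v) he)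
  suffices h : ‖A ν - L ν‖ ≤ N by
    have h1 := hℓ ν
    rw [hν, mul_one] at h1
    calc ‖A ν‖ = ‖L ν + (A ν - L ν)‖ := by congr 1; abel
      _ ≤ ℓ + N := (norm_add_le _ _).trans (add_le_add h1 h)
  refine norm_apply_sub_le_of_inner_le hA hνΩ hN (A₀ := A₀) fun e he => ?_
  filter_upwards [hνΩ, self_mem_nhdsWithin,
    mem_nhdsWithin_of_mem_nhds (Iio_mem_nhds hs)] with t htΩ ht hts
  have ht0 : 0 < t := ht
  have hd : ‖t • ν‖ = t := by
    rw [norm_smul, hν, mul_one, Real.norm_of_nonneg ht0.le]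
  have h1 := testFunction_le hΩ hΩc hf hu (L := L) he hK hC hfKC ho (A₀ := A₀)
    (fun x hx hxs => by
      have h2 := (hinner _ e he).trans (hτ x hx hxs)
      simp only [testFunction, hf0 x hx, Real.sqrt_zero, mul_zero, add_zero]
      nlinarith [sq_nonneg ‖x - y‖])
    (fun x hx hxs => by
      have h2 := hinner (u x - u y - L (x - y)) e he
      have h3 := norm_sub_le (u x - u y) (L (x - y))
      have h4 := hℓ (x - y)
      have h5 := hb x hx hxs.le
      rw [dist_eq_norm] at hxs
      rw [hxs] at h4
      simp only [testFunction, hxs, hA₀s]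
      have : 0 ≤ τ * s ^ 2 := by positivity
      linarith)
    (hbar t ht0 hts) htΩ (by rw [dist_eq_norm, add_sub_cancel_left, hd]; exact le_of_lt hts)
  simp only [testFunction, add_sub_cancel_left, hd] at h1
  have h2 : 0 ≤ K * √(f (u (y + t • ν))) := by positivity
  linarith

/-- The `L^p` norm of `|∇u|²` is bounded by that of the energy density. -/
theorem eLpNorm_frobNorm_sq_le {E D : Set (EuclideanSpace ℝ (Fin n))} (hDE : D ⊆ E)
    (hE : MeasurableSet E) (hEb : volume E ≠ ⊤) {f : EuclideanSpace ℝ (Fin k) → ℝ}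
    (hf : ∀ z, 0 ≤ f z) {u : EuclideanSpace ℝ (Fin n) → EuclideanSpace ℝ (Fin k)} {B Q : ℝ}
    (hB : ∀ x ∈ E, ‖fderiv ℝ u x‖ ≤ B) (hQ : ∀ x ∈ E, f (u x) ≤ Q) {c : ℝ} (hc : 0 ≤ c) (ε : ℝ)
    (p : ENNReal) :
    (eLpNorm (fun x => c * frobNorm (fderiv ℝ u x) ^ 2) p (volume.restrict D)).toReal ≤
      2 * c * (eLpNorm (energyDensity f ε u) p (volume.restrict E)).toReal := by
  have hen : ∀ x, 0 ≤ 1 / ε ^ 2 * f (u x) := fun x => mul_nonneg (by positivity) (hf _)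
  -- An infinite norm would become 0 under `toReal`; boundedness of ∇u and f(u) excludes this.
  have hfin : eLpNorm (energyDensity f ε u) p (volume.restrict E) ≠ ⊤ := by
    refine ne_top_of_le_ne_top ?_ (eLpNorm_le_of_ae_bound
      (C := 1 / 2 * (n * B) ^ 2 + 1 / ε ^ 2 * Q) ?_)
    · refine ENNReal.mul_ne_top (ENNReal.rpow_ne_top_of_nonneg (by simp) ?_) ENNReal.ofReal_ne_top
      simpa using hEb
    · filter_upwards [ae_restrict_mem hE] with x hx
      rw [energyDensity, Real.norm_of_nonneg (add_nonneg (by positivity) (hen x))]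
      have h1 : frobNorm (fderiv ℝ u x) ≤ n * B := frobNorm_le_of_forall fun i =>
        ((fderiv ℝ u x).le_opNorm _).trans (by simpa using hB x hx)
      have h2 := frobNorm_nonneg (fderiv ℝ u x)
      have h3 := hQ x hx
      gcongr
  have h1 : eLpNorm (fun x => c * frobNorm (fderiv ℝ u x) ^ 2) p (volume.restrict D) ≤
      ENNReal.ofReal (2 * c) * eLpNorm (energyDensity f ε u) p (volume.restrict E) := by
    refine (eLpNorm_le_mul_eLpNorm_of_ae_le_mul (g := energyDensity f ε u) (c := 2 * c)
      (Eventually.of_forall fun x => ?_) p).trans ?_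
    · rw [energyDensity, Real.norm_of_nonneg (by positivity),
        Real.norm_of_nonneg (add_nonneg (by positivity) (hen x))]
      nlinarith [mul_nonneg hc (hen x)]
    · gcongr
  have h2 := ENNReal.toReal_mono (ENNReal.mul_ne_top ENNReal.ofReal_ne_top hfin) h1
  rwa [ENNReal.toReal_mul, ENNReal.toReal_ofReal (by positivity)] at h2

/-- The full gradient at a boundary point is controlled by the tangential gradient of the boundary
data and the normal derivative. -/
theorem frobNorm_le_of_normal {S K : Set (EuclideanSpace ℝ (Fin n))} (hS : IsCompact S)
    (hSK : S ⊆ K) {y ν : EuclideanSpace ℝ (Fin n)} (hy : y ∈ S) {κ : ℝ}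
    (hP : ContDiffAt ℝ 2 (nearestPoint S) y) (hPκ : ‖fderiv ℝ (nearestPoint S) y‖ ≤ 1 / κ)
    (hν : ‖ν‖ = 1) (hνP : ∀ v, ∃ s : ℝ, v - fderiv ℝ (nearestPoint S) y v = s • ν)
    {ub u : EuclideanSpace ℝ (Fin n) → EuclideanSpace ℝ (Fin k)} (hu : ∀ x ∈ S, u x = ub x)
    {A : EuclideanSpace ℝ (Fin n) →L[ℝ] EuclideanSpace ℝ (Fin k)}
    (hA : HasFDerivWithinAt u A K y) :
    frobNorm A ≤ n * (n * tangentialGradNorm S ub y + (1 + 1 / κ) * ‖A ν‖) := by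
  refine frobNorm_le_of_forall fun i => ?_
  set v : EuclideanSpace ℝ (Fin n) := EuclideanSpace.single i 1 with hv
  have hv1 : ‖v‖ = 1 := by simp [hv]
  obtain ⟨c, hc⟩ := hνP v
  have hcn : |c| ≤ 1 + 1 / κ := by
    have h1 : ‖c • ν‖ ≤ ‖v‖ + ‖fderiv ℝ (nearestPoint S) y v‖ := hc ▸ norm_sub_le _ _
    have h2 := (fderiv ℝ (nearestPoint S) y).le_of_opNorm_le hPκ v
    rw [norm_smul, hν, mul_one, Real.norm_eq_abs] at h1
    rw [hv1] at h1 h2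
    linarith
  have hAv : A v = fderiv ℝ (normalExtension S ub) y v + c • A ν := by
    rw [← apply_fderiv_nearestPoint hS hSK hy hP hu hA v, ← map_smul, ← hc, ← map_add]
    congr 1
    abel
  have h3 := norm_fderiv_normalExtension_le (S := S) (ub := ub) y v
  rw [hv1, mul_one] at h3
  rw [hAv]
  refine (norm_add_le _ _).trans (add_le_add h3 ?_)
  rw [norm_smul, Real.norm_eq_abs]
  gcongr

/-- Values of a solution near the vacuum are bounded. -/
theorem exists_bound_near_vacuum {f : EuclideanSpace ℝ (Fin k) → ℝ} (hf : IsNondegeneratePotential f)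
    (hne : (vacuum f).Nonempty) (δ : ℝ) :
    ∃ R Q : ℝ, 0 ≤ R ∧ 0 ≤ Q ∧ ∀ z, infDist z (vacuum f) ≤ δ → ‖z‖ ≤ R ∧ f z ≤ Q ^ 2 := by
  obtain ⟨R₀, hR₀⟩ := hf.isCompact_vacuum.isBounded.subset_closedBall 0
  have hz : ∀ z, infDist z (vacuum f) ≤ δ → ‖z‖ ≤ max (R₀ + δ) 0 := by
    intro z hz
    obtain ⟨q, hq, hd⟩ := hf.isCompact_vacuum.exists_infDist_eq_dist hne z
    have h1 := hR₀ hq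
    rw [mem_closedBall_zero_iff] at h1
    have h2 := norm_le_norm_add_norm_sub' z q
    rw [hd, dist_eq_norm] at hz
    exact le_max_of_le_left (by linarith)
  obtain ⟨Q, hQ⟩ := (isCompact_closedBall (0 : EuclideanSpace ℝ (Fin k))
    (max (R₀ + δ) 0)).bddAbove_image hf.smooth.continuous.continuousOn
  refine ⟨_, √(max Q 0), le_max_right _ _, Real.sqrt_nonneg _, fun z h => ⟨hz z h, ?_⟩⟩
  rw [Real.sq_sqrt (le_max_right _ _)]
  exact (hQ ⟨z, mem_closedBall_zero_iff.2 (hz z h), rfl⟩).trans (le_max_left _ _)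

set_option maxHeartbeats 1000000 in
/-- The normal derivative estimate at a boundary point. -/
theorem exists_norm_apply_normal_le (hn : 3 ≤ n) {Ω : Set (EuclideanSpace ℝ (Fin n))}
    (hΩ : IsSmoothBoundedDomain Ω) {f : EuclideanSpace ℝ (Fin k) → ℝ}
    (hf : IsNondegeneratePotential f) (hne : (vacuum f).Nonempty) {p : ℝ} (hp : (n : ℝ) < p)
    {κ : ℝ} (hκ : 0 < κ) :
    ∃ δ : ℝ, 0 < δ ∧ ∃ c : ℝ, 0 < c ∧ ∀ (r ε : ℝ), 0 < r → r ≤ 1 →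
      ∀ ub u : EuclideanSpace ℝ (Fin n) → EuclideanSpace ℝ (Fin k), IsSmoothSolution Ω f ε ub u →
      (∀ x ∈ frontier Ω, ub x ∈ vacuum f) → ∀ x₀ y ν, y ∈ ball x₀ (r / 2) → y ∈ frontier Ω →
      (∀ x ∈ ball x₀ r ∩ Ω, infDist (u x) (vacuum f) ≤ δ) → ‖ν‖ = 1 →
      (∀ᶠ t : ℝ in 𝓝[>] 0, y + t • ν ∈ Ω) → (∀ z ∈ Ω, κ ≤ dist z (y - κ • ν)) →
      ∀ (A L : EuclideanSpace ℝ (Fin n) →L[ℝ] EuclideanSpace ℝ (Fin k)),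
      HasFDerivWithinAt u A (closure Ω) y → ∀ ℓ τ : ℝ, 0 ≤ ℓ → 0 ≤ τ → (∀ v, ‖L v‖ ≤ ℓ * ‖v‖) →
      (∀ x ∈ frontier Ω, dist x y < κ → ‖u x - u y - L (x - y)‖ ≤ τ * ‖x - y‖ ^ 2) →
      ‖A ν‖ ≤ c * (r ^ (1 - (n : ℝ) / p) *
        (eLpNorm (energyDensity f (ε / r) u) (ENNReal.ofReal p)
          (volume.restrict (ball x₀ r ∩ Ω))).toReal + ℓ + r * τ + δ / r) := by
  obtain ⟨δ, K, C, hδ, hK, hC, hfKC⟩ := hf.exists_sqrt_semiconvex hne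
  obtain ⟨Cb, hCb, hbar⟩ := exists_barrier hn hp hκ
  obtain ⟨R, Q, hR, hQ0, hRQ⟩ := exists_bound_near_vacuum hf hne δ
  have hΩc : IsCompact (closure Ω) := hΩ.isBounded.isCompact_closure
  set κ₁ := min κ 1 with hκ₁
  have hκ₁0 : 0 < κ₁ := lt_min hκ one_pos
  -- Bounds |u(x) − u(y)| + K√f(u(x)); the extra 1 keeps A₀ positive, as the barrier requires.
  set b := 2 * R + K * Q + 1 with hb
  have hb0 : 0 < b := by positivity
  set c₃ := Cb * (2 * n) * (4 * b / (κ₁ * δ)) with hc₃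
  set c₄ := Cb * (2 * (K * C)) with hc₄
  set g := 1 + Cb * (2 * n) with hg
  have hc₃0 : 0 ≤ c₃ := by positivity
  have hc₄0 : 0 ≤ c₄ := by positivity
  have hg0 : 0 < g := by positivity
  refine ⟨δ, hδ, g + c₃ + c₄, by positivity, ?_⟩
  intro r ε hr hr1 ub u hu hub x₀ y ν hy hyf hdist hν hνΩ ho A L hA ℓ τ hℓ0 hτ0 hℓ hτ
  -- Comparable to r, small enough that the closed s-ball about y stays in B_r(x₀), and below the
  -- range κ of the boundary expansion.
  set s := κ₁ * r / 4 with hs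
  have hs0 : 0 < s := by positivity
  have hκ₁1 : κ₁ ≤ 1 := min_le_right _ _
  have hsr : s ≤ r / 4 := by rw [hs]; nlinarith
  have hs1 : s ≤ 1 := by linarith
  have hsκ : s < κ := by
    have : κ₁ ≤ κ := min_le_left _ _
    have : κ₁ * r ≤ κ₁ := mul_le_of_le_one_right hκ₁0.le hr1
    rw [hs]; linarith
  have hball : ∀ x, dist x y ≤ s → x ∈ ball x₀ r := fun x hx => by
    rw [mem_ball] at hy ⊢
    have := dist_triangle x y x₀
    linarith
  have hcl : ∀ x ∈ closure Ω, dist x y ≤ s → infDist (u x) (vacuum f) ≤ δ := by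
    intro x hx hxs
    have h1 : x ∈ closure (ball x₀ r ∩ Ω) := isOpen_ball.inter_closure ⟨hball x hxs, hx⟩
    have h2 : ContinuousWithinAt (fun x => infDist (u x) (vacuum f)) (ball x₀ r ∩ Ω) x :=
      (continuous_infDist_pt _).continuousAt.comp_continuousWithinAt
        ((hu.contDiffOn_closure.continuousOn x hx).mono
          (inter_subset_right.trans subset_closure))
    have := h2.mem_closure_image h1
    exact closure_minimal (by rintro _ ⟨z, hz, rfl⟩; exact hdist z hz) isClosed_Iic this
  have hycl : y ∈ closure Ω := frontier_subset_closure hyf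
  have hf0 : ∀ x ∈ frontier Ω, f (u x) = 0 := fun x hx => by
    rw [hu.boundary x hx]; exact hub x hx
  set A₀ := τ + b / s ^ 2 + ℓ / s with hA₀
  have hA₀0 : 0 < A₀ := by positivity
  have hA₀s : A₀ * s = τ * s + b / s + ℓ := by rw [hA₀]; field_simp
  set T := r ^ (1 - (n : ℝ) / p) * (eLpNorm (energyDensity f (ε / r) u) (ENNReal.ofReal p)
    (volume.restrict (ball x₀ r ∩ Ω))).toReal with hT
  have hT0 : 0 ≤ T := by positivity
  set D := Ω ∩ ball y s with hD
  have hDo : IsOpen D := hΩ.isOpen.inter isOpen_ball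
  have hDsub : D ⊆ ball x₀ r ∩ Ω := fun x hx => ⟨hball x (mem_ball.1 hx.2).le, hx.1⟩
  obtain ⟨B, hB⟩ := exists_bound_fderiv hΩ.isOpen hΩc hu.contDiffOn_closure
  set F : EuclideanSpace ℝ (Fin n) → ℝ := fun x => K * C * frobNorm (fderiv ℝ u x) ^ 2 with hF
  have hFc : ContinuousOn F D := by
    have h1 : ContinuousOn (fderiv ℝ u) Ω :=
      hu.smooth.continuousOn_fderiv_of_isOpen hΩ.isOpen (by simp)
    exact continuousOn_const.mul
      ((continuous_frobNorm.comp_continuousOn (h1.mono inter_subset_left)).pow 2)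
  have hp0 : 0 < p := lt_of_le_of_lt (Nat.cast_nonneg n) hp
  have hexp : 0 ≤ 1 - (n : ℝ) / p := by
    rw [sub_nonneg, div_le_one hp0]; exact hp.le
  have hFle : s ^ (1 - (n : ℝ) / p) *
      (eLpNorm F (ENNReal.ofReal p) (volume.restrict D)).toReal ≤ 2 * (K * C) * T := by
    have h1 := eLpNorm_frobNorm_sq_le hDsub (isOpen_ball.inter hΩ.isOpen).measurableSet
      ((measure_mono inter_subset_left).trans_lt measure_ball_lt_top).ne hf.nonneg
      (fun x hx => hB x hx.2) (fun x hx => (hRQ _ (hdist x hx)).2) (mul_nonneg hK hC) (ε / r)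
      (ENNReal.ofReal p)
    have h2 : s ^ (1 - (n : ℝ) / p) ≤ r ^ (1 - (n : ℝ) / p) :=
      Real.rpow_le_rpow hs0.le (by linarith) hexp
    calc _ ≤ r ^ (1 - (n : ℝ) / p) * (2 * (K * C) *
          (eLpNorm (energyDensity f (ε / r) u) (ENNReal.ofReal p)
            (volume.restrict (ball x₀ r ∩ Ω))).toReal) := by gcongr
      _ = 2 * (K * C) * T := by rw [hT]; ring
  set N := Cb * (2 * (K * C) * T + 2 * n * A₀ * s) with hN
  have hmain : ‖A ν‖ ≤ ℓ + N := by
    refine norm_apply_normal_le hΩ.isOpen hΩc hf hu hK hC hA hν hνΩ hs0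
      (fun x hx => hfKC _ (hdist x (hDsub hx))) ho (by positivity) hℓ0 hτ0 hb0.le hℓ hf0
      (fun x hx hxs => hτ x hx (hxs.trans_lt hsκ)) ?_ hA₀s ?_
    · intro x hx hxs
      have h1 := hRQ _ (hcl x hx hxs)
      have h2 := hRQ _ (hcl y hycl (by simpa using hs0.le))
      have h3 := norm_sub_le (u x) (u y)
      have h4 : √(f (u x)) ≤ Q := Real.sqrt_le_iff.2 ⟨hQ0, h1.2⟩
      have h5 := mul_le_mul_of_nonneg_left h4 hK
      linarith [h1.1, h2.1]
    · intro t ht hts S hSD hS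
      have hn0 : (0 : ℝ) < n := by exact_mod_cast (by omega : 0 < n)
      obtain ⟨w, w₁, w₂, h1, h2, h3, h4, h5, h6⟩ := hbar y ν s hν hs0 hs1 D hDo inter_subset_right
        (fun z hz => ho z hz.1) F (K * C * (n * B) ^ 2) hFc (fun z _ => by positivity)
        (fun z hz => by
          have h1 : frobNorm (fderiv ℝ u z) ≤ n * B := frobNorm_le_of_forall fun i =>
            ((fderiv ℝ u z).le_opNorm _).trans (by simpa using hB z hz.1)
          have h2 := frobNorm_nonneg (fderiv ℝ u z)
          simp only [hF]
          gcongr)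
        (2 * n * A₀) (by positivity) S hSD hS t ht hts
      refine ⟨w, w₁, w₂, h1, h2, h3, h4, h5, h6.trans ?_⟩
      calc _ ≤ Cb * t * (2 * (K * C) * T + 2 * n * A₀ * s) := by gcongr
        _ = t * N := by rw [hN]; ring
  -- Origin of δ/r: since δ is already fixed, b/δ can go into the constant.
  have hbs : b / s = 4 * b / (κ₁ * δ) * (δ / r) := by rw [hs]; field_simp
  have hτs : τ * s ≤ r * τ := by nlinarith
  have hδr : 0 ≤ δ / r := by positivity
  have hrτ : 0 ≤ r * τ := by positivity
  calc ‖A ν‖ ≤ ℓ + N := hmain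
    _ = ℓ + Cb * (2 * n) * (τ * s + ℓ) + c₄ * T + c₃ * (δ / r) := by
        rw [hN, mul_assoc (2 * (n : ℝ)), hA₀s, hbs]; ring
    _ ≤ ℓ + Cb * (2 * n) * (r * τ + ℓ) + c₄ * T + c₃ * (δ / r) := by gcongr
    _ ≤ g * (ℓ + r * τ) + c₄ * T + c₃ * (δ / r) := by rw [hg]; nlinarith
    _ ≤ (g + c₃ + c₄) * (ℓ + r * τ) + (g + c₃ + c₄) * T + (g + c₃ + c₄) * (δ / r) := by
        have h0 : 0 ≤ ℓ + r * τ := by positivity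
        gcongr <;> linarith
    _ = (g + c₃ + c₄) * (T + ℓ + r * τ + δ / r) := by ring

end

end GinzburgLandau

end

/-! ### The boundary gradient estimate -/

theorem mainTheorem4 {n k : ℕ} (hn : 3 ≤ n)
    (Ω : Set (EuclideanSpace ℝ (Fin n))) (hΩ : GinzburgLandau.IsSmoothBoundedDomain Ω)
    (f : EuclideanSpace ℝ (Fin k) → ℝ) (hf : GinzburgLandau.IsNondegeneratePotential f)
    (p : ℝ) (hp : (n : ℝ) < p) :
    ∃ δ : ℝ, 0 < δ ∧ ∃ C : ℝ, 0 < C ∧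
      ∀ x₀ ∈ closure Ω, ∀ r : ℝ, 0 < r → r ≤ 1 → ∀ ε : ℝ, 0 < ε → ε ≤ 1 →
      ∀ ub u : EuclideanSpace ℝ (Fin n) → EuclideanSpace ℝ (Fin k),
        GinzburgLandau.IsC2On (frontier Ω) ub →
        (∀ x ∈ frontier Ω, ub x ∈ GinzburgLandau.vacuum f) →
        GinzburgLandau.IsSmoothSolution Ω f ε ub u →
        (∀ x ∈ ball x₀ r ∩ Ω, infDist (u x) (GinzburgLandau.vacuum f) ≤ δ) →
        ∀ y ∈ ball x₀ (r / 2) ∩ frontier Ω,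
          GinzburgLandau.frobNorm (fderivWithin ℝ u (closure Ω) y) ≤
            C * (r ^ (1 - (n : ℝ) / p) *
                  (eLpNorm (GinzburgLandau.energyDensity f (ε / r) u) (ENNReal.ofReal p)
                    (volume.restrict (ball x₀ r ∩ Ω))).toReal
                + r ^ (-((n : ℝ) / 2)) *
                  (eLpNorm (fun x => GinzburgLandau.frobNorm (fderiv ℝ u x)) 2
                    (volume.restrict (ball x₀ r ∩ Ω))).toReal
                + (⨆ x : frontier Ω, GinzburgLandau.tangentialGradNorm (frontier Ω) ub x)
                + r * (⨆ x : frontier Ω, GinzburgLandau.tangentialHessNorm (frontier Ω) ub x)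
                + δ / r) := by
  -- With an empty vacuum, no data exist at the boundary point in question.
  rcases (GinzburgLandau.vacuum f).eq_empty_or_nonempty with hemp | hne
  · refine ⟨1, one_pos, 1, one_pos, ?_⟩
    intro x₀ _ r _ _ ε _ _ ub u _ hub _ _ y hy
    have := hub y hy.2
    simp [hemp] at this
  obtain ⟨κ, hκ, hgeo⟩ := hΩ.exists_uniform_geometry
  obtain ⟨δ, hδ, c, hc, hmain⟩ :=
    GinzburgLandau.exists_norm_apply_normal_le hn hΩ hf hne hp hκ
  set a : ℝ := n / κ with ha
  set a₂ : ℝ := n ^ 2 / κ ^ 2 with ha₂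
  set c' := (1 + 1 / κ) * c with hc'
  have ha0 : 0 ≤ a := by positivity
  have ha₂0 : 0 ≤ a₂ := by positivity
  have hc'0 : 0 < c' := by positivity
  refine ⟨δ, hδ, n * (n + c' * (1 + 2 * a + a₂)) + 1, by positivity, ?_⟩
  intro x₀ _ r hr hr1 ε _ _ ub u hC2 hub hu hdist y hy
  set S := frontier Ω with hS
  have hSc : IsCompact S := hΩ.isCompact_frontier
  have hP : ∀ x ∈ S, ContDiffAt ℝ 2 (GinzburgLandau.nearestPoint S) x := fun x hx =>
    ((hgeo x hx).1 x (mem_ball_self hκ)).1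
  set M₁ := ⨆ x : S, GinzburgLandau.tangentialGradNorm S ub x with hM₁
  set M₂ := ⨆ x : S, GinzburgLandau.tangentialHessNorm S ub x with hM₂
  have hM₁0 : 0 ≤ M₁ := Real.iSup_nonneg fun x => GinzburgLandau.frobNorm_nonneg _
  have hM₂0 : 0 ≤ M₂ := Real.iSup_nonneg fun x => Real.sqrt_nonneg _
  have h₁ : ∀ x ∈ S, GinzburgLandau.tangentialGradNorm S ub x ≤ M₁ := fun x hx =>
    le_ciSup (GinzburgLandau.bddAbove_tangentialGradNorm hSc hP hC2) (⟨x, hx⟩ : S)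
  have h₂ : ∀ x ∈ S, GinzburgLandau.tangentialHessNorm S ub x ≤ M₂ := fun x hx =>
    le_ciSup (GinzburgLandau.bddAbove_tangentialHessNorm hSc hP hC2) (⟨x, hx⟩ : S)
  obtain ⟨hyb, hyS⟩ := hy
  obtain ⟨hy₁, ν, hν, hνP, hνΩ, ho⟩ := hgeo y hyS
  have hA : HasFDerivWithinAt u (fderivWithin ℝ u (closure Ω) y) (closure Ω) y :=
    ((hu.contDiffOn_closure.differentiableOn (by simp)) y
      (frontier_subset_closure hyS)).hasFDerivWithinAt
  set A := fderivWithin ℝ u (closure Ω) y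
  have hPy := hy₁ y (mem_ball_self hκ)
  have hfrob := GinzburgLandau.frobNorm_le_of_normal hSc frontier_subset_closure hyS hPy.1 hPy.2.1
    hν hνP hu.boundary hA
  -- This composition is the map L to be subtracted: the linear part of the boundary Taylor
  -- expansion.
  have hL : ∀ v, ‖((fderiv ℝ (GinzburgLandau.normalExtension S ub) y).comp
      (fderiv ℝ (GinzburgLandau.nearestPoint S) y)) v‖ ≤ a * M₁ * ‖v‖ := fun v => by
    refine (GinzburgLandau.norm_fderiv_normalExtension_le y _).trans ?_
    calc _ ≤ n * M₁ * (1 / κ * ‖v‖) := by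
          gcongr
          · exact h₁ y hyS
          · exact ContinuousLinearMap.le_of_opNorm_le _ hPy.2.1 v
      _ = a * M₁ * ‖v‖ := by rw [ha]; ring
  have hnormal := hmain r ε hr hr1 ub u hu hub x₀ y ν hyb hyS hdist hν hνΩ ho A _ hA (a * M₁)
    (a * M₁ + a₂ * M₂) (by positivity) (by positivity) hL (fun x hx hxy => by
      rw [hu.boundary x hx, hu.boundary y hyS]
      exact GinzburgLandau.norm_boundary_taylor_le hSc hκ (fun z hz => (hgeo z hz).1) hC2 h₁ h₂ hx
        hyS hxy)
  set T := r ^ (1 - (n : ℝ) / p) * (eLpNorm (GinzburgLandau.energyDensity f (ε / r) u)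
    (ENNReal.ofReal p) (volume.restrict (ball x₀ r ∩ Ω))).toReal with hT
  set T₂ := r ^ (-((n : ℝ) / 2)) * (eLpNorm (fun x => GinzburgLandau.frobNorm (fderiv ℝ u x)) 2
    (volume.restrict (ball x₀ r ∩ Ω))).toReal with hT₂
  have hT0 : 0 ≤ T := by positivity
  have hT₂0 : 0 ≤ T₂ := by positivity
  have hδr : 0 ≤ δ / r := by positivity
  have hrM₂ : 0 ≤ r * M₂ := by positivity
  set G := T + T₂ + M₁ + r * M₂ + δ / r with hG
  have hG0 : 0 ≤ G := by positivity
  have hM₁G : M₁ ≤ G := by linarith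
  have hin : T + a * M₁ + r * (a * M₁ + a₂ * M₂) + δ / r ≤ (1 + 2 * a + a₂) * G := by
    -- The first-order contribution to τ comes from the second derivative of the nearest point map;
    -- r ≤ 1 absorbs it into M₁.
    have e1 : r * (a * M₁) ≤ a * M₁ := mul_le_of_le_one_left (by positivity) hr1
    have e2 : a * M₁ ≤ a * G := by gcongr
    have e3 : a₂ * (r * M₂) ≤ a₂ * G := by
      gcongr
      linarith
    have e4 : T + δ / r ≤ G := by linarith
    nlinarith
  calc GinzburgLandau.frobNorm A
      ≤ n * (n * GinzburgLandau.tangentialGradNorm S ub y + (1 + 1 / κ) * ‖A ν‖) := hfrob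
    _ ≤ n * (n * G + (1 + 1 / κ) * (c * ((1 + 2 * a + a₂) * G))) := by
        gcongr
        · exact (h₁ y hyS).trans hM₁G
        · exact hnormal.trans (by gcongr)
    _ = n * (n + c' * (1 + 2 * a + a₂)) * G := by rw [hc']; ring
    _ ≤ (n * (n + c' * (1 + 2 * a + a₂)) + 1) * G := by linarith
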